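/- All manifolds, maps and forms are smooth ($C^\infty$); manifolds are Hausdorff and $\sigma$-compact. Let $\pi:Y\to X$ be a surjective submersion with $\dim X=n$ and $\dim Y=n+m$, and let $\lambda:J^rY\to\Lambda^nT^*X$ be a Lagrangian of arbitrary order $r\ge 0$, i.e. a fibered morphism over $X$, written $\lambda=L(x^i,y^\sigma_I)\,ds$ in fibered coordinates. Let $D\subseteq X$ be an oriented compact $n$-dimensional submanifold with boundary, let $A_D[\gamma]=\int_D (j^r\gamma)^*\lambda$ be the action, and let $\Gamma^\tau_D$ be the set of sections over $D$ (smooth on a neighbourhood of $D$) that equal a given $\tau$ on $\partial D$. For $\gamma\in\Gamma^\tau_D$ let $T_\gamma\Gamma^\tau_D$ be the space of $\pi$-vertical vector fields along $\gamma$, smooth on a neighbourhood of $D$, that vanish on $\partial D$ and on $X\setminus D$. An extension of $\nu\in T_\gamma\Gamma^\tau_D$ is a vertical vector field $\Xi$ on $Y$ with $\Xi\circ\gamma=\nu$ on $D$ that vanishes on the fibres over $\partial D\cup (X\setminus D)$. The section $\gamma$ is an extremal if $\frac{d}{dt}\big|_{t=0}A_D[\Gamma(t)]=0$ for every one-parameter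 variation $\Gamma$ of $\gamma$ through sections whose variation field $\partial_t\Gamma|_{t=0}$ along $\gamma$ belongs to $T_\gamma\Gamma^\tau_D$. The Hessian of $A_D$ along an extremal $\gamma$ is $$\mathcal H(A_D)[\gamma](\nu,\kappa)=\frac{\partial^2}{\partial t_1\partial t_2}A_D[\Gamma(t_1,t_2)]\Big|_{t_1=t_2=0},\qquad \nu,\kappa\in T_\gamma\Gamma^\tau_D,$$ where $\Gamma$ is any two-parameter variation of $\gamma$ through sections with $\Gamma(0,0)=\gamma$, $\partial_{t_1}\Gamma(t_1,0)|_{t_1=0}=\Xi_1\circ\gamma$ and $\partial_{t_2}\Gamma(t_1,t_2)|_{t_2=0}=\Xi_2\circ\Gamma(t_1,0)$, for any extensions $\Xi_1$ of $\nu$ and $\Xi_2$ of $\kappa$. Let $E_n(L\,ds)=E_\sigma(L)\,\omega^\sigma\wedge ds$ be the Euler--Lagrange form, $E_\sigma(L)=\sum_{|J|}(-1)^{|J|}d_J\big(\partial L/\partial y^\sigma_J\big)$, where $\omega^\sigma=dy^\sigma-y^\sigma_i\,dx^i$. A field $\nu\in T_\gamma\Gamma^\tau_D$ is a Jacobi field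 along $\gamma$ if, for extensions $\Xi$ of $\nu$, the form $E_n\big(\Xi\rfloor E_n(\lambda)\big)$ vanishes along $\gamma$ over $D$; here $\Xi\rfloor E_n(\lambda)=\Xi^\sigma E_\sigma(L)\,ds$ is regarded as a Lagrangian of order $2r$. Proposition. Let $\gamma\in\Gamma^\tau_D$ be an extremal and let $\nu\in T_\gamma\Gamma^\tau_D$. For every $\kappa\in T_\gamma\Gamma^\tau_D$ the Hessian $\mathcal H(A_D)[\gamma](\nu,\kappa)$ is well defined: extensions and variations as above exist, and the second derivative exists and is the same for all of them. Moreover $\nu$ lies in the null space of the Hessian, i.e. $\mathcal H(A_D)[\gamma](\nu,\kappa)=0$ for all $\kappa\in T_\gamma\Gamma^\tau_D$, if and only if $\nu$ is a Jacobi field along $\gamma$. -/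

import Mathlib

open Set Filter Topology MeasureTheory
open scoped Manifold ContDiff

noncomputable section

namespace VarCalc

/-! ### Coordinates on jets -/

abbrev Eu (n : ℕ) : Type := EuclideanSpace ℝ (Fin n)

/-- Multi-indices: `k`-tuples of indices in `Fin n`, of length `k ≤ r`. -/
abbrev MultiIdx (n r : ℕ) : Type := Σ k : Fin (r + 1), (Fin (k : ℕ) → Fin n)

/-- The multi-index of length zero. -/
def MultiIdx.empty (n r : ℕ) : MultiIdx n r := ⟨0, fun j => j.elim0⟩

/-- Coordinates `(xⁱ, y^σ_I)`, `|I| ≤ r`, of jets of order `r`. All tuples `I` are used; the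
coordinates of an actual jet are symmetric in the entries of `I`. -/
abbrev JetCoord (n m r : ℕ) : Type := Eu n × (MultiIdx n r → Eu m)

/-- The iterated partial derivative `∂^|I| f / ∂x^I` at `u`. -/
def iterPartial {n : ℕ} {G : Type*} [NormedAddCommGroup G] [NormedSpace ℝ G]
    {k : ℕ} (I : Fin k → Fin n) (f : Eu n → G) (u : Eu n) : G :=
  iteratedFDeriv ℝ k f u (fun j => EuclideanSpace.single (I j) (1 : ℝ))

/-- The coordinates of the `r`-jet of `f` at `u`. -/
def jetCoord {n m : ℕ} (r : ℕ) (f : Eu n → Eu m) (u : Eu n) : JetCoord n m r :=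
  (u, fun I => iterPartial I.2 f u)

/-- The Taylor polynomial with given jet coordinates. Its derivatives at the base point are the
symmetrizations of the given coordinates. -/
def taylorPoly {n m r : ℕ} (p : JetCoord n m r) (v : Eu n) : Eu m :=
  ∑ I : MultiIdx n r,
    (((Nat.factorial (I.1 : ℕ) : ℝ))⁻¹ * ∏ j, (v - p.1) (I.2 j)) • p.2 I

/-- `∂L / ∂y^σ_I`. With `L` depending only on the symmetrization of the coordinates, this contains
the numerical factor that allows sums to run over all tuples `I`. -/
def partialJet {n m r : ℕ} (L : JetCoord n m r → ℝ) (σ : Fin m) (I : MultiIdx n r)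
    (p : JetCoord n m r) : ℝ :=
  fderiv ℝ L p (0, Pi.single I (EuclideanSpace.single σ (1 : ℝ)))

/-- The Euler–Lagrange expression `E_σ(L) = ∑_{|I| ≤ r} (-1)^|I| d_I (∂L/∂y^σ_I)` at the jet of `f`
at `u`; a total derivative evaluated on a jet prolongation is the partial derivative of the
composite. -/
def eulerExpr {n m r : ℕ} (L : JetCoord n m r → ℝ) (f : Eu n → Eu m) (u : Eu n) (σ : Fin m) : ℝ :=
  ∑ I : MultiIdx n r,
    (-1 : ℝ) ^ (I.1 : ℕ) * iterPartial I.2 (fun v => partialJet L σ I (jetCoord r f v)) u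

/-- The Lagrangian `Ξ ⌟ E(L) = Ξ^σ E_σ(L)` of order `2r`, as a function of the jet coordinates of
order `2r`, for a vertical field with components `Ξ^σ(x, y)`. -/
def contractEuler {n m r : ℕ} (Ξ : Eu n × Eu m → Eu m) (L : JetCoord n m r → ℝ) :
    JetCoord n m (2 * r) → ℝ :=
  fun p => ∑ σ : Fin m,
    Ξ (p.1, p.2 (MultiIdx.empty n (2 * r))) σ * eulerExpr L (taylorPoly p) p.1 σ

section

variable {n m : ℕ} {X Y : Type*}
  [TopologicalSpace X] [ChartedSpace (Eu n) X]
  [TopologicalSpace Y] [ChartedSpace (Eu n × Eu m) Y]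

/-! ### Fibered manifolds, sections, jets -/

/-- A surjective submersion `Y → X`, with `dim X = n`, `dim Y = n + m`. -/
def IsFibered (n m : ℕ) {X Y : Type*}
    [TopologicalSpace X] [ChartedSpace (Eu n) X]
    [TopologicalSpace Y] [ChartedSpace (Eu n × Eu m) Y]
    (π : Y → X) : Prop :=
  Function.Surjective π ∧ Manifold.IsSubmersion 𝓘(ℝ, Eu n × Eu m) 𝓘(ℝ, Eu n) ∞ π

/-- Fibered coordinates: a chart `(xⁱ, y^σ)` of `Y` over a chart `(xⁱ)` of `X`. -/
structure FiberedChart (n m : ℕ) {X Y : Type*}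
    [TopologicalSpace X] [ChartedSpace (Eu n) X]
    [TopologicalSpace Y] [ChartedSpace (Eu n × Eu m) Y]
    (π : Y → X) where
  tot : OpenPartialHomeomorph Y (Eu n × Eu m)
  base : OpenPartialHomeomorph X (Eu n)
  tot_mem : tot ∈ IsManifold.maximalAtlas 𝓘(ℝ, Eu n × Eu m) ∞ Y
  base_mem : base ∈ IsManifold.maximalAtlas 𝓘(ℝ, Eu n) ∞ X
  mapsTo : ∀ y ∈ tot.source, π y ∈ base.source
  fst_eq : ∀ y ∈ tot.source, (tot y).1 = base (π y)

/-- `γ` is a smooth section of `π` over the open set `U` (its values outside `U` are irrelevant). -/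
def IsSectionOn (n m : ℕ) {X Y : Type*}
    [TopologicalSpace X] [ChartedSpace (Eu n) X]
    [TopologicalSpace Y] [ChartedSpace (Eu n × Eu m) Y]
    (π : Y → X) (γ : X → Y) (U : Set X) : Prop :=
  IsOpen U ∧ ContMDiffOn 𝓘(ℝ, Eu n) 𝓘(ℝ, Eu n × Eu m) ∞ γ U ∧ ∀ x ∈ U, π (γ x) = x

/-- `γ` is a smooth section of `π` in a neighbourhood of `x`. -/
def IsSectionAt (n m : ℕ) {X Y : Type*}
    [TopologicalSpace X] [ChartedSpace (Eu n) X]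
    [TopologicalSpace Y] [ChartedSpace (Eu n × Eu m) Y]
    (π : Y → X) (x : X) (γ : X → Y) : Prop :=
  ∃ U : Set X, x ∈ U ∧ IsSectionOn n m π γ U

/-- The components `γ^σ(xⁱ)` of a section in fibered coordinates. -/
def FiberedChart.rep {π : Y → X} (ψ : FiberedChart n m π) (γ : X → Y) (u : Eu n) : Eu m :=
  (ψ.tot (γ (ψ.base.symm u))).2

/-- Two local sections around `x` have the same `r`-jet at `x`: same value, and same partial
derivatives up to order `r` in fibered coordinates. -/
def jetSetoid (n m : ℕ) {X Y : Type*}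
    [TopologicalSpace X] [ChartedSpace (Eu n) X]
    [TopologicalSpace Y] [ChartedSpace (Eu n × Eu m) Y]
    (π : Y → X) (r : ℕ) (x : X) : Setoid {γ : X → Y // IsSectionAt n m π x γ} where
  r γ γ' := γ.1 x = γ'.1 x ∧ ∀ ψ : FiberedChart n m π, γ.1 x ∈ ψ.tot.source →
    ∀ k ≤ r, iteratedFDeriv ℝ k (ψ.rep γ.1) (ψ.base x) =
      iteratedFDeriv ℝ k (ψ.rep γ'.1) (ψ.base x)
  iseqv :=
    { refl := fun _ => ⟨rfl, fun _ _ _ _ => rfl⟩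
      symm := fun h => ⟨h.1.symm, fun ψ hψ k hk => (h.2 ψ (h.1 ▸ hψ) k hk).symm⟩
      trans := fun h h' => ⟨h.1.trans h'.1, fun ψ hψ k hk =>
        (h.2 ψ hψ k hk).trans (h'.2 ψ (h.1 ▸ hψ) k hk)⟩ }

/-- The jet space `J^r π`. -/
def Jet (n m : ℕ) {X Y : Type*}
    [TopologicalSpace X] [ChartedSpace (Eu n) X]
    [TopologicalSpace Y] [ChartedSpace (Eu n × Eu m) Y]
    (π : Y → X) (r : ℕ) : Type _ := Σ x : X, Quotient (jetSetoid n m π r x)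

/-- The jet `j^r_x γ`. -/
def jet {π : Y → X} (r : ℕ) {x : X} {γ : X → Y} (h : IsSectionAt n m π x γ) : Jet n m π r :=
  ⟨x, Quotient.mk (jetSetoid n m π r x) ⟨γ, h⟩⟩

/-- The local section whose components in fibered coordinates are a Taylor polynomial. -/
def FiberedChart.taylorSection {π : Y → X} (ψ : FiberedChart n m π) {r : ℕ} (p : JetCoord n m r) :
    X → Y :=
  fun z => ψ.tot.symm (ψ.base z, taylorPoly p (ψ.base z))

/-- The open set of jet coordinates over a fibered chart. -/
def FiberedChart.jetDomain {π : Y → X} (ψ : FiberedChart n m π) (r : ℕ) : Set (JetCoord n m r) :=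
  {p | (p.1, p.2 (MultiIdx.empty n r)) ∈ ψ.tot.target}

theorem taylorPoly_self {r : ℕ} (p : JetCoord n m r) :
    taylorPoly p p.1 = p.2 (MultiIdx.empty n r) := by
  unfold taylorPoly
  rw [Finset.sum_eq_single (MultiIdx.empty n r)]
  · change (((Nat.factorial 0 : ℝ))⁻¹ * ∏ j : Fin 0, _) • _ = _
    simp
  · rintro ⟨⟨k, hk⟩, I⟩ - hI
    rcases k with _ | k
    · exact absurd (by
        refine Sigma.ext rfl (heq_of_eq ?_)
        funext j
        exact j.elim0) hI
    · simp
  · simp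

theorem contDiff_taylorPoly {r : ℕ} (p : JetCoord n m r) : ContDiff ℝ ∞ (taylorPoly p) := by
  unfold taylorPoly
  fun_prop

theorem FiberedChart.base_mem_target {π : Y → X} (ψ : FiberedChart n m π) {q : Eu n × Eu m}
    (hq : q ∈ ψ.tot.target) : q.1 = ψ.base (π (ψ.tot.symm q)) ∧ q.1 ∈ ψ.base.target := by
  have h := ψ.fst_eq _ (ψ.tot.map_target hq)
  rw [ψ.tot.right_inv hq] at h
  exact ⟨h, h ▸ ψ.base.map_source (ψ.mapsTo _ (ψ.tot.map_target hq))⟩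

theorem FiberedChart.isSectionAt_taylorSection {π : Y → X} (ψ : FiberedChart n m π) {r : ℕ}
    {p : JetCoord n m r} (hp : p ∈ ψ.jetDomain r) :
    IsSectionAt n m π (ψ.base.symm p.1) (ψ.taylorSection p) := by
  have hp1 : p.1 ∈ ψ.base.target := (ψ.base_mem_target hp).2
  have hsm : ContDiff ℝ ∞ (fun u : Eu n => (u, taylorPoly p u)) :=
    contDiff_id.prodMk (contDiff_taylorPoly p)
  refine ⟨ψ.base.source ∩ ψ.base ⁻¹' ((fun u => (u, taylorPoly p u)) ⁻¹' ψ.tot.target),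
    ⟨ψ.base.map_target hp1, ?_⟩, ?_, ?_, ?_⟩
  · simp only [mem_preimage, ψ.base.right_inv hp1, taylorPoly_self]
    exact hp
  · exact ψ.base.isOpen_inter_preimage (ψ.tot.open_target.preimage hsm.continuous)
  · refine (contMDiffOn_symm_of_mem_maximalAtlas ψ.tot_mem).comp
      (t := ψ.tot.target) (f := fun z => (ψ.base z, taylorPoly p (ψ.base z))) ?_ (fun z hz => hz.2)
    exact hsm.contMDiff.comp_contMDiffOn
      ((contMDiffOn_of_mem_maximalAtlas ψ.base_mem).mono inter_subset_left)
  · rintro z ⟨hz, hz'⟩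
    have h := (ψ.base_mem_target hz').1
    exact (ψ.base.injOn hz (ψ.mapsTo _ (ψ.tot.map_target hz')) h).symm

/-! ### Top-degree forms, Lagrangians, the action -/

/-- Alternating `n`-forms on the tangent space at `x`, i.e. the fibre of `Λⁿ T*X` at `x`. -/
abbrev TopForm (n : ℕ) {X : Type*} [TopologicalSpace X] [ChartedSpace (Eu n) X] (x : X) : Type :=
  (TangentSpace 𝓘(ℝ, Eu n) x) [⋀^Fin n]→L[ℝ] ℝ

/-- The coordinate vector `∂/∂xⁱ` of a chart at `x`. -/
def coordVec (φ : OpenPartialHomeomorph X (Eu n)) (x : X) (i : Fin n) :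
    TangentSpace 𝓘(ℝ, Eu n) x :=
  mfderiv 𝓘(ℝ, Eu n) 𝓘(ℝ, Eu n) φ.symm (φ x) (EuclideanSpace.single i (1 : ℝ) : Eu n)

/-- The coefficient `a` in `α = a dx¹ ∧ … ∧ dxⁿ`. -/
def coeff (φ : OpenPartialHomeomorph X (Eu n)) {x : X} (α : TopForm n x) : ℝ :=
  α (coordVec φ x)

open Classical in
/-- The coordinate expression `L(xⁱ, y^σ_I)` of a horizontal `n`-form `L ds` on the jet space (and
zero outside the domain of the fibered chart). -/
def localDensity {π : Y → X} {r : ℕ} (l : ∀ θ : Jet n m π r, TopForm n θ.1)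
    (ψ : FiberedChart n m π) (p : JetCoord n m r) : ℝ :=
  if hp : p ∈ ψ.jetDomain r then
    coeff ψ.base (l (jet r (ψ.isSectionAt_taylorSection hp)))
  else 0

/-- A Lagrangian of order `r`: a smooth fibered morphism `J^r π → Λⁿ T*X` over `X`. -/
structure Lagrangian (n m : ℕ) {X Y : Type*}
    [TopologicalSpace X] [ChartedSpace (Eu n) X]
    [TopologicalSpace Y] [ChartedSpace (Eu n × Eu m) Y]
    (π : Y → X) (r : ℕ) where
  toFun : ∀ θ : Jet n m π r, TopForm n θ.1
  smooth : ∀ ψ : FiberedChart n m π, ContDiffOn ℝ ∞ (localDensity toFun ψ) (ψ.jetDomain r)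

open Classical in
/-- The pull-back `(j^r γ)^* λ`. -/
def Lagrangian.pullback {π : Y → X} {r : ℕ} (l : Lagrangian n m π r) (γ : X → Y) (x : X) :
    TopForm n x :=
  if h : IsSectionAt n m π x γ then l.toFun (jet r h) else 0

/-- An `n`-region: a compact `n`-dimensional submanifold with boundary. Around a boundary point it
is a half space in suitable coordinates. -/
def IsRegion (n : ℕ) {X : Type*} [TopologicalSpace X] [ChartedSpace (Eu n) X] (D : Set X) : Prop :=
  IsCompact D ∧ ∀ x ∈ frontier D,
    ∃ φ ∈ IsManifold.maximalAtlas 𝓘(ℝ, Eu n) ∞ X, ∃ i : Fin n,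
      x ∈ φ.source ∧ φ x i = 0 ∧ ∀ z ∈ φ.source, z ∈ D ↔ 0 ≤ φ z i

/-- An orientation of `D`, given by a continuous nowhere vanishing `n`-form. -/
def IsOrientation (D : Set X) (o : ∀ x : X, TopForm n x) : Prop :=
  (∀ x ∈ D, o x ≠ 0) ∧
    ∀ φ ∈ IsManifold.maximalAtlas 𝓘(ℝ, Eu n) ∞ X,
      ContinuousOn (fun x => coeff φ (o x)) (φ.source ∩ D)

/-- A smooth partition of unity subordinate to the preferred charts. -/
def chartPartition (n : ℕ) (X : Type*) [TopologicalSpace X] [ChartedSpace (Eu n) X]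
    [IsManifold 𝓘(ℝ, Eu n) ∞ X] [T2Space X] [SigmaCompactSpace X] :
    SmoothPartitionOfUnity X 𝓘(ℝ, Eu n) X univ :=
  Classical.choose (SmoothPartitionOfUnity.exists_isSubordinate_chartAt_source 𝓘(ℝ, Eu n) X)

/-- The integral over `D`, with the orientation of `o`, of an `n`-form: in each chart of a
subordinate partition of unity it is `± ∫ ρ a dx¹ … dxⁿ`, with the sign `+` if the chart is
positively oriented and `-` otherwise. -/
def integralForm [IsManifold 𝓘(ℝ, Eu n) ∞ X] [T2Space X] [SigmaCompactSpace X]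
    (o : ∀ x : X, TopForm n x) (D : Set X) (α : ∀ x : X, TopForm n x) : ℝ :=
  ∑ᶠ c : X, ∫ u in (chartAt (Eu n) c).target ∩ (chartAt (Eu n) c).symm ⁻¹' D,
    chartPartition n X c ((chartAt (Eu n) c).symm u) *
      (Real.sign (coeff (chartAt (Eu n) c) (o ((chartAt (Eu n) c).symm u))) *
        coeff (chartAt (Eu n) c) (α ((chartAt (Eu n) c).symm u)))

/-- The action `A_D[γ] = ∫_D (j^r γ)^* λ`. -/
def action [IsManifold 𝓘(ℝ, Eu n) ∞ X] [T2Space X] [SigmaCompactSpace X] {π : Y → X} {r : ℕ}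
    (l : Lagrangian n m π r) (o : ∀ x : X, TopForm n x) (D : Set X) (γ : X → Y) : ℝ :=
  integralForm o D (l.pullback γ)

/-! ### Sections over `D`, their variations, and vertical fields -/

/-- `Γ^τ_D`: the smooth sections over `D` (smooth sections over a neighbourhood of `D`) that equal
`τ` on `∂D`. -/
def sectionsRel (n m : ℕ) {X Y : Type*}
    [TopologicalSpace X] [ChartedSpace (Eu n) X]
    [TopologicalSpace Y] [ChartedSpace (Eu n × Eu m) Y]
    (π : Y → X) (D : Set X) (τ : X → Y) : Set (X → Y) :=
  {γ | (∃ U : Set X, D ⊆ U ∧ IsSectionOn n m π γ U) ∧ ∀ x ∈ frontier D, γ x = τ x}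

/-- `T_γ Γ^τ_D`: smooth vertical vector fields along `γ`, defined near `D`, that vanish on `∂D` and
outside `D`. -/
structure TangentField (n m : ℕ) {X Y : Type*}
    [TopologicalSpace X] [ChartedSpace (Eu n) X]
    [TopologicalSpace Y] [ChartedSpace (Eu n × Eu m) Y] [IsManifold 𝓘(ℝ, Eu n × Eu m) ∞ Y]
    (π : Y → X) (D : Set X) (γ : X → Y) where
  toFun : ∀ x : X, TangentSpace 𝓘(ℝ, Eu n × Eu m) (γ x)
  smooth : ∃ U : Set X, IsOpen U ∧ D ⊆ U ∧
    ContMDiffOn 𝓘(ℝ, Eu n) (𝓘(ℝ, Eu n × Eu m).tangent) ∞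
      (fun x => (⟨γ x, toFun x⟩ : TangentBundle 𝓘(ℝ, Eu n × Eu m) Y)) U
  vertical : ∀ x ∈ D, mfderiv 𝓘(ℝ, Eu n × Eu m) 𝓘(ℝ, Eu n) π (γ x) (toFun x) = 0
  zero : ∀ x, x ∉ interior D → toFun x = 0

/-- A smooth vertical vector field on `Y` that vanishes on the fibres over `∂D` and `X \ D` and
extends `ν`. -/
structure IsExtension [IsManifold 𝓘(ℝ, Eu n × Eu m) ∞ Y] {π : Y → X} {D : Set X} {γ : X → Y}
    (Ξ : ∀ y : Y, TangentSpace 𝓘(ℝ, Eu n × Eu m) y) (ν : TangentField n m π D γ) : Prop where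
  smooth : ContMDiff 𝓘(ℝ, Eu n × Eu m) (𝓘(ℝ, Eu n × Eu m).tangent) ∞
    (fun y => (⟨y, Ξ y⟩ : TangentBundle 𝓘(ℝ, Eu n × Eu m) Y))
  vertical : ∀ y, mfderiv 𝓘(ℝ, Eu n × Eu m) 𝓘(ℝ, Eu n) π y (Ξ y) = 0
  zero : ∀ y, π y ∉ interior D → Ξ y = 0
  extends_field : ∀ x ∈ D, Ξ (γ x) = ν.toFun x

/-- The velocity of a curve in `Y` at the parameter `0`, a point of `TY`. -/
def velocity (c : ℝ → Y) : TangentBundle 𝓘(ℝ, Eu n × Eu m) Y :=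
  ⟨c 0, mfderiv 𝓘(ℝ, ℝ) 𝓘(ℝ, Eu n × Eu m) c 0 (1 : ℝ)⟩

/-- `Γ` is a one-parameter variation of `γ` (over a neighbourhood of `D`) whose variation vector
field along `γ` is `ν`. -/
def IsVariation [IsManifold 𝓘(ℝ, Eu n × Eu m) ∞ Y] {π : Y → X} {D : Set X} {γ : X → Y} (ν : TangentField n m π D γ) (Γ : ℝ → X → Y) :
    Prop :=
  ∃ ε > (0 : ℝ), ∃ U : Set X, IsOpen U ∧ D ⊆ U ∧
    ContMDiffOn (𝓘(ℝ, ℝ).prod 𝓘(ℝ, Eu n)) 𝓘(ℝ, Eu n × Eu m) ∞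
      (fun q : ℝ × X => Γ q.1 q.2) (Ioo (-ε) ε ×ˢ U) ∧
    (∀ t ∈ Ioo (-ε) ε, ∀ x ∈ U, π (Γ t x) = x) ∧
    (∀ x ∈ U, Γ 0 x = γ x) ∧
    ∀ x ∈ U, velocity (fun t => Γ t x) =
      (⟨γ x, ν.toFun x⟩ : TangentBundle 𝓘(ℝ, Eu n × Eu m) Y)

/-- `Γ` is a two-parameter variation of `γ` (over a neighbourhood of `D`) generated by the vector
fields `Ξ₁` and `Ξ₂`. -/
def IsVariation₂ (n m : ℕ) {X Y : Type*}
    [TopologicalSpace X] [ChartedSpace (Eu n) X]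
    [TopologicalSpace Y] [ChartedSpace (Eu n × Eu m) Y]
    (π : Y → X) (D : Set X) (γ : X → Y)
    (Ξ₁ Ξ₂ : ∀ y : Y, TangentSpace 𝓘(ℝ, Eu n × Eu m) y) (Γ : ℝ → ℝ → X → Y) : Prop :=
  ∃ ε > (0 : ℝ), ∃ U : Set X, IsOpen U ∧ D ⊆ U ∧
    ContMDiffOn ((𝓘(ℝ, ℝ).prod 𝓘(ℝ, ℝ)).prod 𝓘(ℝ, Eu n)) 𝓘(ℝ, Eu n × Eu m) ∞
      (fun q : (ℝ × ℝ) × X => Γ q.1.1 q.1.2 q.2) ((Ioo (-ε) ε ×ˢ Ioo (-ε) ε) ×ˢ U) ∧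
    (∀ t₁ ∈ Ioo (-ε) ε, ∀ t₂ ∈ Ioo (-ε) ε, ∀ x ∈ U, π (Γ t₁ t₂ x) = x) ∧
    (∀ x ∈ U, Γ 0 0 x = γ x) ∧
    (∀ x ∈ U, velocity (fun t₁ => Γ t₁ 0 x) =
      (⟨γ x, Ξ₁ (γ x)⟩ : TangentBundle 𝓘(ℝ, Eu n × Eu m) Y)) ∧
    ∀ t₁ ∈ Ioo (-ε) ε, ∀ x ∈ U, velocity (fun t₂ => Γ t₁ t₂ x) =
      (⟨Γ t₁ 0 x, Ξ₂ (Γ t₁ 0 x)⟩ : TangentBundle 𝓘(ℝ, Eu n × Eu m) Y)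

/-! ### Extremals, the Hessian, and Jacobi fields -/

/-- `γ` is an extremal of the action over `D`: the differential `ν ↦ d/dt A_D[Γ(t)]` at `t = 0`
vanishes on all vertical fields along `γ` that vanish outside `D`. -/
def IsExtremal [IsManifold 𝓘(ℝ, Eu n × Eu m) ∞ Y] [IsManifold 𝓘(ℝ, Eu n) ∞ X] [T2Space X] [SigmaCompactSpace X] {π : Y → X} {r : ℕ}
    (l : Lagrangian n m π r) (o : ∀ x : X, TopForm n x) (D : Set X) (γ : X → Y) : Prop :=
  ∀ (ν : TangentField n m π D γ) (Γ : ℝ → X → Y), IsVariation ν Γ →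
    HasDerivAt (fun t => action l o D (Γ t)) 0 0

/-- `∂²F/∂t₁∂t₂ (0, 0)` exists and equals `h`. -/
def HasMixedDeriv (F : ℝ → ℝ → ℝ) (h : ℝ) : Prop :=
  ∃ g : ℝ → ℝ, (∀ᶠ t₁ in 𝓝 0, HasDerivAt (fun t₂ => F t₁ t₂) (g t₁) 0) ∧ HasDerivAt g h 0

/-- `h` is the value at `(ν, κ)` of the Hessian of `A_D` along `γ`: extensions `Ξ₁`, `Ξ₂` and
variations generated by them exist, and `∂²/∂t₁∂t₂ A_D[Γ(t₁, t₂)] = h` at `(0, 0)` for all of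
them. -/
def HasHessian [IsManifold 𝓘(ℝ, Eu n × Eu m) ∞ Y] [IsManifold 𝓘(ℝ, Eu n) ∞ X] [T2Space X] [SigmaCompactSpace X] {π : Y → X} {r : ℕ}
    (l : Lagrangian n m π r) (o : ∀ x : X, TopForm n x) {D : Set X} {γ : X → Y}
    (ν κ : TangentField n m π D γ) (h : ℝ) : Prop :=
  (∃ Ξ₁ Ξ₂ Γ, IsExtension Ξ₁ ν ∧ IsExtension Ξ₂ κ ∧ IsVariation₂ n m π D γ Ξ₁ Ξ₂ Γ) ∧
  ∀ Ξ₁ Ξ₂ Γ, IsExtension Ξ₁ ν → IsExtension Ξ₂ κ → IsVariation₂ n m π D γ Ξ₁ Ξ₂ Γ →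
    HasMixedDeriv (fun t₁ t₂ => action l o D (Γ t₁ t₂)) h

/-- The Hessian of `A_D` along an extremal `γ`. -/
def hessian [IsManifold 𝓘(ℝ, Eu n × Eu m) ∞ Y] [IsManifold 𝓘(ℝ, Eu n) ∞ X] [T2Space X] [SigmaCompactSpace X] {π : Y → X} {r : ℕ}
    (l : Lagrangian n m π r) (o : ∀ x : X, TopForm n x) {D : Set X} {γ : X → Y}
    (ν κ : TangentField n m π D γ) : ℝ :=
  Classical.epsilon (HasHessian l o ν κ)

/-- The components `Ξ^σ(xⁱ, y^σ)` of a vertical field in fibered coordinates. -/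
def FiberedChart.components {π : Y → X} (ψ : FiberedChart n m π)
    (Ξ : ∀ y : Y, TangentSpace 𝓘(ℝ, Eu n × Eu m) y) (q : Eu n × Eu m) : Eu m :=
  (show Eu n × Eu m from mfderiv 𝓘(ℝ, Eu n × Eu m) 𝓘(ℝ, Eu n × Eu m) ψ.tot (ψ.tot.symm q)
    (Ξ (ψ.tot.symm q))).2

/-- `ν` is a Jacobi field along `γ`: for `Ξ` extending `ν`, the Euler–Lagrange form
`E_n(Ξ ⌟ E_n(λ))` of the Lagrangian `Ξ ⌟ E_n(λ)` vanishes along `γ` over `D`. It is expressed in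
fibered coordinates. -/
def IsJacobiAlong [IsManifold 𝓘(ℝ, Eu n × Eu m) ∞ Y] {π : Y → X} {r : ℕ} (l : Lagrangian n m π r) {D : Set X} {γ : X → Y}
    (ν : TangentField n m π D γ) : Prop :=
  ∀ Ξ : ∀ y : Y, TangentSpace 𝓘(ℝ, Eu n × Eu m) y, IsExtension Ξ ν →
    ∀ ψ : FiberedChart n m π, ∀ x ∈ D, γ x ∈ ψ.tot.source → ∀ σ : Fin m,
      eulerExpr (contractEuler (ψ.components Ξ) (localDensity l.toFun ψ))
        (ψ.rep γ) (ψ.base x) σ = 0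

end

end VarCalc

end

/-!
Everything reduces to one formula: along an extremal `γ`, every two-parameter variation satisfies
`∂²A/∂t₁∂t₂ = ∫_D κ^σ J_σ(ν) ds` at the origin, where `J` (`linEuler`) is the linearization at `γ`
of the Euler–Lagrange operator.

*Integrals.* A form on `D` is integrated in an arbitrary finite family of fibered charts with a
partition of unity on `D` (`ChartFamily`). The formula is obtained from the definition of
`integralForm` by the change of variables (`integralForm_eq_integral_chart`), and the domain of
integration in each chart is a compact set that need not have a regular boundary.

*First variation.* For a deformation whose velocity vanishes outside `D`, the derivative of the
action is `∫_D Ξ^σ E_σ(L) ds` (`IsDeformation.hasDerivAt_action_euler`). The derivative of the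
action is a linear form in the jet of the velocity, so the deformation may be cut off by a partition
of unity. A piece with support in one chart is integrated by parts in `ℝⁿ`: its velocity vanishes
outside `D`, so that no boundary term appears and Stokes' theorem on `D` is not needed.

*Extensions.* In a fibered chart, shifting the fibre coordinates by `t W(y)`, with `W` of compact
support in the chart (`FiberedChart.shift`), gives an explicit family of fibre-preserving maps;
compositions of such families have, at `t = 0`, the sum of their velocities (`IsFlow.comp`). This
extends every field along `γ` and generates the variations that are needed, without any integral
curves (`TangentField.exists_isFlow`).

*Euler–Lagrange equations.* The fundamental lemma of the calculus of variations
(`eq_zero_of_integral_comp_mul_eq_zero`) gives `E(L) = 0` along `γ` in the interior of `D`. A region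
is the closure of its interior, so the equations hold on all of `D` by continuity.

*Second variation.* The first variation formula in `t₂` gives `∂A/∂t₂ = ∫_D Ξ₂^σ E_σ(L) ds` along
`Γ(t₁, 0)`. In the derivative with respect to `t₁` only the derivative of the second factor
survives, as `E(L) = 0` along `γ` (`IsVariation₂.hasMixedDeriv`). The result involves
`ν` and `κ` only.

*Jacobi fields.* The Euler–Lagrange expression of `Ξ ⌟ E(λ)` along `γ` is also `J(ν)`
(`eulerExpr_contractEuler`): the second variation of `L` is symmetric, so `J` is formally
self-adjoint (`integral_linEuler_symm`), and the two expressions have the same integrals against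
test functions. One more use of the fundamental lemma identifies the null space of the Hessian with
the solutions of `J(ν) = 0`, first in the interior of `D` and then, by continuity, on `D`.
-/

noncomputable section

namespace VarCalc

/-! ### Iterated partial derivatives -/

section Partial

variable {n : ℕ} {G P : Type*} [NormedAddCommGroup G] [NormedSpace ℝ G]
  [NormedAddCommGroup P] [NormedSpace ℝ P]

/-- Directional derivatives at a point commute. -/
theorem fderiv_fderiv_apply_comm {H : P → G} {z : P} (h : ContDiffAt ℝ ∞ H z) (a b : P) :
    fderiv ℝ (fun q => fderiv ℝ H q a) z b = fderiv ℝ (fun q => fderiv ℝ H q b) z a := by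
  have hd : DifferentiableAt ℝ (fderiv ℝ H) z :=
    (h.fderiv_right (m := 1) (by norm_cast)).differentiableAt (by simp)
  have key : ∀ c : P, fderiv ℝ (fun q => fderiv ℝ H q c) z = (fderiv ℝ (fderiv ℝ H) z).flip c := by
    intro c
    rw [fderiv_clm_apply hd (differentiableAt_const c)]
    ext; simp
  rw [key, key]
  have hs : IsSymmSndFDerivAt ℝ H z := h.isSymmSndFDerivAt (by simp; norm_cast)
  exact hs b a

/-- Iterated partial derivatives along a list of coordinate directions, the head of the list being
the outermost derivative. -/
def listPartial (l : List (Fin n)) (f : Eu n → G) : Eu n → G :=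
  l.foldr (fun i g u => fderiv ℝ g u (EuclideanSpace.single i (1 : ℝ))) f

@[simp] theorem listPartial_nil (f : Eu n → G) : listPartial [] f = f := rfl

theorem listPartial_cons (i : Fin n) (l : List (Fin n)) (f : Eu n → G) (u : Eu n) :
    listPartial (i :: l) f u = fderiv ℝ (listPartial l f) u (EuclideanSpace.single i (1 : ℝ)) := rfl

theorem contDiffOn_fderiv_apply {h : P → G} {V : Set P} (hV : IsOpen V)
    (hh : ContDiffOn ℝ ∞ h V) (v : P) : ContDiffOn ℝ ∞ (fun u => fderiv ℝ h u v) V :=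
  (hh.fderiv_of_isOpen hV (m := ∞) (by simp)).clm_apply contDiffOn_const

theorem contDiffOn_listPartial (l : List (Fin n)) {f : Eu n → G} {V : Set (Eu n)} (hV : IsOpen V)
    (hf : ContDiffOn ℝ ∞ f V) : ContDiffOn ℝ ∞ (listPartial l f) V := by
  induction l with
  | nil => exact hf
  | cons i l ih => exact contDiffOn_fderiv_apply hV ih _

theorem listPartial_congr (l : List (Fin n)) {f g : Eu n → G} {u : Eu n} (h : f =ᶠ[𝓝 u] g) :
    listPartial l f =ᶠ[𝓝 u] listPartial l g := by
  induction l with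
  | nil => exact h
  | cons i l ih =>
    filter_upwards [ih.eventuallyEq_nhds] with x hx
    simp only [listPartial_cons, hx.fderiv_eq]

theorem iterPartial_eq_listPartial {k : ℕ} (I : Fin k → Fin n) {f : Eu n → G} {V : Set (Eu n)}
    (hV : IsOpen V) (hf : ContDiffOn ℝ ∞ f V) {u : Eu n} (hu : u ∈ V) :
    iterPartial I f u = listPartial (List.ofFn I) f u := by
  induction k generalizing u with
  | zero => simp [iterPartial]
  | succ k ih =>
    rw [List.ofFn_succ, listPartial_cons]
    have h1 : listPartial (List.ofFn fun i => I i.succ) f =ᶠ[𝓝 u]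
        fun y => iteratedFDeriv ℝ k f y (fun j => EuclideanSpace.single (I j.succ) (1 : ℝ)) := by
      filter_upwards [hV.mem_nhds hu] with y hy
      exact (ih (fun i => I i.succ) hy).symm
    rw [h1.fderiv_eq]
    have hd : DifferentiableAt ℝ (iteratedFDeriv ℝ k f) u :=
      (hf.contDiffAt (hV.mem_nhds hu)).differentiableAt_iteratedFDeriv (by
        norm_cast; exact WithTop.coe_lt_top _)
    rw [iterPartial, iteratedFDeriv_succ_apply_left]
    have := hd.hasFDerivAt.continuousMultilinear_apply_const
      (fun j : Fin k => (EuclideanSpace.single (I j.succ) (1 : ℝ) : Eu n))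
    rw [this.fderiv]
    rfl

theorem iterPartial_congr {k : ℕ} (I : Fin k → Fin n) {f g : Eu n → G} {u : Eu n}
    (h : f =ᶠ[𝓝 u] g) : iterPartial I f u = iterPartial I g u := by
  rw [iterPartial, iterPartial, (h.iteratedFDeriv ℝ k).self_of_nhds]

theorem listPartial_perm {l l' : List (Fin n)} (h : l.Perm l') {f : Eu n → G} {V : Set (Eu n)}
    (hV : IsOpen V) (hf : ContDiffOn ℝ ∞ f V) {u : Eu n} (hu : u ∈ V) :
    listPartial l f u = listPartial l' f u := by
  induction h generalizing u with
  | nil => rfl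
  | cons i _ ih =>
    have : listPartial _ f =ᶠ[𝓝 u] listPartial _ f :=
      eventually_of_mem (hV.mem_nhds hu) fun y hy => ih hy
    rw [listPartial_cons, listPartial_cons, this.fderiv_eq]
  | swap i j l =>
    exact fderiv_fderiv_apply_comm
      ((contDiffOn_listPartial l hV hf).contDiffAt (hV.mem_nhds hu)) _ _
  | trans _ _ ih1 ih2 => rw [ih1 hu, ih2 hu]

theorem iterPartial_comp_perm {k : ℕ} (I : Fin k → Fin n) (σ : Equiv.Perm (Fin k))
    {f : Eu n → G} {V : Set (Eu n)} (hV : IsOpen V) (hf : ContDiffOn ℝ ∞ f V) {u : Eu n}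
    (hu : u ∈ V) : iterPartial (I ∘ σ) f u = iterPartial I f u := by
  rw [iterPartial_eq_listPartial _ hV hf hu, iterPartial_eq_listPartial _ hV hf hu]
  exact listPartial_perm (Equiv.Perm.ofFn_comp_perm σ I) hV hf hu

/-! ### Iterated partial derivatives of families of functions -/

theorem hasFDerivAt_slice {g : P → Eu n → G} {W : Set (P × Eu n)} (hW : IsOpen W)
    (hg : ContDiffOn ℝ ∞ (fun q : P × Eu n => g q.1 q.2) W) {p : P} {u : Eu n} (h : (p, u) ∈ W) :
    HasFDerivAt (g p) ((fderiv ℝ (fun q : P × Eu n => g q.1 q.2) (p, u)).comp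
      (ContinuousLinearMap.inr ℝ P (Eu n))) u := by
  have h1 := ((hg.contDiffAt (hW.mem_nhds h)).differentiableAt (by simp)).hasFDerivAt
  exact h1.comp u (hasFDerivAt_prodMk_right p u)

theorem isOpen_slice {P : Type*} [TopologicalSpace P] {W : Set (P × Eu n)} (hW : IsOpen W)
    (p : P) : IsOpen {u | (p, u) ∈ W} :=
  hW.preimage (by fun_prop)

theorem contDiffOn_slice {g : P → Eu n → G} {W : Set (P × Eu n)}
    (hg : ContDiffOn ℝ ∞ (fun q : P × Eu n => g q.1 q.2) W) (p : P) :
    ContDiffOn ℝ ∞ (g p) {u | (p, u) ∈ W} :=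
  hg.comp (f := fun u => (p, u)) (by fun_prop) (fun _ h => h)

theorem contDiffOn_listPartial_param (l : List (Fin n)) {g : P → Eu n → G} {W : Set (P × Eu n)}
    (hW : IsOpen W) (hg : ContDiffOn ℝ ∞ (fun q : P × Eu n => g q.1 q.2) W) :
    ContDiffOn ℝ ∞ (fun q : P × Eu n => listPartial l (g q.1) q.2) W := by
  induction l with
  | nil => exact hg
  | cons i l ih =>
    refine (contDiffOn_fderiv_apply hW ih (0, EuclideanSpace.single i (1 : ℝ))).congr ?_
    rintro ⟨p, u⟩ h
    simp only [listPartial_cons]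
    rw [(hasFDerivAt_slice (g := fun p => listPartial l (g p)) hW ih h).fderiv]
    simp

theorem contDiffOn_iterPartial_param {k : ℕ} (I : Fin k → Fin n) {g : P → Eu n → G}
    {W : Set (P × Eu n)} (hW : IsOpen W)
    (hg : ContDiffOn ℝ ∞ (fun q : P × Eu n => g q.1 q.2) W) :
    ContDiffOn ℝ ∞ (fun q : P × Eu n => iterPartial I (g q.1) q.2) W :=
  (contDiffOn_listPartial_param (List.ofFn I) hW hg).congr fun q hq =>
    iterPartial_eq_listPartial I (isOpen_slice hW q.1) (contDiffOn_slice hg q.1) hq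

theorem contDiffOn_iterPartial {k : ℕ} (I : Fin k → Fin n) {f : Eu n → G} {V : Set (Eu n)}
    (hV : IsOpen V) (hf : ContDiffOn ℝ ∞ f V) : ContDiffOn ℝ ∞ (iterPartial I f) V :=
  (contDiffOn_listPartial (List.ofFn I) hV hf).congr fun _ hq =>
    iterPartial_eq_listPartial I hV hf hq

theorem hasDerivAt_slice {g : ℝ → Eu n → G} {W : Set (ℝ × Eu n)} (hW : IsOpen W)
    (hg : ContDiffOn ℝ ∞ (fun q : ℝ × Eu n => g q.1 q.2) W) {t : ℝ} {u : Eu n} (h : (t, u) ∈ W) :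
    HasDerivAt (fun t => g t u) (fderiv ℝ (fun q : ℝ × Eu n => g q.1 q.2) (t, u) (1, 0)) t := by
  have h1 := ((hg.contDiffAt (hW.mem_nhds h)).differentiableAt (by simp)).hasFDerivAt
  exact h1.comp_hasDerivAt t ((hasDerivAt_id t).prodMk (hasDerivAt_const t u))

theorem contDiffOn_deriv_param {g : ℝ → Eu n → G} {W : Set (ℝ × Eu n)} (hW : IsOpen W)
    (hg : ContDiffOn ℝ ∞ (fun q : ℝ × Eu n => g q.1 q.2) W) :
    ContDiffOn ℝ ∞ (fun q : ℝ × Eu n => deriv (fun t => g t q.2) q.1) W :=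
  (contDiffOn_fderiv_apply hW hg (1, 0)).congr fun _ h => (hasDerivAt_slice hW hg h).deriv

theorem listPartial_hasDerivAt (l : List (Fin n)) {g : ℝ → Eu n → G} {W : Set (ℝ × Eu n)}
    (hW : IsOpen W) (hg : ContDiffOn ℝ ∞ (fun q : ℝ × Eu n => g q.1 q.2) W) {t : ℝ} {u : Eu n}
    (h : (t, u) ∈ W) :
    HasDerivAt (fun t => listPartial l (g t) u)
      (listPartial l (fun u' => deriv (fun t => g t u') t) u) t := by
  induction l generalizing u with
  | nil => exact (hasDerivAt_slice hW hg h).differentiableAt.hasDerivAt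
  | cons i l ih =>
    have hs := contDiffOn_listPartial_param l hW hg
    have hs' := contDiffOn_listPartial_param (i :: l) hW hg
    have h1 := hasDerivAt_slice (g := fun t => listPartial (i :: l) (g t)) hW hs' h
    have e1 : (fun q : ℝ × Eu n => listPartial (i :: l) (g q.1) q.2) =ᶠ[𝓝 (t, u)]
        fun q => fderiv ℝ (fun q : ℝ × Eu n => listPartial l (g q.1) q.2) q
          (0, EuclideanSpace.single i (1 : ℝ)) := by
      filter_upwards [hW.mem_nhds h] with q hq
      rw [listPartial_cons,
        (hasFDerivAt_slice (g := fun p => listPartial l (g p)) hW hs (p := q.1)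
          (u := q.2) hq).fderiv]
      simp
    have e2 : listPartial l (fun u' => deriv (fun t => g t u') t) =ᶠ[𝓝 u]
        fun u' => fderiv ℝ (fun q : ℝ × Eu n => listPartial l (g q.1) q.2) (t, u') (1, 0) := by
      filter_upwards [(isOpen_slice hW t).mem_nhds h] with u' hu'
      exact (ih hu').unique (hasDerivAt_slice hW hs hu')
    convert h1 using 1
    rw [e1.fderiv_eq, fderiv_fderiv_apply_comm (hs.contDiffAt (hW.mem_nhds h)), listPartial_cons,
      e2.fderiv_eq, (hasFDerivAt_slice (g := fun t u' =>
        fderiv ℝ (fun q : ℝ × Eu n => listPartial l (g q.1) q.2) (t, u') (1, 0)) hW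
        (contDiffOn_fderiv_apply hW hs (1, 0)) h).fderiv]
    simp

/-- Iterated partial derivatives commute with the derivative with respect to a parameter. -/
theorem iterPartial_hasDerivAt {k : ℕ} (I : Fin k → Fin n) {g : ℝ → Eu n → G} {W : Set (ℝ × Eu n)}
    (hW : IsOpen W) (hg : ContDiffOn ℝ ∞ (fun q : ℝ × Eu n => g q.1 q.2) W) {t : ℝ} {u : Eu n}
    (h : (t, u) ∈ W) :
    HasDerivAt (fun t => iterPartial I (g t) u)
      (iterPartial I (fun u' => deriv (fun t => g t u') t) u) t := by
  have hd : ContDiffOn ℝ ∞ (fun u' => deriv (fun t => g t u') t) {u | (t, u) ∈ W} :=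
    contDiffOn_slice (g := fun t u' => deriv (fun t => g t u') t) (contDiffOn_deriv_param hW hg) t
  rw [iterPartial_eq_listPartial I (isOpen_slice hW t) hd h]
  refine (listPartial_hasDerivAt (List.ofFn I) hW hg h).congr_of_eventuallyEq ?_
  have : ∀ᶠ t' in 𝓝 t, (t', u) ∈ W :=
    (hW.preimage (f := fun t' : ℝ => (t', u)) (by fun_prop)).mem_nhds h
  filter_upwards [this] with t' ht'
  exact iterPartial_eq_listPartial I (isOpen_slice hW t') (contDiffOn_slice hg t') ht'

theorem iterPartial_sum {k : ℕ} (I : Fin k → Fin n) {ι : Type*} (s : Finset ι) {f : ι → Eu n → G}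
    {u : Eu n} (hf : ∀ i ∈ s, ContDiffAt ℝ ∞ (f i) u) :
    iterPartial I (fun v => ∑ i ∈ s, f i v) u = ∑ i ∈ s, iterPartial I (f i) u := by
  unfold iterPartial
  rw [iteratedFDeriv_fun_sum_apply (fun i hi => (hf i hi).of_le (by
    norm_cast; exact le_top))]
  simp

/-! ### Integration by parts -/

theorem tsupport_fderiv_apply_subset (f : P → G) (v : P) :
    tsupport (fun u => fderiv ℝ f u v) ⊆ tsupport f := by
  refine closure_minimal (fun u hu => ?_) (isClosed_tsupport f)
  by_contra h
  apply hu
  have : f =ᶠ[𝓝 u] 0 := notMem_tsupport_iff_eventuallyEq.1 h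
  simp [this.fderiv_eq]

theorem tsupport_listPartial_subset (l : List (Fin n)) (f : Eu n → G) :
    tsupport (listPartial l f) ⊆ tsupport f := by
  induction l with
  | nil => exact subset_rfl
  | cons i l ih => exact (tsupport_fderiv_apply_subset _ _).trans ih

theorem tsupport_iterPartial_subset {k : ℕ} (I : Fin k → Fin n) (f : Eu n → G) :
    tsupport (iterPartial I f) ⊆ tsupport f := by
  refine closure_minimal (fun u hu => ?_) (isClosed_tsupport f)
  by_contra h
  apply hu
  have : f =ᶠ[𝓝 u] 0 := notMem_tsupport_iff_eventuallyEq.1 h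
  rw [iterPartial_congr I this]
  simp [iterPartial, Pi.zero_def]

theorem continuous_mul_of_tsupport_subset {a v : Eu n → ℝ} {V : Set (Eu n)} (hV : IsOpen V)
    (ha : ContinuousOn a V) (hv : Continuous v) (hsupp : tsupport v ⊆ V) :
    Continuous fun u => v u * a u := by
  refine continuous_iff_continuousAt.2 fun u => ?_
  by_cases hu : u ∈ tsupport v
  · exact hv.continuousAt.mul (ha.continuousAt (hV.mem_nhds (hsupp hu)))
  · have : (fun u => v u * a u) =ᶠ[𝓝 u] fun _ => 0 := by
      filter_upwards [notMem_tsupport_iff_eventuallyEq.1 hu] with y hy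
      simp [hy]
    exact continuousAt_const.congr this.symm

theorem integrable_mul_of_tsupport_subset {a v : Eu n → ℝ} {V : Set (Eu n)} (hV : IsOpen V)
    (ha : ContinuousOn a V) (hv : Continuous v) (hc : HasCompactSupport v)
    (hsupp : tsupport v ⊆ V) : Integrable fun u => v u * a u :=
  (continuous_mul_of_tsupport_subset hV ha hv hsupp).integrable_of_hasCompactSupport hc.mul_right

theorem integral_listPartial_mul (l : List (Fin n)) {a v : Eu n → ℝ} {V : Set (Eu n)}
    (hV : IsOpen V) (ha : ContDiffOn ℝ ∞ a V) (hv : ContDiff ℝ ∞ v) (hc : HasCompactSupport v)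
    (hsupp : tsupport v ⊆ V) :
    ∫ u, listPartial l v u * a u = (-1) ^ l.length * ∫ u, v u * listPartial l.reverse a u := by
  induction l generalizing a with
  | nil => simp
  | cons i l ih =>
    have hlv : ContDiff ℝ ∞ (listPartial l v) :=
      contDiffOn_univ.1 (contDiffOn_listPartial l isOpen_univ hv.contDiffOn)
    have hls : tsupport (listPartial l v) ⊆ tsupport v := tsupport_listPartial_subset l v
    have hlc : HasCompactSupport (listPartial l v) :=
      hc.of_isClosed_subset (isClosed_tsupport _) hls
    have hiv : ContDiff ℝ ∞ (fun u => fderiv ℝ (listPartial l v) u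
        (EuclideanSpace.single i (1 : ℝ))) :=
      contDiffOn_univ.1 (contDiffOn_fderiv_apply isOpen_univ hlv.contDiffOn _)
    have his := tsupport_fderiv_apply_subset (listPartial l v) (EuclideanSpace.single i (1 : ℝ))
    have hic := hlc.of_isClosed_subset (isClosed_tsupport _) his
    have hda : ContDiffOn ℝ ∞ (fun u => fderiv ℝ a u (EuclideanSpace.single i (1 : ℝ))) V :=
      contDiffOn_fderiv_apply hV ha _
    have h := integral_mul_fderiv_eq_neg_fderiv_mul_of_integrable (μ := (volume : Measure (Eu n)))
      (f := a) (g := listPartial l v) (v := EuclideanSpace.single i (1 : ℝ))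
      (by simpa only [mul_comm] using integrable_mul_of_tsupport_subset hV hda.continuousOn
            hlv.continuous hlc (hls.trans hsupp))
      (by simpa only [mul_comm] using integrable_mul_of_tsupport_subset hV ha.continuousOn
            hiv.continuous hic (his.trans (hls.trans hsupp)))
      (by simpa only [mul_comm] using integrable_mul_of_tsupport_subset hV ha.continuousOn
            hlv.continuous hlc (hls.trans hsupp))
      (fun x hx => (ha.contDiffAt (hV.mem_nhds (hsupp (hls hx)))).differentiableAt (by simp))
      (fun x _ => hlv.contDiffAt.differentiableAt (by simp))
    have h2 := ih hda
    simp only [listPartial_cons, List.length_cons, pow_succ, List.reverse_cons]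
    have h3 : listPartial (l.reverse ++ [i]) a = listPartial l.reverse
        (fun u => fderiv ℝ a u (EuclideanSpace.single i (1 : ℝ))) := by
      simp [listPartial, List.foldr_append]
    rw [h3]
    calc _ = ∫ u, a u * fderiv ℝ (listPartial l v) u (EuclideanSpace.single i (1 : ℝ)) := by
          simp only [mul_comm]
      _ = - ∫ u, listPartial l v u * fderiv ℝ a u (EuclideanSpace.single i (1 : ℝ)) := by
          rw [h]; simp only [mul_comm]
      _ = _ := by rw [h2]; ring

/-- Repeated integration by parts. -/
theorem integral_iterPartial_mul {k : ℕ} (I : Fin k → Fin n) {a v : Eu n → ℝ} {V : Set (Eu n)}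
    (hV : IsOpen V) (ha : ContDiffOn ℝ ∞ a V) (hv : ContDiff ℝ ∞ v) (hc : HasCompactSupport v)
    (hsupp : tsupport v ⊆ V) :
    ∫ u, iterPartial I v u * a u = (-1) ^ k * ∫ u, v u * iterPartial I a u := by
  have h := integral_listPartial_mul (List.ofFn I) hV ha hv hc hsupp
  rw [List.length_ofFn] at h
  have e1 : ∀ u, iterPartial I v u = listPartial (List.ofFn I) v u := fun u =>
    iterPartial_eq_listPartial I isOpen_univ hv.contDiffOn (mem_univ u)
  simp only [e1, h]
  congr 2
  funext u
  by_cases hu : u ∈ tsupport v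
  · rw [iterPartial_eq_listPartial I hV ha (hsupp hu),
      listPartial_perm (List.reverse_perm _) hV ha (hsupp hu)]
  · rw [image_eq_zero_of_notMem_tsupport hu, zero_mul, zero_mul]

end Partial


/-! ### Equality of jets -/

section SameJet

variable {n m : ℕ} {E G H : Type*} [NormedAddCommGroup E] [NormedSpace ℝ E]
  [NormedAddCommGroup G] [NormedSpace ℝ G] [NormedAddCommGroup H] [NormedSpace ℝ H]

/-- `f` and `g` have the same derivatives up to order `N` at `u`. -/
def SameJet (N : ℕ) (f g : E → G) (u : E) : Prop :=
  ∀ k ≤ N, iteratedFDeriv ℝ k f u = iteratedFDeriv ℝ k g u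

theorem SameJet.refl (N : ℕ) (f : E → G) (u : E) : SameJet N f f u := fun _ _ => rfl

theorem SameJet.symm {N : ℕ} {f g : E → G} {u : E} (h : SameJet N f g u) : SameJet N g f u :=
  fun k hk => (h k hk).symm

theorem SameJet.trans {N : ℕ} {f g h : E → G} {u : E} (h1 : SameJet N f g u)
    (h2 : SameJet N g h u) : SameJet N f h u :=
  fun k hk => (h1 k hk).trans (h2 k hk)

theorem sameJet_of_eventuallyEq (N : ℕ) {f g : E → G} {u : E} (h : f =ᶠ[𝓝 u] g) :
    SameJet N f g u :=
  fun k _ => (h.iteratedFDeriv ℝ k).self_of_nhds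

theorem SameJet.apply_eq {N : ℕ} {f g : E → G} {u : E} (h : SameJet N f g u) : f u = g u := by
  have := congrArg (fun T => T (fun _ => 0)) (h 0 (Nat.zero_le _))
  simpa using this

theorem SameJet.comp {N : ℕ} {Φ Ψ : G → H} {f g : E → G} {u : E}
    (h : SameJet N f g u) (hΦΨ : SameJet N Φ Ψ (f u))
    (hΦ : ContDiffAt ℝ ∞ Φ (f u)) (hΨ : ContDiffAt ℝ ∞ Ψ (f u))
    (hf : ContDiffAt ℝ ∞ f u) (hg : ContDiffAt ℝ ∞ g u) :
    SameJet N (fun v => Φ (f v)) (fun v => Ψ (g v)) u := by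
  intro k hk
  have hΨ' : ContDiffAt ℝ ∞ Ψ (g u) := h.apply_eq ▸ hΨ
  have hk' : (k : WithTop ℕ∞) ≤ ∞ := by norm_cast; exact le_top
  change iteratedFDeriv ℝ k (Φ ∘ f) u = iteratedFDeriv ℝ k (Ψ ∘ g) u
  rw [iteratedFDeriv_comp hΦ hf hk', iteratedFDeriv_comp hΨ' hg hk']
  unfold FormalMultilinearSeries.taylorComp FormalMultilinearSeries.compAlongOrderedFinpartition
  refine Finset.sum_congr rfl fun c _ => ?_
  simp only [ftaylorSeries]
  congr 1
  · rw [← h.apply_eq]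
    exact hΦΨ _ (c.length_le.trans hk)
  · funext i
    exact h _ ((c.partSize_le i).trans hk)

theorem SameJet.comp_left {N : ℕ} {Φ : G → H} {f g : E → G} {u : E} (h : SameJet N f g u)
    (hΦ : ContDiffAt ℝ ∞ Φ (f u)) (hf : ContDiffAt ℝ ∞ f u) (hg : ContDiffAt ℝ ∞ g u) :
    SameJet N (fun v => Φ (f v)) (fun v => Φ (g v)) u :=
  h.comp (SameJet.refl _ _ _) hΦ hΦ hf hg

theorem SameJet.add {N : ℕ} {f g f' g' : E → G} {u : E} (h : SameJet N f g u)
    (h' : SameJet N f' g' u) (hf : ContDiffAt ℝ ∞ f u) (hg : ContDiffAt ℝ ∞ g u)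
    (hf' : ContDiffAt ℝ ∞ f' u) (hg' : ContDiffAt ℝ ∞ g' u) :
    SameJet N (fun v => f v + f' v) (fun v => g v + g' v) u := by
  intro k hk
  have hk' : (k : WithTop ℕ∞) ≤ ∞ := by norm_cast; exact le_top
  change iteratedFDeriv ℝ k (f + f') u = iteratedFDeriv ℝ k (g + g') u
  rw [iteratedFDeriv_add_apply (hf.of_le hk') (hf'.of_le hk'),
    iteratedFDeriv_add_apply (hg.of_le hk') (hg'.of_le hk'), h k hk, h' k hk]

theorem SameJet.sum {N : ℕ} {ι : Type*} (s : Finset ι) {f g : ι → E → G} {u : E}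
    (h : ∀ i ∈ s, SameJet N (f i) (g i) u) (hf : ∀ i ∈ s, ContDiffAt ℝ ∞ (f i) u)
    (hg : ∀ i ∈ s, ContDiffAt ℝ ∞ (g i) u) :
    SameJet N (fun v => ∑ i ∈ s, f i v) (fun v => ∑ i ∈ s, g i v) u := by
  intro k hk
  have hk' : (k : WithTop ℕ∞) ≤ ∞ := by norm_cast; exact le_top
  rw [iteratedFDeriv_fun_sum_apply fun i hi => (hf i hi).of_le hk',
    iteratedFDeriv_fun_sum_apply fun i hi => (hg i hi).of_le hk']
  exact Finset.sum_congr rfl fun i hi => h i hi k hk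

theorem SameJet.prodMk {N : ℕ} {f g : E → G} {f' g' : E → H} {u : E} (h : SameJet N f g u)
    (h' : SameJet N f' g' u) (hf : ContDiffAt ℝ ∞ f u) (hg : ContDiffAt ℝ ∞ g u)
    (hf' : ContDiffAt ℝ ∞ f' u) (hg' : ContDiffAt ℝ ∞ g' u) :
    SameJet N (fun v => (f v, f' v)) (fun v => (g v, g' v)) u := by
  have h1 := h.comp_left (Φ := fun x => ((x, 0) : G × H)) (by fun_prop) hf hg
  have h2 := h'.comp_left (Φ := fun x => ((0, x) : G × H)) (by fun_prop) hf' hg'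
  simpa using h1.add h2 (by fun_prop) (by fun_prop) (by fun_prop) (by fun_prop)

theorem SameJet.pi {N : ℕ} {ι : Type*} [Fintype ι] {f g : ι → E → G} {u : E}
    (h : ∀ i, SameJet N (f i) (g i) u) (hf : ∀ i, ContDiffAt ℝ ∞ (f i) u)
    (hg : ∀ i, ContDiffAt ℝ ∞ (g i) u) :
    SameJet N (fun v i => f i v) (fun v i => g i v) u := by
  classical
  have hs : ∀ i, ContDiff ℝ ∞ (fun x : G => (Pi.single i x : ι → G)) := fun i =>
    (ContinuousLinearMap.single ℝ (fun _ : ι => G) i).contDiff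
  have h1 := SameJet.sum Finset.univ (N := N) (u := u)
    (f := fun i v => (Pi.single i (f i v) : ι → G)) (g := fun i v => (Pi.single i (g i v) : ι → G))
    (fun i _ => (h i).comp_left (hs i).contDiffAt (hf i) (hg i))
    (fun i _ => (hs i).contDiffAt.comp u (hf i)) (fun i _ => (hs i).contDiffAt.comp u (hg i))
  simpa only [Finset.univ_sum_single] using h1

theorem sameJet_iff_iterPartial {N : ℕ} {f g : Eu n → G} {u : Eu n} :
    SameJet N f g u ↔ ∀ k ≤ N, ∀ I : Fin k → Fin n, iterPartial I f u = iterPartial I g u := by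
  refine forall₂_congr fun k _ => ⟨fun h I => by rw [iterPartial, h, iterPartial], fun h => ?_⟩
  apply ContinuousMultilinearMap.toMultilinearMap_injective
  refine Module.Basis.ext_multilinear (fun _ => (EuclideanSpace.basisFun (Fin n) ℝ).toBasis)
    fun I => ?_
  simpa [iterPartial] using h I

theorem sameJet_iff_listPartial {N : ℕ} {f g : Eu n → G} {V : Set (Eu n)} (hV : IsOpen V)
    (hf : ContDiffOn ℝ ∞ f V) (hg : ContDiffOn ℝ ∞ g V) {u : Eu n} (hu : u ∈ V) :
    SameJet N f g u ↔ ∀ l : List (Fin n), l.length ≤ N → listPartial l f u = listPartial l g u := by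
  rw [sameJet_iff_iterPartial]
  constructor
  · intro h l hl
    have := h l.length hl l.get
    rwa [iterPartial_eq_listPartial _ hV hf hu, iterPartial_eq_listPartial _ hV hg hu,
      List.ofFn_get] at this
  · intro h k hk I
    rw [iterPartial_eq_listPartial _ hV hf hu, iterPartial_eq_listPartial _ hV hg hu]
    exact h _ (by simpa using hk)

theorem SameJet.iterPartial {N k : ℕ} (I : Fin k → Fin n) {f g : Eu n → G} {V : Set (Eu n)}
    (hV : IsOpen V) (hf : ContDiffOn ℝ ∞ f V) (hg : ContDiffOn ℝ ∞ g V) {u : Eu n} (hu : u ∈ V)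
    (h : SameJet (N + k) f g u) :
    SameJet N (VarCalc.iterPartial I f) (VarCalc.iterPartial I g) u := by
  have key : ∀ {f : Eu n → G}, ContDiffOn ℝ ∞ f V → ∀ l : List (Fin n),
      listPartial l (VarCalc.iterPartial I f) u = listPartial (l ++ List.ofFn I) f u := by
    intro f hf l
    have : VarCalc.iterPartial I f =ᶠ[𝓝 u] listPartial (List.ofFn I) f :=
      eventually_of_mem (hV.mem_nhds hu) fun v hv => iterPartial_eq_listPartial I hV hf hv
    rw [(listPartial_congr l this).self_of_nhds]
    simp [listPartial, List.foldr_append]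
  rw [sameJet_iff_listPartial hV (contDiffOn_iterPartial I hV hf)
    (contDiffOn_iterPartial I hV hg) hu]
  rw [sameJet_iff_listPartial hV hf hg hu] at h
  intro l hl
  rw [key hf, key hg]
  exact h _ (by simpa using hl)

end SameJet

/-! ### Jet coordinates and Taylor polynomials -/

section JetCoord

variable {n m r : ℕ} {P : Type*} [NormedAddCommGroup P] [NormedSpace ℝ P]

theorem jetCoord_congr (r : ℕ) {f g : Eu n → Eu m} {u : Eu n} (h : f =ᶠ[𝓝 u] g) :
    jetCoord r f u = jetCoord r g u := by
  unfold jetCoord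
  simp only [iterPartial_congr _ h]

theorem jetCoord_empty (r : ℕ) (f : Eu n → Eu m) (u : Eu n) :
    (jetCoord r f u).2 (MultiIdx.empty n r) = f u := by
  exact iteratedFDeriv_zero_apply _

theorem contDiffOn_jetCoord_param {g : P → Eu n → Eu m} {W : Set (P × Eu n)} (hW : IsOpen W)
    (hg : ContDiffOn ℝ ∞ (fun q : P × Eu n => g q.1 q.2) W) :
    ContDiffOn ℝ ∞ (fun q : P × Eu n => jetCoord r (g q.1) q.2) W :=
  contDiffOn_snd.prodMk (contDiffOn_pi.2 fun I => contDiffOn_iterPartial_param I.2 hW hg)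

theorem contDiffOn_jetCoord {f : Eu n → Eu m} {V : Set (Eu n)} (hV : IsOpen V)
    (hf : ContDiffOn ℝ ∞ f V) : ContDiffOn ℝ ∞ (jetCoord r f) V :=
  contDiffOn_id.prodMk (contDiffOn_pi.2 fun I => contDiffOn_iterPartial I.2 hV hf)

/-- The vector tangent to the jet space, with components `∂^|I| w^σ / ∂x^I` in the directions
`∂ / ∂y^σ_I`: the prolongation of a variation `w`. -/
def jetVec (r : ℕ) (w : Eu n → Eu m) (u : Eu n) : JetCoord n m r :=
  (0, fun I => iterPartial I.2 w u)

theorem jetVec_congr (r : ℕ) {f g : Eu n → Eu m} {u : Eu n} (h : f =ᶠ[𝓝 u] g) :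
    jetVec r f u = jetVec r g u := by
  unfold jetVec
  simp only [iterPartial_congr _ h]

theorem contDiffOn_jetVec {f : Eu n → Eu m} {V : Set (Eu n)} (hV : IsOpen V)
    (hf : ContDiffOn ℝ ∞ f V) : ContDiffOn ℝ ∞ (jetVec r f) V :=
  contDiffOn_const.prodMk (contDiffOn_pi.2 fun I => contDiffOn_iterPartial I.2 hV hf)

theorem jetVec_sum {ι : Type*} (s : Finset ι) {f : ι → Eu n → Eu m} {u : Eu n}
    (hf : ∀ i ∈ s, ContDiffAt ℝ ∞ (f i) u) :
    jetVec r (fun v => ∑ i ∈ s, f i v) u = ∑ i ∈ s, jetVec r (f i) u := by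
  unfold jetVec
  refine Prod.ext ?_ ?_
  · simp [Prod.fst_sum]
  · funext I
    simp only [Prod.snd_sum, Finset.sum_apply]
    exact iterPartial_sum I.2 s hf

theorem hasDerivAt_jetCoord {g : ℝ → Eu n → Eu m} {W : Set (ℝ × Eu n)} (hW : IsOpen W)
    (hg : ContDiffOn ℝ ∞ (fun q : ℝ × Eu n => g q.1 q.2) W) {t : ℝ} {u : Eu n} (h : (t, u) ∈ W) :
    HasDerivAt (fun t => jetCoord r (g t) u)
      (jetVec r (fun u' => deriv (fun t => g t u') t) u) t :=
  (hasDerivAt_const t u).prodMk (hasDerivAt_pi.2 fun I => iterPartial_hasDerivAt I.2 hW hg h)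

theorem SameJet.jetCoord {N : ℕ} {f g : Eu n → Eu m} {V : Set (Eu n)}
    (hV : IsOpen V) (hf : ContDiffOn ℝ ∞ f V) (hg : ContDiffOn ℝ ∞ g V) {u : Eu n} (hu : u ∈ V)
    (h : SameJet (N + r) f g u) :
    SameJet N (VarCalc.jetCoord r f) (VarCalc.jetCoord r g) u := by
  have hf' : ∀ I : MultiIdx n r, ContDiffAt ℝ ∞ (VarCalc.iterPartial I.2 f) u := fun I =>
    (contDiffOn_iterPartial I.2 hV hf).contDiffAt (hV.mem_nhds hu)
  have hg' : ∀ I : MultiIdx n r, ContDiffAt ℝ ∞ (VarCalc.iterPartial I.2 g) u := fun I =>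
    (contDiffOn_iterPartial I.2 hV hg).contDiffAt (hV.mem_nhds hu)
  refine (SameJet.refl N (fun v => v) u).prodMk (SameJet.pi (fun I => ?_) hf' hg')
    contDiffAt_id contDiffAt_id (contDiffAt_pi.2 hf') (contDiffAt_pi.2 hg')
  exact SameJet.iterPartial I.2 hV hf hg hu fun k hk => h k (hk.trans (by have := I.1.2; omega))

/-- The `k`-th homogeneous part of a Taylor polynomial, as a multilinear map. -/
def taylorTerm (p : JetCoord n m r) : FormalMultilinearSeries ℝ (Eu n) (Eu m) := fun k =>
  if hk : k < r + 1 then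
    ((Nat.factorial k : ℝ))⁻¹ • ∑ I : Fin k → Fin n,
      ((ContinuousMultilinearMap.mkPiAlgebra ℝ (Fin k) ℝ).compContinuousLinearMap
        (fun j => EuclideanSpace.proj (I j))).smulRight (p.2 ⟨⟨k, hk⟩, I⟩)
  else 0

theorem hasFPowerSeriesOnBall_taylorPoly (p : JetCoord n m r) :
    HasFPowerSeriesOnBall (taylorPoly p) (taylorTerm p) p.1 ⊤ := by
  refine (HasFiniteFPowerSeriesOnBall.mk' (n := r + 1) ?_ ENNReal.zero_lt_top
    ?_).toHasFPowerSeriesOnBall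
  · intro k hk
    exact dif_neg (by omega)
  · intro y _
    rw [Finset.sum_range]
    unfold taylorPoly
    rw [Fintype.sum_sigma]
    refine Finset.sum_congr rfl fun k _ => ?_
    simp only [taylorTerm, dif_pos k.2, smul_apply, sum_apply, Finset.smul_sum]
    simp [smul_smul]

/-- The derivatives at the base point of a Taylor polynomial are the symmetrizations of the jet
coordinates. -/
theorem iterPartial_taylorPoly (p : JetCoord n m r) {k : ℕ} (hk : k < r + 1)
    (I : Fin k → Fin n) :
    iterPartial I (taylorPoly p) p.1 =
      ((Nat.factorial k : ℝ))⁻¹ • ∑ σ : Equiv.Perm (Fin k), p.2 ⟨⟨k, hk⟩, I ∘ σ⟩ := by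
  rw [iterPartial, (hasFPowerSeriesOnBall_taylorPoly p).iteratedFDeriv_eq_sum_of_completeSpace,
    Finset.smul_sum]
  refine Finset.sum_congr rfl fun σ _ => ?_
  simp only [taylorTerm, dif_pos hk, smul_apply,
    sum_apply]
  congr 1
  rw [Finset.sum_eq_single (I ∘ σ)]
  · simp
  · intro J _ hJ
    obtain ⟨j, hj⟩ : ∃ j, J j ≠ (I ∘ σ) j := by
      by_contra! h
      exact hJ (funext h)
    simp only [ContinuousMultilinearMap.smulRight_apply,
      ContinuousMultilinearMap.compContinuousLinearMap_apply,
      ContinuousMultilinearMap.mkPiAlgebra_apply]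
    rw [Finset.prod_eq_zero (Finset.mem_univ j), zero_smul]
    simp only [Function.comp_apply] at hj
    simp [hj]
  · simp

/-- The Taylor polynomial of the jet of `f` at `u` has that jet. -/
theorem sameJet_taylorPoly {f : Eu n → Eu m} {V : Set (Eu n)} (hV : IsOpen V)
    (hf : ContDiffOn ℝ ∞ f V) {u : Eu n} (hu : u ∈ V) :
    SameJet r (taylorPoly (jetCoord r f u)) f u := by
  rw [sameJet_iff_iterPartial]
  intro k hk I
  have h := iterPartial_taylorPoly (jetCoord r f u) (Nat.lt_succ_of_le hk) I
  change iterPartial I _ u = _ at h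
  rw [h]
  have h2 : ∀ σ : Equiv.Perm (Fin k),
      (jetCoord r f u).2 ⟨⟨k, Nat.lt_succ_of_le hk⟩, I ∘ σ⟩ = iterPartial I f u :=
    fun σ => iterPartial_comp_perm I σ hV hf hu
  simp only [h2, Finset.sum_const, Finset.card_univ, Fintype.card_perm, Fintype.card_fin]
  rw [← Nat.cast_smul_eq_nsmul ℝ, smul_smul, inv_mul_cancel₀ (by positivity), one_smul]

theorem contDiff_taylorPoly_param :
    ContDiff ℝ ∞ (fun q : JetCoord n m r × Eu n => taylorPoly q.1 q.2) := by
  unfold taylorPoly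
  fun_prop

end JetCoord


/-! ### The Euler–Lagrange operator in coordinates -/

section Euler

variable {n m r : ℕ} {P : Type*} [NormedAddCommGroup P] [NormedSpace ℝ P]

theorem vertical_eq_sum (q : MultiIdx n r → Eu m) :
    ((0, q) : JetCoord n m r) = ∑ I : MultiIdx n r, ∑ σ : Fin m,
      q I σ • ((0, Pi.single I (EuclideanSpace.single σ (1 : ℝ))) : JetCoord n m r) := by
  refine Prod.ext (by simp [Prod.fst_sum]) ?_
  funext J
  simp only [Prod.snd_sum, Finset.sum_apply, Prod.smul_snd, Pi.smul_apply]
  rw [Finset.sum_eq_single J]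
  · ext σ
    simp [Finset.sum_apply, Pi.single_apply]
  · intro I _ hI
    simp [Pi.single_eq_of_ne hI.symm]
  · simp

theorem fderiv_vertical (L : JetCoord n m r → ℝ) (p : JetCoord n m r) (q : MultiIdx n r → Eu m) :
    fderiv ℝ L p (0, q) = ∑ I : MultiIdx n r, ∑ σ : Fin m, q I σ * partialJet L σ I p := by
  rw [vertical_eq_sum]
  simp only [map_sum, map_smul, partialJet, smul_eq_mul]

theorem contDiffOn_partialJet {L : JetCoord n m r → ℝ} {Ω : Set (JetCoord n m r)} (hΩ : IsOpen Ω)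
    (hL : ContDiffOn ℝ ∞ L Ω) (σ : Fin m) (I : MultiIdx n r) :
    ContDiffOn ℝ ∞ (partialJet L σ I) Ω :=
  contDiffOn_fderiv_apply hΩ hL _

theorem contDiffOn_eulerExpr_param {L : JetCoord n m r → ℝ} {Ω : Set (JetCoord n m r)}
    (hΩ : IsOpen Ω) (hL : ContDiffOn ℝ ∞ L Ω) {g : P → Eu n → Eu m} {W : Set (P × Eu n)}
    (hW : IsOpen W) (hg : ContDiffOn ℝ ∞ (fun q : P × Eu n => g q.1 q.2) W)
    (hm : ∀ q ∈ W, jetCoord r (g q.1) q.2 ∈ Ω) (σ : Fin m) :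
    ContDiffOn ℝ ∞ (fun q : P × Eu n => eulerExpr L (g q.1) q.2 σ) W := by
  unfold eulerExpr
  refine ContDiffOn.sum fun I _ => contDiffOn_const.mul ?_
  exact contDiffOn_iterPartial_param I.2
    (g := fun p v => partialJet L σ I (jetCoord r (g p) v)) hW
    ((contDiffOn_partialJet hΩ hL σ I).comp (contDiffOn_jetCoord_param hW hg) hm)

theorem contDiffOn_eulerExpr {L : JetCoord n m r → ℝ} {Ω : Set (JetCoord n m r)}
    (hΩ : IsOpen Ω) (hL : ContDiffOn ℝ ∞ L Ω) {f : Eu n → Eu m} {V : Set (Eu n)}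
    (hV : IsOpen V) (hf : ContDiffOn ℝ ∞ f V) (hm : ∀ u ∈ V, jetCoord r f u ∈ Ω) (σ : Fin m) :
    ContDiffOn ℝ ∞ (fun u => eulerExpr L f u σ) V := by
  unfold eulerExpr
  refine ContDiffOn.sum fun I _ => contDiffOn_const.mul ?_
  exact contDiffOn_iterPartial I.2 hV
    ((contDiffOn_partialJet hΩ hL σ I).comp (contDiffOn_jetCoord hV hf) hm)

theorem eulerExpr_congr (L : JetCoord n m r → ℝ) {f g : Eu n → Eu m} {u : Eu n} (h : f =ᶠ[𝓝 u] g)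
    (σ : Fin m) : eulerExpr L f u σ = eulerExpr L g u σ := by
  unfold eulerExpr
  refine Finset.sum_congr rfl fun I _ => ?_
  congr 1
  refine iterPartial_congr I.2 ?_
  filter_upwards [h.eventuallyEq_nhds] with v hv
  rw [jetCoord_congr r hv]

/-- The Euler–Lagrange expression of a Lagrangian of order `r` depends on the `2r`-jet only. -/
theorem eulerExpr_eq_of_sameJet {L : JetCoord n m r → ℝ} {Ω : Set (JetCoord n m r)}
    (hΩ : IsOpen Ω) (hL : ContDiffOn ℝ ∞ L Ω) {f g : Eu n → Eu m} {V : Set (Eu n)}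
    (hV : IsOpen V) (hf : ContDiffOn ℝ ∞ f V) (hg : ContDiffOn ℝ ∞ g V) {u : Eu n} (hu : u ∈ V)
    (hm : jetCoord r f u ∈ Ω) (h : SameJet (2 * r) f g u) (σ : Fin m) :
    eulerExpr L f u σ = eulerExpr L g u σ := by
  unfold eulerExpr
  refine Finset.sum_congr rfl fun I _ => ?_
  congr 1
  have h1 : SameJet r (jetCoord r f) (jetCoord r g) u :=
    SameJet.jetCoord hV hf hg hu (by rwa [← two_mul])
  have h2 := h1.comp_left (Φ := partialJet L σ I)
    ((contDiffOn_partialJet hΩ hL σ I).contDiffAt (hΩ.mem_nhds hm))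
    ((contDiffOn_jetCoord hV hf).contDiffAt (hV.mem_nhds hu))
    ((contDiffOn_jetCoord hV hg).contDiffAt (hV.mem_nhds hu))
  exact sameJet_iff_iterPartial.1 h2 _ (by have := I.1.2; omega) I.2

theorem iterPartial_apply {k : ℕ} (I : Fin k → Fin n) {w : Eu n → Eu m} {u : Eu n}
    (hw : ContDiffAt ℝ ∞ w u) (σ : Fin m) :
    iterPartial I (fun v => w v σ) u = iterPartial I w u σ := by
  have h := (EuclideanSpace.proj σ : Eu m →L[ℝ] ℝ).iteratedFDeriv_comp_left hw
    (i := k) (by norm_cast; exact le_top)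
  change iteratedFDeriv ℝ k (⇑(EuclideanSpace.proj σ : Eu m →L[ℝ] ℝ) ∘ w) u _ = _
  rw [h]
  rfl

theorem tsupport_apply_subset (w : Eu n → Eu m) (σ : Fin m) :
    tsupport (fun u => w u σ) ⊆ tsupport w :=
  tsupport_comp_subset (g := fun x : Eu m => x σ) (by simp) w

/-- The first variation formula: repeated integration by parts. -/
theorem integral_fderiv_jetVec {L : JetCoord n m r → ℝ} {Ω : Set (JetCoord n m r)}
    (hΩ : IsOpen Ω) (hL : ContDiffOn ℝ ∞ L Ω) {f w : Eu n → Eu m} {V : Set (Eu n)}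
    (hV : IsOpen V) (hf : ContDiffOn ℝ ∞ f V) (hm : ∀ u ∈ V, jetCoord r f u ∈ Ω)
    (hw : ContDiff ℝ ∞ w) (hc : HasCompactSupport w) (hs : tsupport w ⊆ V) :
    ∫ u, fderiv ℝ L (jetCoord r f u) (jetVec r w u) = ∫ u, ∑ σ, w u σ * eulerExpr L f u σ := by
  have hwσ : ∀ σ, ContDiff ℝ ∞ (fun u => w u σ) := fun σ => by fun_prop
  have hsσ : ∀ σ, tsupport (fun u => w u σ) ⊆ V := fun σ => (tsupport_apply_subset w σ).trans hs
  have hcσ : ∀ σ, HasCompactSupport (fun u => w u σ) := fun σ =>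
    hc.of_isClosed_subset (isClosed_tsupport _) (tsupport_apply_subset w σ)
  have hp : ∀ σ I, ContDiffOn ℝ ∞ (fun u => partialJet L σ I (jetCoord r f u)) V := fun σ I =>
    (contDiffOn_partialJet hΩ hL σ I).comp (contDiffOn_jetCoord hV hf) hm
  have hi1 : ∀ (I : MultiIdx n r) σ, Integrable fun u =>
      iterPartial I.2 (fun v => w v σ) u * partialJet L σ I (jetCoord r f u) := fun I σ =>
    integrable_mul_of_tsupport_subset hV (hp σ I).continuousOn
      (contDiffOn_univ.1 (contDiffOn_iterPartial I.2 isOpen_univ (hwσ σ).contDiffOn)).continuous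
      ((hcσ σ).of_isClosed_subset (isClosed_tsupport _) (tsupport_iterPartial_subset I.2 _))
      ((tsupport_iterPartial_subset I.2 _).trans (hsσ σ))
  have hi2 : ∀ (I : MultiIdx n r) σ, Integrable fun u =>
      w u σ * iterPartial I.2 (fun v => partialJet L σ I (jetCoord r f v)) u := fun I σ =>
    integrable_mul_of_tsupport_subset hV
      (contDiffOn_iterPartial I.2 hV (hp σ I)).continuousOn (hwσ σ).continuous (hcσ σ) (hsσ σ)
  calc ∫ u, fderiv ℝ L (jetCoord r f u) (jetVec r w u)
      = ∫ u, ∑ I : MultiIdx n r, ∑ σ,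
          iterPartial I.2 (fun v => w v σ) u * partialJet L σ I (jetCoord r f u) := by
        refine integral_congr_ae (Eventually.of_forall fun u => ?_)
        simp only [jetVec, fderiv_vertical, iterPartial_apply _ hw.contDiffAt]
    _ = ∑ I : MultiIdx n r, ∑ σ, (-1) ^ (I.1 : ℕ) *
          ∫ u, w u σ * iterPartial I.2 (fun v => partialJet L σ I (jetCoord r f v)) u := by
        rw [integral_finsetSum _ fun I _ => integrable_finsetSum _ fun σ _ => hi1 I σ]
        refine Finset.sum_congr rfl fun I _ => ?_
        rw [integral_finsetSum _ fun σ _ => hi1 I σ]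
        exact Finset.sum_congr rfl fun σ _ =>
          integral_iterPartial_mul I.2 hV (hp σ I) (hwσ σ) (hcσ σ) (hsσ σ)
    _ = _ := by
        simp only [eulerExpr, Finset.mul_sum]
        rw [integral_finsetSum _ fun σ _ => integrable_finsetSum _ fun I _ => by
          simpa only [mul_left_comm] using (hi2 I σ).const_mul ((-1) ^ (I.1 : ℕ))]
        rw [Finset.sum_comm]
        refine Finset.sum_congr rfl fun σ _ => ?_
        rw [integral_finsetSum _ fun I _ => by
          simpa only [mul_left_comm] using (hi2 I σ).const_mul ((-1) ^ (I.1 : ℕ))]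
        refine Finset.sum_congr rfl fun I _ => ?_
        rw [← integral_const_mul]
        simp only [mul_left_comm]

/-! ### The linearized Euler–Lagrange operator -/

/-- The linearization at `f`, in the direction `v`, of the Euler–Lagrange expression `E_σ(L)`. -/
def linEuler (L : JetCoord n m r → ℝ) (f v : Eu n → Eu m) (u : Eu n) (σ : Fin m) : ℝ :=
  ∑ I : MultiIdx n r, (-1 : ℝ) ^ (I.1 : ℕ) *
    iterPartial I.2 (fun u' => fderiv ℝ (partialJet L σ I) (jetCoord r f u') (jetVec r v u')) u

theorem linEuler_congr (L : JetCoord n m r → ℝ) {f f' v v' : Eu n → Eu m} {u : Eu n}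
    (h : f =ᶠ[𝓝 u] f') (h' : v =ᶠ[𝓝 u] v') (σ : Fin m) :
    linEuler L f v u σ = linEuler L f' v' u σ := by
  unfold linEuler
  refine Finset.sum_congr rfl fun I _ => ?_
  congr 1
  refine iterPartial_congr I.2 ?_
  filter_upwards [h.eventuallyEq_nhds, h'.eventuallyEq_nhds] with x hx hx'
  rw [jetCoord_congr r hx, jetVec_congr r hx']

theorem hasDerivAt_lagrangian {L : JetCoord n m r → ℝ} {Ω : Set (JetCoord n m r)}
    (hΩ : IsOpen Ω) (hL : ContDiffOn ℝ ∞ L Ω) {g : ℝ → Eu n → Eu m} {W : Set (ℝ × Eu n)}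
    (hW : IsOpen W) (hg : ContDiffOn ℝ ∞ (fun q : ℝ × Eu n => g q.1 q.2) W)
    (hm : ∀ q ∈ W, jetCoord r (g q.1) q.2 ∈ Ω) {t : ℝ} {u : Eu n} (h : (t, u) ∈ W) :
    HasDerivAt (fun t => L (jetCoord r (g t) u)) (fderiv ℝ L (jetCoord r (g t) u)
      (jetVec r (fun u' => deriv (fun t => g t u') t) u)) t :=
  ((hL.contDiffAt (hΩ.mem_nhds (hm _ h))).differentiableAt
    (by simp)).hasFDerivAt.comp_hasDerivAt t (hasDerivAt_jetCoord hW hg h)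

theorem hasDerivAt_eulerExpr {L : JetCoord n m r → ℝ} {Ω : Set (JetCoord n m r)}
    (hΩ : IsOpen Ω) (hL : ContDiffOn ℝ ∞ L Ω) {g : ℝ → Eu n → Eu m} {W : Set (ℝ × Eu n)}
    (hW : IsOpen W) (hg : ContDiffOn ℝ ∞ (fun q : ℝ × Eu n => g q.1 q.2) W)
    (hm : ∀ q ∈ W, jetCoord r (g q.1) q.2 ∈ Ω) {t : ℝ} {u : Eu n} (h : (t, u) ∈ W) (σ : Fin m) :
    HasDerivAt (fun t => eulerExpr L (g t) u σ)
      (linEuler L (g t) (fun u' => deriv (fun t => g t u') t) u σ) t := by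
  unfold eulerExpr linEuler
  refine HasDerivAt.fun_sum fun I _ => HasDerivAt.const_mul _ ?_
  have h1 := iterPartial_hasDerivAt I.2
    (g := fun t v => partialJet L σ I (jetCoord r (g t) v)) hW
    ((contDiffOn_partialJet hΩ hL σ I).comp (contDiffOn_jetCoord_param hW hg) hm) h
  rwa [iterPartial_congr I.2 (g := fun u' => fderiv ℝ (partialJet L σ I) (jetCoord r (g t) u')
    (jetVec r (fun u' => deriv (fun t => g t u') t) u'))] at h1
  filter_upwards [(isOpen_slice hW t).mem_nhds h] with u' hu'
  exact (hasDerivAt_lagrangian hΩ (contDiffOn_partialJet hΩ hL σ I) hW hg hm hu').deriv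

theorem contDiffOn_fderiv_partialJet {L : JetCoord n m r → ℝ} {Ω : Set (JetCoord n m r)}
    (hΩ : IsOpen Ω) (hL : ContDiffOn ℝ ∞ L Ω) {f v : Eu n → Eu m} {V : Set (Eu n)}
    (hV : IsOpen V) (hf : ContDiffOn ℝ ∞ f V) (hm : ∀ u ∈ V, jetCoord r f u ∈ Ω)
    (hv : ContDiffOn ℝ ∞ v V) (σ : Fin m) (I : MultiIdx n r) :
    ContDiffOn ℝ ∞ (fun u => fderiv ℝ (partialJet L σ I) (jetCoord r f u) (jetVec r v u)) V :=
  (((contDiffOn_partialJet hΩ hL σ I).fderiv_of_isOpen hΩ (m := ∞) (by simp)).comp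
    (contDiffOn_jetCoord hV hf) hm).clm_apply (contDiffOn_jetVec hV hv)

theorem contDiffOn_linEuler {L : JetCoord n m r → ℝ} {Ω : Set (JetCoord n m r)}
    (hΩ : IsOpen Ω) (hL : ContDiffOn ℝ ∞ L Ω) {f v : Eu n → Eu m} {V : Set (Eu n)}
    (hV : IsOpen V) (hf : ContDiffOn ℝ ∞ f V) (hm : ∀ u ∈ V, jetCoord r f u ∈ Ω)
    (hv : ContDiffOn ℝ ∞ v V) (σ : Fin m) :
    ContDiffOn ℝ ∞ (fun u => linEuler L f v u σ) V := by
  unfold linEuler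
  exact ContDiffOn.sum fun I _ => contDiffOn_const.mul
    (contDiffOn_iterPartial I.2 hV (contDiffOn_fderiv_partialJet hΩ hL hV hf hm hv σ I))

/-- The second derivative of `L` along prolongations, expressed by means of `∂L/∂y^σ_I`. -/
theorem sum_mul_fderiv_partialJet {L : JetCoord n m r → ℝ} {p : JetCoord n m r}
    (hL : ContDiffAt ℝ ∞ L p) (q : MultiIdx n r → Eu m) (w : JetCoord n m r) :
    ∑ σ, ∑ I : MultiIdx n r, q I σ * fderiv ℝ (partialJet L σ I) p w =
      fderiv ℝ (fun p => fderiv ℝ L p (0, q)) p w := by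
  have hd : ∀ I σ, DifferentiableAt ℝ (partialJet L σ I) p := fun I σ =>
    ((hL.fderiv_right (m := 1) (by norm_cast)).clm_apply contDiffAt_const).differentiableAt
      (by simp)
  simp only [fderiv_vertical]
  rw [fderiv_fun_sum fun I _ => DifferentiableAt.fun_sum fun σ _ => (hd I σ).const_mul _,
    Finset.sum_comm, sum_apply]
  refine Finset.sum_congr rfl fun I _ => ?_
  rw [fderiv_fun_sum fun σ _ => (hd I σ).const_mul _, sum_apply]
  refine Finset.sum_congr rfl fun σ _ => ?_
  rw [fderiv_const_mul (hd I σ)]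
  simp

theorem contDiff_of_contDiffAt_tsupport {G : Type*} [NormedAddCommGroup G] [NormedSpace ℝ G]
    {f : P → G} (h : ∀ u ∈ tsupport f, ContDiffAt ℝ ∞ f u) : ContDiff ℝ ∞ f := by
  refine contDiff_iff_contDiffAt.2 fun u => ?_
  by_cases hu : u ∈ tsupport f
  · exact h u hu
  · exact contDiffAt_const.congr_of_eventuallyEq (notMem_tsupport_iff_eventuallyEq.1 hu)

theorem jetVec_eq_zero {w : Eu n → Eu m} {u : Eu n} (h : w =ᶠ[𝓝 u] 0) :
    jetVec r w u = 0 := by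
  rw [jetVec_congr r h]
  refine Prod.ext rfl ?_
  funext I
  simp [jetVec, iterPartial, Pi.zero_def]

/-- The linearized Euler–Lagrange operator is formally self-adjoint, since the second derivative of
the Lagrangian is symmetric. -/
theorem integral_linEuler_symm {L : JetCoord n m r → ℝ} {Ω : Set (JetCoord n m r)}
    (hΩ : IsOpen Ω) (hL : ContDiffOn ℝ ∞ L Ω) {f v w : Eu n → Eu m} {V : Set (Eu n)}
    (hV : IsOpen V) (hf : ContDiffOn ℝ ∞ f V) (hm : ∀ u ∈ V, jetCoord r f u ∈ Ω)
    (hv : ContDiffOn ℝ ∞ v V)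
    (hw : ContDiff ℝ ∞ w) (hc : HasCompactSupport w) (hs : tsupport w ⊆ V) :
    ∫ u, ∑ σ, v u σ * linEuler L f w u σ = ∫ u, ∑ σ, w u σ * linEuler L f v u σ := by
  have hwσ : ∀ σ, ContDiff ℝ ∞ (fun u => w u σ) := fun σ => by fun_prop
  have hsσ : ∀ σ, tsupport (fun u => w u σ) ⊆ V := fun σ => (tsupport_apply_subset w σ).trans hs
  have hcσ : ∀ σ, HasCompactSupport (fun u => w u σ) := fun σ =>
    hc.of_isClosed_subset (isClosed_tsupport _) (tsupport_apply_subset w σ)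
  have hvσ : ∀ σ, ContDiffOn ℝ ∞ (fun u => v u σ) V := fun σ => by
    exact (EuclideanSpace.proj σ : Eu m →L[ℝ] ℝ).contDiff.comp_contDiffOn hv
  -- Both sides become integrals of the second derivative of `L` at the two variations: on each side
  -- `iterPartial` is moved, by parts, from `a` or `b` to the other factor. The coefficients `a`
  -- have compact support in `V`; the coefficients `b` need not, but are paired with `w`.
  set a : Fin m → MultiIdx n r → Eu n → ℝ := fun σ I u =>
    fderiv ℝ (partialJet L σ I) (jetCoord r f u) (jetVec r w u) with ha
  set b : Fin m → MultiIdx n r → Eu n → ℝ := fun σ I u =>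
    fderiv ℝ (partialJet L σ I) (jetCoord r f u) (jetVec r v u) with hb
  have hbs : ∀ σ I, ContDiffOn ℝ ∞ (b σ I) V := fun σ I =>
    contDiffOn_fderiv_partialJet hΩ hL hV hf hm hv σ I
  have hats : ∀ σ I, tsupport (a σ I) ⊆ tsupport w := fun σ I => by
    refine closure_minimal (fun u hu => ?_) (isClosed_tsupport w)
    by_contra h
    refine hu ?_
    simp only [ha]
    rw [jetVec_eq_zero (notMem_tsupport_iff_eventuallyEq.1 h), map_zero]
  have has : ∀ σ I, ContDiff ℝ ∞ (a σ I) := fun σ I => contDiff_of_contDiffAt_tsupport fun u hu =>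
    (contDiffOn_fderiv_partialJet hΩ hL hV hf hm hw.contDiffOn σ I).contDiffAt
      (hV.mem_nhds (hs (hats σ I hu)))
  have hac : ∀ σ I, HasCompactSupport (a σ I) := fun σ I =>
    hc.of_isClosed_subset (isClosed_tsupport _) (hats σ I)
  have hi1 : ∀ σ (I : MultiIdx n r), Integrable fun u =>
      iterPartial I.2 (a σ I) u * v u σ := fun σ I =>
    integrable_mul_of_tsupport_subset hV (hvσ σ).continuousOn
      (contDiffOn_univ.1 (contDiffOn_iterPartial I.2 isOpen_univ (has σ I).contDiffOn)).continuous
      ((hac σ I).of_isClosed_subset (isClosed_tsupport _) (tsupport_iterPartial_subset I.2 _))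
      ((tsupport_iterPartial_subset I.2 _).trans ((hats σ I).trans hs))
  have hi2 : ∀ σ (I : MultiIdx n r), Integrable fun u =>
      w u σ * iterPartial I.2 (b σ I) u := fun σ I =>
    integrable_mul_of_tsupport_subset hV
      (contDiffOn_iterPartial I.2 hV (hbs σ I)).continuousOn (hwσ σ).continuous (hcσ σ) (hsσ σ)
  have hi3 : ∀ σ (I : MultiIdx n r), Integrable fun u =>
      a σ I u * iterPartial I.2 (fun u => v u σ) u := fun σ I =>
    integrable_mul_of_tsupport_subset hV
      (contDiffOn_iterPartial I.2 hV (hvσ σ)).continuousOn (has σ I).continuous (hac σ I)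
      ((hats σ I).trans hs)
  have hi4 : ∀ σ (I : MultiIdx n r), Integrable fun u =>
      iterPartial I.2 (fun u => w u σ) u * b σ I u := fun σ I =>
    integrable_mul_of_tsupport_subset hV (hbs σ I).continuousOn
      (contDiffOn_univ.1 (contDiffOn_iterPartial I.2 isOpen_univ (hwσ σ).contDiffOn)).continuous
      ((hcσ σ).of_isClosed_subset (isClosed_tsupport _) (tsupport_iterPartial_subset I.2 _))
      ((tsupport_iterPartial_subset I.2 _).trans (hsσ σ))
  have hsign : ∀ k : ℕ, ((-1 : ℝ) ^ k) * (-1) ^ k = 1 := fun k => by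
    rw [← mul_pow]; norm_num
  have lhs : ∫ u, ∑ σ, v u σ * linEuler L f w u σ =
      ∫ u, ∑ σ, ∑ I : MultiIdx n r, a σ I u * iterPartial I.2 (fun u => v u σ) u := by
    simp only [linEuler, Finset.mul_sum]
    have hi1' : ∀ σ (I : MultiIdx n r), Integrable fun u =>
        v u σ * ((-1) ^ (I.1 : ℕ) * iterPartial I.2 (a σ I) u) := fun σ I => by
      refine ((hi1 σ I).const_mul ((-1) ^ (I.1 : ℕ))).congr (Eventually.of_forall fun u => ?_)
      simp only; ring
    rw [integral_finsetSum _ fun σ _ => integrable_finsetSum _ fun I _ => hi1' σ I,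
      integral_finsetSum _ fun σ _ => integrable_finsetSum _ fun I _ => hi3 σ I]
    refine Finset.sum_congr rfl fun σ _ => ?_
    rw [integral_finsetSum _ fun I _ => hi1' σ I, integral_finsetSum _ fun I _ => hi3 σ I]
    refine Finset.sum_congr rfl fun I _ => ?_
    have := integral_iterPartial_mul I.2 hV (hvσ σ) (has σ I) (hac σ I) ((hats σ I).trans hs)
    calc _ = (-1) ^ (I.1 : ℕ) * ∫ u, iterPartial I.2 (a σ I) u * v u σ := by
          rw [← integral_const_mul]
          refine integral_congr_ae (Eventually.of_forall fun u => ?_)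
          simp only; ring
      _ = _ := by rw [this, ← mul_assoc, hsign, one_mul]
  have rhs : ∫ u, ∑ σ, w u σ * linEuler L f v u σ =
      ∫ u, ∑ σ, ∑ I : MultiIdx n r, iterPartial I.2 (fun u => w u σ) u * b σ I u := by
    simp only [linEuler, Finset.mul_sum]
    have hi2' : ∀ σ (I : MultiIdx n r), Integrable fun u =>
        w u σ * ((-1) ^ (I.1 : ℕ) * iterPartial I.2 (b σ I) u) := fun σ I => by
      refine ((hi2 σ I).const_mul ((-1) ^ (I.1 : ℕ))).congr (Eventually.of_forall fun u => ?_)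
      simp only; ring
    rw [integral_finsetSum _ fun σ _ => integrable_finsetSum _ fun I _ => hi2' σ I,
      integral_finsetSum _ fun σ _ => integrable_finsetSum _ fun I _ => hi4 σ I]
    refine Finset.sum_congr rfl fun σ _ => ?_
    rw [integral_finsetSum _ fun I _ => hi2' σ I, integral_finsetSum _ fun I _ => hi4 σ I]
    refine Finset.sum_congr rfl fun I _ => ?_
    rw [integral_iterPartial_mul I.2 hV (hbs σ I) (hwσ σ) (hcσ σ) (hsσ σ), ← integral_const_mul]
    refine integral_congr_ae (Eventually.of_forall fun u => ?_)
    simp only; ring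
  rw [lhs, rhs]
  refine integral_congr_ae (Eventually.of_forall fun u => ?_)
  simp only
  by_cases hu : u ∈ tsupport w
  · have huV := hs hu
    have hLu := hL.contDiffAt (hΩ.mem_nhds (hm u huV))
    have e1 := sum_mul_fderiv_partialJet hLu (jetVec r v u).2 (jetVec r w u)
    have e2 := sum_mul_fderiv_partialJet hLu (jetVec r w u).2 (jetVec r v u)
    have e3 := fderiv_fderiv_apply_comm hLu (0, (jetVec r v u).2) (0, (jetVec r w u).2)
    simp only [jetVec] at e1 e2 e3
    rw [e3, ← e2] at e1
    simp only [ha, hb, iterPartial_apply _ hw.contDiffAt,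
      iterPartial_apply _ (hv.contDiffAt (hV.mem_nhds huV)), jetVec]
    simpa only [mul_comm] using e1
  · have h0 : w =ᶠ[𝓝 u] 0 := notMem_tsupport_iff_eventuallyEq.1 hu
    have e : ∀ σ (I : MultiIdx n r), iterPartial I.2 (fun u => w u σ) u = 0 := fun σ I =>
      image_eq_zero_of_notMem_tsupport fun h =>
        hu (tsupport_apply_subset w σ (tsupport_iterPartial_subset I.2 _ h))
    simp [ha, e, jetVec_eq_zero h0]

/-! ### The Euler–Lagrange expression of `Ξ ⌟ E(L)` -/

/-- The fundamental lemma of the calculus of variations. -/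
theorem eq_zero_of_integral_mul_eq_zero {N : Set (Eu n)} (hN : IsOpen N) {h : Eu n → ℝ}
    (hh : ContinuousOn h N) (H : ∀ η : Eu n → ℝ, ContDiff ℝ ∞ η → HasCompactSupport η →
      tsupport η ⊆ N → ∫ u, η u * h u = 0) : ∀ u ∈ N, h u = 0 := by
  have h1 := hN.ae_eq_zero_of_integral_contDiff_smul_eq_zero
    (hh.locallyIntegrableOn hN.measurableSet) (μ := (volume : Measure (Eu n)))
    (by simpa only [smul_eq_mul] using H)
  have h2 : h =ᵐ[volume.restrict N] fun _ => 0 := (ae_restrict_iff' hN.measurableSet).2 h1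
  exact Measure.eqOn_open_of_ae_eq h2 hN hh continuousOn_const

theorem isOpen_jetDomain' {T : Set (Eu n × Eu m)} (hT : IsOpen T) (r : ℕ) :
    IsOpen {p : JetCoord n m r | (p.1, p.2 (MultiIdx.empty n r)) ∈ T} :=
  hT.preimage (by fun_prop)

theorem jetCoord_mem_iff (r : ℕ) {T : Set (Eu n × Eu m)} (f : Eu n → Eu m) (u : Eu n) :
    jetCoord r f u ∈ {p : JetCoord n m r | (p.1, p.2 (MultiIdx.empty n r)) ∈ T} ↔
      (u, f u) ∈ T := by
  rw [mem_ofPred_eq, jetCoord_empty]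
  rfl

/-- The Lagrangian `Ξ ⌟ E(L)` is defined by means of a Taylor polynomial; as `E(L)` has order `2r`,
its value at the jet of `f` is that of `Ξ^σ E_σ(L)` along `f`. -/
theorem contractEuler_jetCoord {T : Set (Eu n × Eu m)} (hT : IsOpen T) {L : JetCoord n m r → ℝ}
    (hL : ContDiffOn ℝ ∞ L {p | (p.1, p.2 (MultiIdx.empty n r)) ∈ T}) (Ξ : Eu n × Eu m → Eu m)
    {f : Eu n → Eu m} {V : Set (Eu n)}
    (hV : IsOpen V) (hf : ContDiffOn ℝ ∞ f V) {u : Eu n} (hu : u ∈ V) (hm : (u, f u) ∈ T) :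
    contractEuler Ξ L (jetCoord (2 * r) f u) = ∑ σ, Ξ (u, f u) σ * eulerExpr L f u σ := by
  unfold contractEuler
  rw [jetCoord_empty]
  refine Finset.sum_congr rfl fun σ _ => ?_
  congr 1
  refine (eulerExpr_eq_of_sameJet (isOpen_jetDomain' hT r) hL hV hf
    (contDiff_taylorPoly _).contDiffOn hu ((jetCoord_mem_iff r f u).2 hm)
    (sameJet_taylorPoly hV hf hu).symm σ).symm

theorem contDiffOn_contractEuler {T : Set (Eu n × Eu m)} (hT : IsOpen T) {L : JetCoord n m r → ℝ}
    (hL : ContDiffOn ℝ ∞ L {p | (p.1, p.2 (MultiIdx.empty n r)) ∈ T}) {Ξ : Eu n × Eu m → Eu m}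
    (hΞ : ContDiffOn ℝ ∞ Ξ T) : ContDiffOn ℝ ∞ (contractEuler Ξ L)
      {p | (p.1, p.2 (MultiIdx.empty n (2 * r))) ∈ T} := by
  unfold contractEuler
  refine ContDiffOn.sum fun σ _ => ContDiffOn.mul ?_ ?_
  · have h1 : ContDiffOn ℝ ∞
        (fun p : JetCoord n m (2 * r) => Ξ (p.1, p.2 (MultiIdx.empty n (2 * r))))
        {p | (p.1, p.2 (MultiIdx.empty n (2 * r))) ∈ T} := by
      refine hΞ.comp (ContDiff.contDiffOn ?_) (fun p hp => hp)
      fun_prop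
    exact (EuclideanSpace.proj σ : Eu m →L[ℝ] ℝ).contDiff.comp_contDiffOn h1
  · have hW : IsOpen {q : JetCoord n m (2 * r) × Eu n | (q.2, taylorPoly q.1 q.2) ∈ T} :=
      hT.preimage (continuous_snd.prodMk contDiff_taylorPoly_param.continuous)
    have h2 := contDiffOn_eulerExpr_param (isOpen_jetDomain' hT r) hL hW
      (g := taylorPoly) contDiff_taylorPoly_param.contDiffOn (fun q hq =>
        (jetCoord_mem_iff r _ _).2 hq) σ
    have h3 : ContDiff ℝ ∞ (fun p : JetCoord n m (2 * r) => (p, p.1)) := by fun_prop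
    have h4 : MapsTo (fun p : JetCoord n m (2 * r) => (p, p.1))
        {p | (p.1, p.2 (MultiIdx.empty n (2 * r))) ∈ T}
        {q : JetCoord n m (2 * r) × Eu n | (q.2, taylorPoly q.1 q.2) ∈ T} := fun p hp => by
      change (p.1, taylorPoly p p.1) ∈ T
      rwa [taylorPoly_self]
    change ContDiffOn ℝ ∞ ((fun q : JetCoord n m (2 * r) × Eu n =>
      eulerExpr L (taylorPoly q.1) q.2 σ) ∘ fun p => (p, p.1)) _
    exact h2.comp h3.contDiffOn h4

/-- Where `f` satisfies the Euler–Lagrange equations, the Euler–Lagrange expression of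
`Ξ ⌟ E(L)` along `f` is the linearized Euler–Lagrange operator applied to `Ξ ∘ f`. -/
theorem eulerExpr_contractEuler {T : Set (Eu n × Eu m)} (hT : IsOpen T) {L : JetCoord n m r → ℝ}
    (hL : ContDiffOn ℝ ∞ L {p | (p.1, p.2 (MultiIdx.empty n r)) ∈ T}) {Ξ : Eu n × Eu m → Eu m}
    (hΞ : ContDiffOn ℝ ∞ Ξ T) {f : Eu n → Eu m} {N : Set (Eu n)} (hN : IsOpen N)
    (hf : ContDiffOn ℝ ∞ f N) (hm : ∀ u ∈ N, (u, f u) ∈ T)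
    (hE : ∀ u ∈ N, ∀ σ, eulerExpr L f u σ = 0) :
    ∀ u ∈ N, ∀ σ, eulerExpr (contractEuler Ξ L) f u σ =
      linEuler L f (fun u => Ξ (u, f u)) u σ := by
  intro u hu σ
  have hΩ := isOpen_jetDomain' hT r
  have hΩ' := isOpen_jetDomain' hT (2 * r)
  have hΛ := contDiffOn_contractEuler hT hL hΞ
  have hm' : ∀ r', ∀ u ∈ N,
      jetCoord r' f u ∈ {p : JetCoord n m r' | (p.1, p.2 (MultiIdx.empty n r')) ∈ T} :=
    fun r' u hu => (jetCoord_mem_iff r' f u).2 (hm u hu)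
  have hν : ContDiffOn ℝ ∞ (fun u => Ξ (u, f u)) N :=
    hΞ.comp (contDiffOn_id.prodMk hf) hm
  have c1 := contDiffOn_eulerExpr hΩ' hΛ hN hf (hm' _) σ
  have c2 := contDiffOn_linEuler hΩ hL hN hf (hm' _) hν σ
  refine sub_eq_zero.1 (eq_zero_of_integral_mul_eq_zero hN (c1.continuousOn.sub c2.continuousOn)
    (fun η hη hηc hηs => ?_) u hu)
  set w : Eu n → Eu m := fun u => EuclideanSpace.single σ (η u) with hw
  have hw_eq : ∀ u, w u = η u • EuclideanSpace.single σ (1 : ℝ) := fun u => by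
    ext τ; simp [hw, PiLp.single_apply]
  have hws : ContDiff ℝ ∞ w := by
    rw [funext hw_eq]
    fun_prop
  have hwt : tsupport w ⊆ tsupport η :=
    tsupport_comp_subset (g := fun x : ℝ => (EuclideanSpace.single σ x : Eu m)) (by simp) η
  have hwc : HasCompactSupport w := hηc.of_isClosed_subset (isClosed_tsupport _) hwt
  have i1 := integral_fderiv_jetVec hΩ' hΛ hN hf (hm' _) hws hwc (hwt.trans hηs)
  have i2 := integral_linEuler_symm hΩ hL hN hf (hm' _) hν hws hwc (hwt.trans hηs)
  -- The derivative of `t ↦ (Ξ ⌟ E(L))(j(f + t w))` at `t = 0`, computed by the product rule. The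
  -- term with the derivative of `Ξ` contains `E(L)` along `f`, which vanishes.
  have key : ∀ u, fderiv ℝ (contractEuler Ξ L) (jetCoord (2 * r) f u) (jetVec (2 * r) w u) =
      ∑ σ, Ξ (u, f u) σ * linEuler L f w u σ := by
    intro u
    by_cases hu : u ∈ tsupport w
    swap
    · have h0 := notMem_tsupport_iff_eventuallyEq.1 hu
      rw [jetVec_eq_zero h0, map_zero]
      symm
      refine Finset.sum_eq_zero fun τ _ => ?_
      unfold linEuler
      refine mul_eq_zero_of_right _ (Finset.sum_eq_zero fun I _ => mul_eq_zero_of_right _ ?_)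
      rw [iterPartial_congr I.2 (g := 0)]
      · simp [iterPartial, Pi.zero_def]
      · filter_upwards [h0.eventuallyEq_nhds] with x hx
        simp [jetVec_eq_zero hx]
    have huN := hηs (hwt hu)
    set W : Set (ℝ × Eu n) := {q | q.2 ∈ N ∧ (q.2, f q.2 + q.1 • w q.2) ∈ T} with hWdef
    have hcont : ContDiffOn ℝ ∞ (fun q : ℝ × Eu n => f q.2 + q.1 • w q.2) {q | q.2 ∈ N} :=
      (hf.comp contDiffOn_snd fun q hq => hq).add
        (contDiff_fst.smul (hws.comp contDiff_snd)).contDiffOn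
    have hNo : IsOpen {q : ℝ × Eu n | q.2 ∈ N} := hN.preimage continuous_snd
    have hW : IsOpen W := by
      have : W = {q | q.2 ∈ N} ∩ (fun q : ℝ × Eu n => (q.2, f q.2 + q.1 • w q.2)) ⁻¹' T := rfl
      rw [this]
      exact (continuousOn_snd.prodMk hcont.continuousOn).isOpen_inter_preimage hNo hT
    have hg : ContDiffOn ℝ ∞ (fun q : ℝ × Eu n => f q.2 + q.1 • w q.2) W :=
      hcont.mono fun q hq => hq.1
    have h0W : ((0 : ℝ), u) ∈ W := ⟨huN, by simpa using hm u huN⟩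
    have hmW : ∀ r', ∀ q ∈ W, jetCoord r' (fun v => f v + q.1 • w v) q.2 ∈
        {p : JetCoord n m r' | (p.1, p.2 (MultiIdx.empty n r')) ∈ T} := fun r' q hq =>
      (jetCoord_mem_iff r' _ _).2 hq.2
    have hder : (fun u' => deriv (fun t : ℝ => f u' + t • w u') 0) = w := by
      funext u'
      have := ((hasDerivAt_id (0 : ℝ)).smul_const (w u')).const_add (f u')
      simpa using this.deriv
    have hf0 : (fun v => f v + (0 : ℝ) • w v) = f := by simp
    have d1 := hasDerivAt_lagrangian hΩ' hΛ hW (g := fun t v => f v + t • w v) hg (hmW _) h0W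
    have d2 := fun τ => hasDerivAt_eulerExpr hΩ hL hW (g := fun t v => f v + t • w v) hg (hmW _)
      h0W τ
    simp only [hder, hf0] at d1 d2
    have d3 : ∀ τ, HasDerivAt (fun t : ℝ => Ξ (u, f u + t • w u) τ)
        (deriv (fun t : ℝ => Ξ (u, f u + t • w u) τ) 0) 0 := by
      intro τ
      refine DifferentiableAt.hasDerivAt ?_
      have e1 : DifferentiableAt ℝ Ξ (u, f u + (0 : ℝ) • w u) :=
        (hΞ.contDiffAt (hT.mem_nhds (by simpa using hm u huN))).differentiableAt (by simp)
      have e2 : DifferentiableAt ℝ (fun t : ℝ => (u, f u + t • w u)) 0 := by fun_prop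
      exact (EuclideanSpace.proj τ : Eu m →L[ℝ] ℝ).differentiableAt.comp 0 (e1.comp (0 : ℝ) e2)
    have d4 : HasDerivAt (fun t : ℝ => ∑ τ, Ξ (u, f u + t • w u) τ *
        eulerExpr L (fun v => f v + t • w v) u τ) (∑ τ, Ξ (u, f u) τ * linEuler L f w u τ) 0 := by
      refine HasDerivAt.fun_sum fun τ _ => ?_
      have := (d3 τ).mul (d2 τ)
      simp only [zero_smul, add_zero] at this
      rw [show (fun v => f v) = f from rfl, hE u huN, mul_zero, zero_add] at this
      exact this
    refine d1.unique (d4.congr_of_eventuallyEq ?_)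
    have : ∀ᶠ t : ℝ in 𝓝 0, (t, u) ∈ W :=
      (hW.preimage (f := fun t' : ℝ => (t', u)) (by fun_prop)).mem_nhds h0W
    filter_upwards [this] with t ht
    exact contractEuler_jetCoord hT hL Ξ (isOpen_slice hW t)
      (contDiffOn_slice (g := fun (t : ℝ) v => f v + t • w v) hg t) ht ht.2
  have hsum : ∀ h : Fin m → ℝ, ∀ u, ∑ τ, w u τ * h τ = η u * h σ := fun h u => by
    simp [hw, PiLp.single_apply]
  simp only [key, hsum] at i1 i2
  have j1 : Integrable fun u => η u * eulerExpr (contractEuler Ξ L) f u σ :=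
    integrable_mul_of_tsupport_subset hN c1.continuousOn hη.continuous hηc hηs
  have j2 : Integrable fun u => η u * linEuler L f (fun u => Ξ (u, f u)) u σ :=
    integrable_mul_of_tsupport_subset hN c2.continuousOn hη.continuous hηc hηs
  have e : ∀ u, η u * (eulerExpr (contractEuler Ξ L) f u σ -
      linEuler L f (fun u => Ξ (u, f u)) u σ) = η u * eulerExpr (contractEuler Ξ L) f u σ -
      η u * linEuler L f (fun u => Ξ (u, f u)) u σ := fun u => mul_sub _ _ _
  calc _ = ∫ u, (η u * eulerExpr (contractEuler Ξ L) f u σ -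
      η u * linEuler L f (fun u => Ξ (u, f u)) u σ) := integral_congr_ae (Eventually.of_forall e)
    _ = 0 := by rw [integral_sub j1 j2, ← i1, i2, sub_self]

end Euler

/-! ### Differentiation under the integral sign -/

theorem hasDerivAt_integral_mul {n : ℕ} {K : Set (Eu n)} (hK : IsCompact K) {W : Set (ℝ × Eu n)}
    (hW : IsOpen W) (hKW : ∀ u ∈ K, ((0 : ℝ), u) ∈ W) {g : ℝ → Eu n → ℝ}
    (hg : ContDiffOn ℝ ∞ (fun q : ℝ × Eu n => g q.1 q.2) W) {a : Eu n → ℝ}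
    (ha : ContinuousOn a K) :
    HasDerivAt (fun t => ∫ u in K, a u * g t u)
      (∫ u in K, a u * deriv (fun t => g t u) 0) 0 := by
  obtain ⟨A, B, hA, hB, h0A, hKB, hAB⟩ := generalized_tube_lemma
    (isCompact_singleton (x := (0 : ℝ))) hK hW (by rintro ⟨t, u⟩ ⟨rfl, hu⟩; exact hKW u hu)
  obtain ⟨δ, hδ, hδA⟩ := Metric.isOpen_iff.1 hA 0 (h0A rfl)
  have hsub : Metric.closedBall (0 : ℝ) (δ / 2) ×ˢ K ⊆ W := fun q hq =>
    hAB ⟨hδA (Metric.closedBall_subset_ball (by linarith) hq.1), hKB hq.2⟩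
  have hd := contDiffOn_deriv_param hW hg
  have hcomp : IsCompact (Metric.closedBall (0 : ℝ) (δ / 2) ×ˢ K) :=
    (isCompact_closedBall _ _).prod hK
  obtain ⟨C, hC⟩ := hcomp.exists_bound_of_continuousOn (f := fun q : ℝ × Eu n =>
      a q.2 * deriv (fun t => g t q.2) q.1)
    ((ha.comp continuousOn_snd fun q hq => hq.2).mul (hd.continuousOn.mono hsub))
  have hslice : ∀ {h : ℝ → Eu n → ℝ}, ContDiffOn ℝ ∞ (fun q : ℝ × Eu n => h q.1 q.2) W →
      ∀ t ∈ Metric.closedBall (0 : ℝ) (δ / 2), ContinuousOn (fun u => a u * h t u) K :=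
    fun hh t ht => ha.mul ((contDiffOn_slice hh t).continuousOn.mono fun u hu => hsub ⟨ht, hu⟩)
  have h0 : (0 : ℝ) ∈ Metric.closedBall (0 : ℝ) (δ / 2) := by simp; positivity
  refine (hasDerivAt_integral_of_dominated_loc_of_deriv_le
    (Metric.closedBall_mem_nhds (0 : ℝ) (half_pos hδ)) (bound := fun _ => C)
    (F' := fun t u => a u * deriv (fun t => g t u) t) ?_ ?_ ?_ ?_ ?_ ?_).2
  · filter_upwards [Metric.closedBall_mem_nhds (0 : ℝ) (half_pos hδ)] with t ht
    exact (hslice hg t ht).aestronglyMeasurable hK.measurableSet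
  · exact (hslice hg 0 h0).integrableOn_compact hK
  · exact (hslice (h := fun t u => deriv (fun t => g t u) t) hd 0 h0).aestronglyMeasurable
      hK.measurableSet
  · filter_upwards [ae_restrict_mem hK.measurableSet] with u hu t ht
    exact hC (t, u) ⟨ht, hu⟩
  · exact continuousOn_const.integrableOn_compact hK
  · filter_upwards [ae_restrict_mem hK.measurableSet] with u hu t ht
    exact (hasDerivAt_slice hW hg (hsub ⟨ht, hu⟩)).differentiableAt.hasDerivAt.const_mul _


/-! ### Fibered charts and coordinate representations of sections -/

section Fibered

variable {n m r : ℕ} {X Y P : Type*}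
  [TopologicalSpace X] [ChartedSpace (Eu n) X]
  [TopologicalSpace Y] [ChartedSpace (Eu n × Eu m) Y] {π : Y → X}
  [NormedAddCommGroup P] [NormedSpace ℝ P]

/-- The normal form of a submersion is a fibered chart, once the complement that occurs in it is
identified with `Eu m`. -/
theorem exists_fiberedChart [IsManifold 𝓘(ℝ, Eu n × Eu m) ∞ Y] (hπ : IsFibered n m π) (y : Y) :
    ∃ ψ : FiberedChart n m π, y ∈ ψ.tot.source := by
  have h := hπ.2.isSubmersionAt y
  have hfin : FiniteDimensional ℝ h.complement :=
    FiniteDimensional.of_surjective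
      ((LinearMap.snd ℝ (Eu n) h.complement).comp h.equiv.toLinearEquiv.toLinearMap)
      (by
        intro z
        obtain ⟨w, hw⟩ := h.equiv.surjective (0, z)
        exact ⟨w, by
          change (h.equiv w).2 = z
          rw [hw]⟩)
  have hrank : Module.finrank ℝ h.complement = Module.finrank ℝ (Eu m) := by
    have := h.equiv.toLinearEquiv.finrank_eq
    simp only [Module.finrank_prod, finrank_euclideanSpace, Fintype.card_fin] at this
    simpa using this.symm
  let Θ : (Eu n × Eu m) ≃L[ℝ] (Eu n × Eu m) := h.equiv.trans
    ((ContinuousLinearEquiv.refl ℝ (Eu n)).prodCongr (ContinuousLinearEquiv.ofFinrankEq hrank))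
  have hΘ : ∀ z, (Θ z).1 = (h.equiv z).1 := fun z => rfl
  have hdom := h.domChart_mem_maximalAtlas
  refine ⟨⟨h.domChart.transHomeomorph Θ.toHomeomorph, h.codChart, ?_,
    h.codChart_mem_maximalAtlas, fun z hz => h.source_subset_preimage_source hz, ?_⟩,
    h.mem_domChart_source⟩
  · refine OpenPartialHomeomorph.mem_maximalAtlas_of_contMDiffOn (I := 𝓘(ℝ, Eu n × Eu m))
      (n := ∞) _ ?_ ?_
    · exact Θ.contDiff.contMDiff.comp_contMDiffOn (contMDiffOn_of_mem_maximalAtlas hdom)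
    · exact (contMDiffOn_symm_of_mem_maximalAtlas hdom).comp
        Θ.symm.contDiff.contMDiff.contMDiffOn (fun z hz => hz)
  · intro z hz
    change (Θ (h.domChart z)).1 = h.codChart (π z)
    rw [hΘ]
    have hz' : h.domChart z ∈ (h.domChart.extend 𝓘(ℝ, Eu n × Eu m)).target := by
      simpa using h.domChart.map_source hz
    have := h.writtenInCharts hz'
    simpa [h.domChart.left_inv hz] using this.symm

theorem FiberedChart.tot_eq (ψ : FiberedChart n m π) {γ : X → Y} {x : X} (hx : π (γ x) = x)
    (h : γ x ∈ ψ.tot.source) : ψ.tot (γ x) = (ψ.base x, ψ.rep γ (ψ.base x)) := by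
  have hb : x ∈ ψ.base.source := hx ▸ ψ.mapsTo _ h
  refine Prod.ext ?_ ?_
  · rw [ψ.fst_eq _ h, hx]
  · simp only [FiberedChart.rep, ψ.base.left_inv hb]

theorem FiberedChart.mem_base (ψ : FiberedChart n m π) {γ : X → Y} {x : X} (hx : π (γ x) = x)
    (h : γ x ∈ ψ.tot.source) : x ∈ ψ.base.source := hx ▸ ψ.mapsTo _ h

/-- The parameters and coordinates at which a family of sections over `U` is represented in a
fibered chart. -/
def FiberedChart.repDomain (ψ : FiberedChart n m π) (Γ : P → X → Y) (A : Set P) (U : Set X) :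
    Set (P × Eu n) :=
  {q | q.1 ∈ A ∧ q.2 ∈ ψ.base.target ∧ ψ.base.symm q.2 ∈ U ∧
    Γ q.1 (ψ.base.symm q.2) ∈ ψ.tot.source}

theorem FiberedChart.contMDiffOn_aux (ψ : FiberedChart n m π) :
    ContMDiffOn 𝓘(ℝ, P × Eu n) (𝓘(ℝ, P).prod 𝓘(ℝ, Eu n)) ∞
      (fun q : P × Eu n => (q.1, ψ.base.symm q.2)) (univ ×ˢ ψ.base.target) :=
  contDiff_fst.contMDiff.contMDiffOn.prodMk ((contMDiffOn_symm_of_mem_maximalAtlas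
    ψ.base_mem).comp contDiff_snd.contMDiff.contMDiffOn fun _ hq => hq.2)

theorem FiberedChart.isOpen_repDomain (ψ : FiberedChart n m π) {Γ : P → X → Y} {A : Set P}
    {U : Set X} (hA : IsOpen A) (hU : IsOpen U)
    (hΓ : ContMDiffOn (𝓘(ℝ, P).prod 𝓘(ℝ, Eu n)) 𝓘(ℝ, Eu n × Eu m) ∞
      (fun q : P × X => Γ q.1 q.2) (A ×ˢ U)) : IsOpen (ψ.repDomain Γ A U) := by
  have h1 : IsOpen ((A ×ˢ U) ∩ (fun q : P × X => Γ q.1 q.2) ⁻¹' ψ.tot.source) :=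
    hΓ.continuousOn.isOpen_inter_preimage (hA.prod hU) ψ.tot.open_source
  have h2 := (ψ.contMDiffOn_aux (P := P)).continuousOn.isOpen_inter_preimage
    (isOpen_univ.prod ψ.base.open_target) h1
  convert h2 using 1
  ext q
  simp only [FiberedChart.repDomain, mem_ofPred_eq, mem_inter_iff, mem_preimage, mem_prod, mem_univ]
  tauto

theorem FiberedChart.contDiffOn_rep_param (ψ : FiberedChart n m π) {Γ : P → X → Y} {A : Set P}
    {U : Set X} (hΓ : ContMDiffOn (𝓘(ℝ, P).prod 𝓘(ℝ, Eu n)) 𝓘(ℝ, Eu n × Eu m) ∞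
      (fun q : P × X => Γ q.1 q.2) (A ×ˢ U)) :
    ContDiffOn ℝ ∞ (fun q : P × Eu n => ψ.rep (Γ q.1) q.2) (ψ.repDomain Γ A U) := by
  have h1 : ContMDiffOn 𝓘(ℝ, P × Eu n) 𝓘(ℝ, Eu n × Eu m) ∞
      (fun q : P × Eu n => Γ q.1 (ψ.base.symm q.2)) (ψ.repDomain Γ A U) :=
    hΓ.comp (ψ.contMDiffOn_aux.mono fun q hq => ⟨mem_univ _, hq.2.1⟩)
      (fun q hq => ⟨hq.1, hq.2.2.1⟩)
  have h2 := (contMDiffOn_of_mem_maximalAtlas ψ.tot_mem).comp h1 (fun q hq => hq.2.2.2)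
  exact contDiff_snd.comp_contDiffOn h2.contDiffOn

/-- The coordinates at which a section over `U` is represented in a fibered chart. -/
def FiberedChart.repSet (ψ : FiberedChart n m π) (γ : X → Y) (U : Set X) : Set (Eu n) :=
  {u | u ∈ ψ.base.target ∧ ψ.base.symm u ∈ U ∧ γ (ψ.base.symm u) ∈ ψ.tot.source}

theorem FiberedChart.isOpen_repSet (ψ : FiberedChart n m π) {γ : X → Y} {U : Set X}
    (hγ : IsSectionOn n m π γ U) : IsOpen (ψ.repSet γ U) := by
  have h1 := hγ.2.1.continuousOn.isOpen_inter_preimage hγ.1 ψ.tot.open_source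
  exact ψ.base.symm.isOpen_inter_preimage h1

theorem FiberedChart.contDiffOn_rep (ψ : FiberedChart n m π) {γ : X → Y} {U : Set X}
    (hγ : IsSectionOn n m π γ U) : ContDiffOn ℝ ∞ (ψ.rep γ) (ψ.repSet γ U) := by
  have h1 := hγ.2.1.comp ((contMDiffOn_symm_of_mem_maximalAtlas ψ.base_mem).mono
    (s := ψ.base.target) (t := ψ.repSet γ U) (fun q hq => hq.1)) (fun q hq => hq.2.1)
  have h2 := (contMDiffOn_of_mem_maximalAtlas ψ.tot_mem).comp h1 (fun q hq => hq.2.2)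
  exact contDiff_snd.comp_contDiffOn h2.contDiffOn

theorem FiberedChart.mem_repSet (ψ : FiberedChart n m π) {γ : X → Y} {U : Set X}
    (hγ : IsSectionOn n m π γ U) {x : X} (hx : x ∈ U) (h : γ x ∈ ψ.tot.source) :
    ψ.base x ∈ ψ.repSet γ U := by
  have hb := ψ.mem_base (hγ.2.2 x hx) h
  exact ⟨ψ.base.map_source hb, by rwa [ψ.base.left_inv hb], by rwa [ψ.base.left_inv hb]⟩

theorem FiberedChart.rep_mem_target (ψ : FiberedChart n m π) {γ : X → Y} {u : Eu n}
    (hu : u ∈ ψ.base.target) (hs : π (γ (ψ.base.symm u)) = ψ.base.symm u)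
    (h : γ (ψ.base.symm u) ∈ ψ.tot.source) : (u, ψ.rep γ u) ∈ ψ.tot.target := by
  have := ψ.tot_eq hs h
  rw [ψ.base.right_inv hu] at this
  rw [← this]
  exact ψ.tot.map_source h

theorem FiberedChart.symm_rep (ψ : FiberedChart n m π) {γ : X → Y} {u : Eu n}
    (hu : u ∈ ψ.base.target) (hs : π (γ (ψ.base.symm u)) = ψ.base.symm u)
    (h : γ (ψ.base.symm u) ∈ ψ.tot.source) :
    ψ.tot.symm (u, ψ.rep γ u) = γ (ψ.base.symm u) := by
  have := ψ.tot_eq hs h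
  rw [ψ.base.right_inv hu] at this
  rw [← this, ψ.tot.left_inv h]

/-! ### Jets in different fibered charts -/

/-- Equality of jets of sections does not depend on the fibered chart. -/
theorem FiberedChart.sameJet_rep (ψ ψ' : FiberedChart n m π) {γ γ' : X → Y} {x : X}
    (h : IsSectionAt n m π x γ) (h' : IsSectionAt n m π x γ') (hψ : γ x ∈ ψ.tot.source)
    (hψ' : γ x ∈ ψ'.tot.source) (e : γ x = γ' x)
    (hj : SameJet r (ψ.rep γ) (ψ.rep γ') (ψ.base x)) :
    SameJet r (ψ'.rep γ) (ψ'.rep γ') (ψ'.base x) := by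
  -- the representative in `ψ'` is the transition map applied to the representative in `ψ`
  have key : ∀ γ : X → Y, IsSectionAt n m π x γ → γ x ∈ ψ.tot.source → γ x ∈ ψ'.tot.source →
      ψ'.rep γ =ᶠ[𝓝 (ψ'.base x)] fun u => (ψ'.tot (ψ.tot.symm (ψ.base (ψ'.base.symm u),
        ψ.rep γ (ψ.base (ψ'.base.symm u))))).2 := by
    rintro γ ⟨U, hxU, hγ⟩ h1 h2
    have hx := hγ.2.2 x hxU
    have hb1 := ψ.mem_base hx h1
    have hb2 := ψ'.mem_base hx h2
    have o1 := ψ'.base.isOpen_inter_preimage_symm (ψ.base.open_source.inter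
      (hγ.2.1.continuousOn.isOpen_inter_preimage hγ.1 ψ.tot.open_source))
    filter_upwards [o1.mem_nhds ⟨ψ'.base.map_source hb2, by
      simp only [mem_preimage, ψ'.base.left_inv hb2]
      exact ⟨hb1, hxU, h1⟩⟩] with u hu
    have hu' := ψ.base.map_source hu.2.1
    have e1 : γ (ψ.base.symm (ψ.base (ψ'.base.symm u))) = γ (ψ'.base.symm u) := by
      rw [ψ.base.left_inv hu.2.1]
    rw [ψ.symm_rep hu' (by rw [e1, ψ.base.left_inv hu.2.1]; exact hγ.2.2 _ hu.2.2.1)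
      (by rw [e1]; exact hu.2.2.2), e1]
    rfl
  obtain ⟨U, hxU, hγ⟩ := id h
  obtain ⟨U', hxU', hγ'⟩ := id h'
  have hx := hγ.2.2 x hxU
  have hb1 := ψ.mem_base hx hψ
  have hb2 := ψ'.mem_base hx hψ'
  have hγψ' : γ' x ∈ ψ.tot.source := e ▸ hψ
  refine (sameJet_of_eventuallyEq r (key γ h hψ hψ')).trans (SameJet.trans ?_
    (sameJet_of_eventuallyEq r (key γ' h' hγψ' (e ▸ hψ'))).symm)
  have hτ : ContDiffAt ℝ ∞ (fun u => ψ.base (ψ'.base.symm u)) (ψ'.base x) := by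
    have h1 := contMDiffAt_symm_of_mem_maximalAtlas ψ'.base_mem (ψ'.base.map_source hb2)
    have h2 : ContMDiffAt 𝓘(ℝ, Eu n) 𝓘(ℝ, Eu n) ∞ ψ.base (ψ'.base.symm (ψ'.base x)) := by
      rw [ψ'.base.left_inv hb2]
      exact contMDiffAt_of_mem_maximalAtlas ψ.base_mem hb1
    exact (h2.comp _ h1).contDiffAt
  have hτx : ψ.base (ψ'.base.symm (ψ'.base x)) = ψ.base x := by rw [ψ'.base.left_inv hb2]
  have hrep : ∀ γ : X → Y, ∀ U, IsSectionOn n m π γ U → x ∈ U → γ x ∈ ψ.tot.source →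
      ContDiffAt ℝ ∞ (ψ.rep γ) (ψ.base (ψ'.base.symm (ψ'.base x))) := fun γ U hγ hxU h => by
    rw [hτx]
    exact (ψ.contDiffOn_rep hγ).contDiffAt ((ψ.isOpen_repSet hγ).mem_nhds
      (ψ.mem_repSet hγ hxU h))
  have r1 := hrep γ U hγ hxU hψ
  have r2 := hrep γ' U' hγ' hxU' hγψ'
  have j1 : SameJet r (fun u => ψ.rep γ (ψ.base (ψ'.base.symm u)))
      (fun u => ψ.rep γ' (ψ.base (ψ'.base.symm u))) (ψ'.base x) :=
    (SameJet.refl r (fun u => ψ.base (ψ'.base.symm u)) _).comp (by rwa [hτx]) r1 r2 hτ hτ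
  have r1' : ContDiffAt ℝ ∞ (fun u => ψ.rep γ (ψ.base (ψ'.base.symm u))) (ψ'.base x) :=
    ContDiffAt.comp (f := fun u => ψ.base (ψ'.base.symm u)) _ r1 hτ
  have r2' : ContDiffAt ℝ ∞ (fun u => ψ.rep γ' (ψ.base (ψ'.base.symm u))) (ψ'.base x) :=
    ContDiffAt.comp (f := fun u => ψ.base (ψ'.base.symm u)) _ r2 hτ
  have j2 := (SameJet.refl r (fun u => ψ.base (ψ'.base.symm u)) (ψ'.base x)).prodMk j1 hτ hτ
    r1' r2'
  have hval : (ψ.base (ψ'.base.symm (ψ'.base x)), ψ.rep γ (ψ.base (ψ'.base.symm (ψ'.base x)))) =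
      ψ.tot (γ x) := by rw [hτx, ψ.tot_eq hx hψ]
  have hΦ : ContDiffAt ℝ ∞ (fun z : Eu n × Eu m => (ψ'.tot (ψ.tot.symm z)).2)
      (ψ.base (ψ'.base.symm (ψ'.base x)), ψ.rep γ (ψ.base (ψ'.base.symm (ψ'.base x)))) := by
    rw [hval]
    have h1 := contMDiffAt_symm_of_mem_maximalAtlas ψ.tot_mem (ψ.tot.map_source hψ)
    have h2 : ContMDiffAt 𝓘(ℝ, Eu n × Eu m) 𝓘(ℝ, Eu n × Eu m) ∞ ψ'.tot
        (ψ.tot.symm (ψ.tot (γ x))) := by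
      rw [ψ.tot.left_inv hψ]
      exact contMDiffAt_of_mem_maximalAtlas ψ'.tot_mem hψ'
    exact contDiff_snd.contDiffAt.comp _ (h2.comp _ h1).contDiffAt
  exact j2.comp_left hΦ (hτ.prodMk r1') (hτ.prodMk r2')

theorem jet_congr {x x' : X} {γ γ' : X → Y} (hx : x' = x) (h' : IsSectionAt n m π x' γ')
    (h : IsSectionAt n m π x γ) (hv : γ' x = γ x)
    (H : ∀ ψ : FiberedChart n m π, γ' x ∈ ψ.tot.source →
      SameJet r (ψ.rep γ') (ψ.rep γ) (ψ.base x)) : jet r h' = jet r h := by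
  subst hx
  unfold jet
  congr 1
  exact Quotient.sound ⟨hv, fun ψ hψ k hk => H ψ hψ k hk⟩

theorem FiberedChart.isOpen_jetDomain (ψ : FiberedChart n m π) (r : ℕ) : IsOpen (ψ.jetDomain r) :=
  isOpen_jetDomain' ψ.tot.open_target r

theorem FiberedChart.jetCoord_mem (ψ : FiberedChart n m π) (r : ℕ) {f : Eu n → Eu m} {u : Eu n}
    (h : (u, f u) ∈ ψ.tot.target) : jetCoord r f u ∈ ψ.jetDomain r :=
  (jetCoord_mem_iff r f u).2 h

/-- The local section with the Taylor polynomial of `γ` as its components represents the jet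
of `γ`. -/
theorem FiberedChart.jet_taylorSection (ψ : FiberedChart n m π) {γ : X → Y} {x : X}
    (h : IsSectionAt n m π x γ) (hx : γ x ∈ ψ.tot.source)
    (hp : jetCoord r (ψ.rep γ) (ψ.base x) ∈ ψ.jetDomain r) :
    jet r (ψ.isSectionAt_taylorSection hp) = jet r h := by
  obtain ⟨U, hxU, hγ⟩ := id h
  have hπx := hγ.2.2 x hxU
  have hb := ψ.mem_base hπx hx
  set p := jetCoord r (ψ.rep γ) (ψ.base x) with hpdef
  have hp1 : ψ.base.symm p.1 = x := ψ.base.left_inv hb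
  have hval : ψ.taylorSection p x = γ x := by
    unfold FiberedChart.taylorSection
    have : taylorPoly p (ψ.base x) = ψ.rep γ (ψ.base x) := by
      rw [show ψ.base x = p.1 from rfl, taylorPoly_self, hpdef, jetCoord_empty]
      rfl
    rw [this, ← ψ.tot_eq hπx hx, ψ.tot.left_inv hx]
  have hts : IsSectionAt n m π x (ψ.taylorSection p) := by
    have := ψ.isSectionAt_taylorSection hp
    rwa [hp1] at this
  refine jet_congr hp1 _ h hval fun ψ' hψ' => ?_
  refine ψ.sameJet_rep ψ' hts h (hval ▸ hx) hψ' hval ?_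
  have h1 : SameJet r (taylorPoly p) (ψ.rep γ) (ψ.base x) :=
    sameJet_taylorPoly (ψ.isOpen_repSet hγ) (ψ.contDiffOn_rep hγ) (ψ.mem_repSet hγ hxU hx)
  refine (sameJet_of_eventuallyEq r ?_).trans h1
  have hcont : Continuous fun u => (u, taylorPoly p u) :=
    continuous_id.prodMk (contDiff_taylorPoly p).continuous
  have hmem : (ψ.base x, taylorPoly p (ψ.base x)) ∈ ψ.tot.target := by
    rw [show ψ.base x = p.1 from rfl, taylorPoly_self]
    exact hp
  filter_upwards [(ψ.tot.open_target.preimage hcont).mem_nhds hmem,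
    ψ.base.open_target.mem_nhds (ψ.base.map_source hb)] with u hu hu'
  simp only [FiberedChart.rep, FiberedChart.taylorSection]
  rw [ψ.base.right_inv hu', ψ.tot.right_inv hu]

theorem Lagrangian.pullback_of_isSectionAt (l : Lagrangian n m π r) {γ : X → Y} {x : X}
    (h : IsSectionAt n m π x γ) : l.pullback γ x = l.toFun (jet r h) := dif_pos h

theorem Lagrangian.pullback_of_not_isSectionAt (l : Lagrangian n m π r) {γ : X → Y} {x : X}
    (h : ¬ IsSectionAt n m π x γ) : l.pullback γ x = 0 := dif_neg h

/-- The coordinate expression of `(j^r γ)^* λ`. -/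
theorem coeff_pullback (l : Lagrangian n m π r) (ψ : FiberedChart n m π) {γ : X → Y} {x : X}
    (h : IsSectionAt n m π x γ) (hx : γ x ∈ ψ.tot.source) :
    coeff ψ.base (l.pullback γ x) =
      localDensity l.toFun ψ (jetCoord r (ψ.rep γ) (ψ.base x)) := by
  obtain ⟨U, hxU, hγ⟩ := id h
  have hp : jetCoord r (ψ.rep γ) (ψ.base x) ∈ ψ.jetDomain r := by
    refine ψ.jetCoord_mem r ?_
    rw [← ψ.tot_eq (hγ.2.2 x hxU) hx]
    exact ψ.tot.map_source hx
  have key : ∀ θ θ' : Jet n m π r, θ = θ' →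
      coeff ψ.base (l.toFun θ) = coeff ψ.base (l.toFun θ') := by
    rintro θ _ rfl; rfl
  rw [localDensity, dif_pos hp, l.pullback_of_isSectionAt h]
  exact key _ _ (ψ.jet_taylorSection h hx hp).symm

theorem Lagrangian.pullback_congr (l : Lagrangian n m π r) {γ γ' : X → Y} {x : X}
    (h : γ =ᶠ[𝓝 x] γ') : l.pullback γ x = l.pullback γ' x := by
  have aux : ∀ {γ γ' : X → Y}, γ =ᶠ[𝓝 x] γ' → IsSectionAt n m π x γ →
      IsSectionAt n m π x γ' := by
    rintro γ γ' h ⟨U, hxU, hU, hs, hp⟩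
    obtain ⟨V, hV, hVo, hxV⟩ := eventually_nhds_iff.1 h
    refine ⟨U ∩ V, ⟨hxU, hxV⟩, hU.inter hVo, (hs.mono inter_subset_left).congr fun z hz => ?_,
      fun z hz => ?_⟩
    · exact (hV z hz.2).symm
    · rw [← hV z hz.2]; exact hp z hz.1
  by_cases hγ : IsSectionAt n m π x γ
  · have hγ' := aux h hγ
    rw [l.pullback_of_isSectionAt hγ, l.pullback_of_isSectionAt hγ']
    have key : jet r hγ = jet r hγ' := by
      refine jet_congr rfl hγ hγ' h.self_of_nhds fun ψ hψ => sameJet_of_eventuallyEq r ?_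
      have hb : x ∈ ψ.base.source := by
        obtain ⟨U, hxU, hU⟩ := hγ
        exact ψ.mem_base (hU.2.2 x hxU) hψ
      have hc : Tendsto ψ.base.symm (𝓝 (ψ.base x)) (𝓝 x) := ψ.base.tendsto_symm hb
      filter_upwards [hc.eventually h] with u hu
      simp only [FiberedChart.rep, hu]
    have key' : ∀ (q q' : Quotient (jetSetoid n m π r x)),
        (⟨x, q⟩ : Jet n m π r) = ⟨x, q'⟩ → l.toFun ⟨x, q⟩ = l.toFun ⟨x, q'⟩ := by
      rintro q q' h
      obtain rfl := eq_of_heq (Sigma.mk.inj h).2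
      rfl
    exact key' _ _ key
  · have hγ' : ¬ IsSectionAt n m π x γ' := fun h' => hγ (aux h.symm h')
    rw [l.pullback_of_not_isSectionAt hγ, l.pullback_of_not_isSectionAt hγ']

end Fibered


/-! ### Integration of top-degree forms -/

section Forms

variable {n : ℕ} {X : Type*} [TopologicalSpace X] [ChartedSpace (Eu n) X]

theorem coordVec_change [IsManifold 𝓘(ℝ, Eu n) ∞ X] {φ φ' : OpenPartialHomeomorph X (Eu n)}
    (hφ : φ ∈ IsManifold.maximalAtlas 𝓘(ℝ, Eu n) ∞ X)
    (hφ' : φ' ∈ IsManifold.maximalAtlas 𝓘(ℝ, Eu n) ∞ X) {x : X} (hx : x ∈ φ.source)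
    (hx' : x ∈ φ'.source) (i : Fin n) :
    coordVec φ x i = mfderiv 𝓘(ℝ, Eu n) 𝓘(ℝ, Eu n) φ'.symm (φ' x)
      (fderiv ℝ (φ' ∘ φ.symm) (φ x) (EuclideanSpace.single i (1 : ℝ))) := by
  have e : φ.symm =ᶠ[𝓝 (φ x)] φ'.symm ∘ (φ' ∘ φ.symm) := by
    have ho := φ.symm.isOpen_inter_preimage φ'.open_source
    filter_upwards [ho.mem_nhds ⟨φ.map_source hx, by
      simpa only [mem_preimage, φ.left_inv hx] using hx'⟩] with u hu
    exact (φ'.left_inv hu.2).symm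
  have h1 : MDifferentiableAt 𝓘(ℝ, Eu n) 𝓘(ℝ, Eu n) (φ' ∘ φ.symm) (φ x) := by
    have a1 := (contMDiffAt_symm_of_mem_maximalAtlas hφ (φ.map_source hx)).mdifferentiableAt
      (by simp)
    have a2 : MDifferentiableAt 𝓘(ℝ, Eu n) 𝓘(ℝ, Eu n) φ' (φ.symm (φ x)) := by
      rw [φ.left_inv hx]
      exact (contMDiffAt_of_mem_maximalAtlas hφ' hx').mdifferentiableAt (by simp)
    exact a2.comp _ a1
  have hv : (φ' ∘ φ.symm) (φ x) = φ' x := by simp [φ.left_inv hx]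
  have h2 : MDifferentiableAt 𝓘(ℝ, Eu n) 𝓘(ℝ, Eu n) φ'.symm ((φ' ∘ φ.symm) (φ x)) := by
    rw [hv]
    exact (contMDiffAt_symm_of_mem_maximalAtlas hφ' (φ'.map_source hx')).mdifferentiableAt
      (by simp)
  unfold coordVec
  rw [e.mfderiv_eq, mfderiv_comp _ h2 h1, hv, ← mfderiv_eq_fderiv]
  rfl

/-- The pull-back of a form to the model space by the inverse of a chart. -/
def chartPull (φ : OpenPartialHomeomorph X (Eu n)) {x : X} (α : TopForm n x) :
    (Eu n) [⋀^Fin n]→ₗ[ℝ] ℝ :=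
  AlternatingMap.compLinearMap (M := Eu n) α.toAlternatingMap
    (mfderiv 𝓘(ℝ, Eu n) 𝓘(ℝ, Eu n) φ.symm (φ x)).toLinearMap

theorem chartPull_apply (φ : OpenPartialHomeomorph X (Eu n)) {x : X} (α : TopForm n x)
    (v : Fin n → Eu n) :
    chartPull φ α v = α (fun i => mfderiv 𝓘(ℝ, Eu n) 𝓘(ℝ, Eu n) φ.symm (φ x) (v i)) := rfl

theorem coeff_eq_chartPull (φ : OpenPartialHomeomorph X (Eu n)) {x : X} (α : TopForm n x) :
    coeff φ α = chartPull φ α (EuclideanSpace.basisFun (Fin n) ℝ).toBasis := by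
  rw [chartPull_apply, coeff]
  refine congrArg α (funext fun i => ?_)
  simp only [coordVec, OrthonormalBasis.coe_toBasis, EuclideanSpace.basisFun_apply]
  rfl

theorem coeff_change [IsManifold 𝓘(ℝ, Eu n) ∞ X] {φ φ' : OpenPartialHomeomorph X (Eu n)}
    (hφ : φ ∈ IsManifold.maximalAtlas 𝓘(ℝ, Eu n) ∞ X)
    (hφ' : φ' ∈ IsManifold.maximalAtlas 𝓘(ℝ, Eu n) ∞ X) {x : X} (hx : x ∈ φ.source)
    (hx' : x ∈ φ'.source) (α : TopForm n x) :
    coeff φ α = (fderiv ℝ (φ' ∘ φ.symm) (φ x)).det * coeff φ' α := by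
  set b := (EuclideanSpace.basisFun (Fin n) ℝ).toBasis with hb
  have h1 : coeff φ α = chartPull φ' α ((fderiv ℝ (φ' ∘ φ.symm) (φ x)).toLinearMap ∘ b) := by
    rw [chartPull_apply, coeff]
    refine congrArg α (funext fun i => ?_)
    rw [coordVec_change hφ hφ' hx hx']
    simp only [hb, Function.comp_apply, OrthonormalBasis.coe_toBasis,
      EuclideanSpace.basisFun_apply]
    rfl
  have h2 := congrArg (fun A => A ((fderiv ℝ (φ' ∘ φ.symm) (φ x)).toLinearMap ∘ b))
    ((chartPull φ' α).eq_smul_basis_det b)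
  simp only [AlternatingMap.smul_apply, b.det_comp, b.det_self, smul_eq_mul, mul_one] at h2
  rw [h1, h2, coeff_eq_chartPull φ', mul_comm]

theorem mdifferentiable_of_mem_maximalAtlas [IsManifold 𝓘(ℝ, Eu n) ∞ X]
    {φ : OpenPartialHomeomorph X (Eu n)} (hφ : φ ∈ IsManifold.maximalAtlas 𝓘(ℝ, Eu n) ∞ X) :
    φ.MDifferentiable 𝓘(ℝ, Eu n) 𝓘(ℝ, Eu n) :=
  ⟨(contMDiffOn_of_mem_maximalAtlas hφ).mdifferentiableOn (by simp),
    (contMDiffOn_symm_of_mem_maximalAtlas hφ).mdifferentiableOn (by simp)⟩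

theorem coeff_ne_zero [IsManifold 𝓘(ℝ, Eu n) ∞ X] {φ : OpenPartialHomeomorph X (Eu n)}
    (hφ : φ ∈ IsManifold.maximalAtlas 𝓘(ℝ, Eu n) ∞ X) {x : X} (hx : x ∈ φ.source)
    {α : TopForm n x} (hα : α ≠ 0) : coeff φ α ≠ 0 := by
  rw [coeff_eq_chartPull]
  intro h
  rw [AlternatingMap.map_basis_eq_zero_iff] at h
  apply hα
  ext v
  have h1 := DFunLike.congr_fun h (fun i => mfderiv 𝓘(ℝ, Eu n) 𝓘(ℝ, Eu n) φ x (v i))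
  have h2 := (mdifferentiable_of_mem_maximalAtlas hφ).symm_comp_deriv hx
  have h3 : ∀ w, mfderiv 𝓘(ℝ, Eu n) 𝓘(ℝ, Eu n) φ.symm (φ x)
      (mfderiv 𝓘(ℝ, Eu n) 𝓘(ℝ, Eu n) φ x w) = w := fun w => DFunLike.congr_fun h2 w
  replace h1 := (chartPull_apply φ α _).symm.trans h1
  have h4 : (fun i => mfderiv 𝓘(ℝ, Eu n) 𝓘(ℝ, Eu n) φ.symm (φ x)
      (mfderiv 𝓘(ℝ, Eu n) 𝓘(ℝ, Eu n) φ x (v i))) = v := funext fun i => h3 (v i)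
  rw [h4] at h1
  exact h1

/-- The coefficient of a form in a chart, with the sign that compares the orientation of the chart
with `o`. -/
def sgnCoeff (φ : OpenPartialHomeomorph X (Eu n)) (o α : ∀ x : X, TopForm n x) (x : X) : ℝ :=
  Real.sign (coeff φ (o x)) * coeff φ (α x)

theorem coeff_zero (φ : OpenPartialHomeomorph X (Eu n)) (x : X) :
    coeff φ (0 : TopForm n x) = 0 := rfl

theorem sgnCoeff_of_eq_zero (φ : OpenPartialHomeomorph X (Eu n)) (o : ∀ x : X, TopForm n x)
    {α : ∀ x : X, TopForm n x} {x : X} (h : α x = 0) : sgnCoeff φ o α x = 0 := by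
  rw [sgnCoeff, h, coeff_zero, mul_zero]

theorem sign_mul_mul (d a b : ℝ) : Real.sign (d * a) * (d * b) = |d| * (Real.sign a * b) := by
  rcases lt_trichotomy d 0 with hd | rfl | hd
  · rcases lt_trichotomy a 0 with ha | rfl | ha
    · rw [Real.sign_of_pos (mul_pos_of_neg_of_neg hd ha), Real.sign_of_neg ha, abs_of_neg hd]; ring
    · simp
    · rw [Real.sign_of_neg (mul_neg_of_neg_of_pos hd ha), Real.sign_of_pos ha, abs_of_neg hd]; ring
  · simp
  · rcases lt_trichotomy a 0 with ha | rfl | ha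
    · rw [Real.sign_of_neg (mul_neg_of_pos_of_neg hd ha), Real.sign_of_neg ha, abs_of_pos hd]; ring
    · simp
    · rw [Real.sign_of_pos (mul_pos hd ha), Real.sign_of_pos ha, abs_of_pos hd]; ring

theorem sgnCoeff_change [IsManifold 𝓘(ℝ, Eu n) ∞ X] {φ φ' : OpenPartialHomeomorph X (Eu n)}
    (hφ : φ ∈ IsManifold.maximalAtlas 𝓘(ℝ, Eu n) ∞ X)
    (hφ' : φ' ∈ IsManifold.maximalAtlas 𝓘(ℝ, Eu n) ∞ X) {x : X} (hx : x ∈ φ.source)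
    (hx' : x ∈ φ'.source) (o α : ∀ x : X, TopForm n x) :
    sgnCoeff φ o α x = |(fderiv ℝ (φ' ∘ φ.symm) (φ x)).det| * sgnCoeff φ' o α x := by
  unfold sgnCoeff
  rw [coeff_change hφ hφ' hx hx', coeff_change hφ hφ' hx hx', sign_mul_mul]

/-- The part of `D` in the domain of a chart, in coordinates. -/
def chartSet (φ : OpenPartialHomeomorph X (Eu n)) (D : Set X) : Set (Eu n) :=
  φ.target ∩ φ.symm ⁻¹' D

theorem measurableSet_chartSet {X : Type*} [TopologicalSpace X]
    (φ : OpenPartialHomeomorph X (Eu n)) {D : Set X} (hD : IsClosed D) :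
    MeasurableSet (chartSet φ D) := by
  have : chartSet φ D = φ.target \ (φ.target ∩ φ.symm ⁻¹' Dᶜ) := by
    ext u; simp [chartSet]
  rw [this]
  exact φ.open_target.measurableSet.diff
    (φ.symm.isOpen_inter_preimage hD.isOpen_compl).measurableSet

/-- Change of variables between two charts. -/
theorem integral_chartSet_change [IsManifold 𝓘(ℝ, Eu n) ∞ X]
    {φ φ' : OpenPartialHomeomorph X (Eu n)}
    (hφ : φ ∈ IsManifold.maximalAtlas 𝓘(ℝ, Eu n) ∞ X)
    (hφ' : φ' ∈ IsManifold.maximalAtlas 𝓘(ℝ, Eu n) ∞ X) {D : Set X} (hD : IsClosed D)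
    (o α : ∀ x : X, TopForm n x) (h : X → ℝ)
    (hs : ∀ x ∈ D, h x ≠ 0 → α x ≠ 0 → x ∈ φ.source ∧ x ∈ φ'.source) :
    ∫ u in chartSet φ D, h (φ.symm u) * sgnCoeff φ o α (φ.symm u) =
      ∫ u in chartSet φ' D, h (φ'.symm u) * sgnCoeff φ' o α (φ'.symm u) := by
  -- Outside the overlap of the charts both integrands vanish.
  set S : Set (Eu n) := chartSet φ D ∩ (φ.target ∩ φ.symm ⁻¹' φ'.source) with hS
  have hSo : IsOpen (φ.target ∩ φ.symm ⁻¹' φ'.source) :=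
    φ.symm.isOpen_inter_preimage φ'.open_source
  have hSm : MeasurableSet S := (measurableSet_chartSet φ hD).inter hSo.measurableSet
  have himg : (φ' ∘ φ.symm) '' S ⊆ chartSet φ' D := by
    rintro _ ⟨u, hu, rfl⟩
    refine ⟨φ'.map_source hu.2.2, ?_⟩
    simp only [mem_preimage, Function.comp_apply, φ'.left_inv hu.2.2]
    exact hu.1.2
  have hinj : InjOn (φ' ∘ φ.symm) S := by
    intro u hu v hv huv
    exact φ.symm.injOn hu.1.1 hv.1.1 (φ'.injOn hu.2.2 hv.2.2 huv)
  have hder : ∀ u ∈ S, HasFDerivWithinAt (φ' ∘ φ.symm) (fderiv ℝ (φ' ∘ φ.symm) u) S u := by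
    intro u hu
    have h1 := (contMDiffAt_symm_of_mem_maximalAtlas hφ hu.1.1)
    have h2 := contMDiffAt_of_mem_maximalAtlas hφ' hu.2.2
    exact (((h2.comp u h1).contDiffAt).differentiableAt (by simp)).hasFDerivAt.hasFDerivWithinAt
  have e1 : ∫ u in chartSet φ D, h (φ.symm u) * sgnCoeff φ o α (φ.symm u) =
      ∫ u in S, h (φ.symm u) * sgnCoeff φ o α (φ.symm u) := by
    refine setIntegral_eq_of_subset_of_forall_sdiff_eq_zero (measurableSet_chartSet φ hD)
      inter_subset_left fun u hu => ?_
    by_contra hne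
    have h1 : h (φ.symm u) ≠ 0 := left_ne_zero_of_mul hne
    have h2 : α (φ.symm u) ≠ 0 := fun h0 =>
      right_ne_zero_of_mul hne (sgnCoeff_of_eq_zero φ o h0)
    exact hu.2 ⟨hu.1, hu.1.1, (hs _ hu.1.2 h1 h2).2⟩
  have e2 : ∫ u in chartSet φ' D, h (φ'.symm u) * sgnCoeff φ' o α (φ'.symm u) =
      ∫ u in (φ' ∘ φ.symm) '' S, h (φ'.symm u) * sgnCoeff φ' o α (φ'.symm u) := by
    refine setIntegral_eq_of_subset_of_forall_sdiff_eq_zero (measurableSet_chartSet φ' hD)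
      himg fun u hu => ?_
    by_contra hne
    have h1 : h (φ'.symm u) ≠ 0 := left_ne_zero_of_mul hne
    have h2 : α (φ'.symm u) ≠ 0 := fun h0 =>
      right_ne_zero_of_mul hne (sgnCoeff_of_eq_zero φ' o h0)
    have h3 := (hs _ hu.1.2 h1 h2).1
    have h4 : φ.symm (φ (φ'.symm u)) = φ'.symm u := φ.left_inv h3
    have h5 := φ'.map_target hu.1.1
    refine hu.2 ⟨φ (φ'.symm u), ⟨⟨φ.map_source h3, ?_⟩, φ.map_source h3, ?_⟩, ?_⟩
    · simpa only [mem_preimage, h4] using hu.1.2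
    · simpa only [mem_preimage, h4] using h5
    · simp only [Function.comp_apply, h4, φ'.right_inv hu.1.1]
  rw [e1, e2, integral_image_eq_integral_abs_det_fderiv_smul volume hSm hder hinj]
  refine setIntegral_congr_fun hSm fun u hu => ?_
  have h4 : φ'.symm (φ' (φ.symm u)) = φ.symm u := φ'.left_inv hu.2.2
  simp only [Function.comp_apply, h4, smul_eq_mul]
  rw [sgnCoeff_change hφ hφ' (φ.map_target hu.1.1) hu.2.2, φ.right_inv hu.1.1]
  simp only [Function.comp_def]
  ring

/-- A form whose coefficients in all charts are continuous on `D`. -/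
def ContinuousForm (D : Set X) (α : ∀ x : X, TopForm n x) : Prop :=
  ∀ φ ∈ IsManifold.maximalAtlas 𝓘(ℝ, Eu n) ∞ X,
    ContinuousOn (fun x => coeff φ (α x)) (φ.source ∩ D)

theorem continuousForm_of_exists_chart [IsManifold 𝓘(ℝ, Eu n) ∞ X] {D : Set X}
    {α : ∀ x : X, TopForm n x}
    (h : ∀ x ∈ D, ∃ φ ∈ IsManifold.maximalAtlas 𝓘(ℝ, Eu n) ∞ X, x ∈ φ.source ∧
      ContinuousWithinAt (fun x => coeff φ (α x)) D x) : ContinuousForm D α := by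
  intro φ hφ x hx
  obtain ⟨φ', hφ', hx', hc⟩ := h x hx.2
  have h1 : ContinuousAt (fun z => (fderiv ℝ (φ' ∘ φ.symm) (φ z)).det) x := by
    have a1 : ContDiffAt ℝ ∞ (φ' ∘ φ.symm) (φ x) := by
      have b1 := contMDiffAt_symm_of_mem_maximalAtlas hφ (φ.map_source hx.1)
      have b2 : ContMDiffAt 𝓘(ℝ, Eu n) 𝓘(ℝ, Eu n) ∞ φ' (φ.symm (φ x)) := by
        rw [φ.left_inv hx.1]
        exact contMDiffAt_of_mem_maximalAtlas hφ' hx'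
      exact (b2.comp _ b1).contDiffAt
    have a2 : ContinuousAt (fderiv ℝ (φ' ∘ φ.symm)) (φ x) :=
      (a1.fderiv_right (m := 1) (by norm_cast)).continuousAt
    exact ContinuousLinearMap.continuous_det.continuousAt.comp
      (a2.comp (φ.continuousAt hx.1))
  have h2 : ContinuousWithinAt (fun x => coeff φ' (α x)) (φ.source ∩ D) x :=
    hc.mono inter_subset_right
  refine (h1.continuousWithinAt.mul h2).congr_of_eventuallyEq ?_
    (coeff_change hφ hφ' hx.1 hx' (α x))
  filter_upwards [self_mem_nhdsWithin, mem_nhdsWithin_of_mem_nhds (φ'.open_source.mem_nhds hx')]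
    with z hz hz'
  exact coeff_change hφ hφ' hz.1 hz' (α z)

theorem ContinuousForm.smul {D : Set X} {α : ∀ x : X, TopForm n x} (hα : ContinuousForm D α)
    {χ : X → ℝ} (hχ : Continuous χ) : ContinuousForm D (fun x => χ x • α x) :=
  fun φ hφ => hχ.continuousOn.mul (hα φ hφ)

theorem ContinuousForm.sub {D : Set X} {α β : ∀ x : X, TopForm n x} (hα : ContinuousForm D α)
    (hβ : ContinuousForm D β) : ContinuousForm D (fun x => α x - β x) :=
  fun φ hφ => (hα φ hφ).sub (hβ φ hφ)

theorem sign_eq_div_abs (a : ℝ) : Real.sign a = a / |a| := by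
  rcases lt_trichotomy a 0 with h | rfl | h
  · rw [Real.sign_of_neg h, abs_of_neg h, div_neg, div_self h.ne]
  · simp
  · rw [Real.sign_of_pos h, abs_of_pos h, div_self h.ne']

theorem continuousOn_sign_coeff [IsManifold 𝓘(ℝ, Eu n) ∞ X] {D : Set X}
    {o : ∀ x : X, TopForm n x} (ho : IsOrientation D o) {φ : OpenPartialHomeomorph X (Eu n)}
    (hφ : φ ∈ IsManifold.maximalAtlas 𝓘(ℝ, Eu n) ∞ X) :
    ContinuousOn (fun x => Real.sign (coeff φ (o x))) (φ.source ∩ D) := by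
  simp only [sign_eq_div_abs]
  exact (ho.2 φ hφ).div (ho.2 φ hφ).abs fun x hx =>
    abs_ne_zero.2 (coeff_ne_zero hφ hx.1 (ho.1 x hx.2))

theorem continuousOn_sgnCoeff [IsManifold 𝓘(ℝ, Eu n) ∞ X] {D : Set X}
    {o α : ∀ x : X, TopForm n x} (ho : IsOrientation D o) (hα : ContinuousForm D α)
    {φ : OpenPartialHomeomorph X (Eu n)} (hφ : φ ∈ IsManifold.maximalAtlas 𝓘(ℝ, Eu n) ∞ X) :
    ContinuousOn (sgnCoeff φ o α) (φ.source ∩ D) :=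
  (continuousOn_sign_coeff ho hφ).mul (hα φ hφ)

theorem continuousOn_comp_symm {X : Type*} [TopologicalSpace X] {D : Set X}
    {φ : OpenPartialHomeomorph X (Eu n)} {g : X → ℝ}
    (hg : ContinuousOn g (φ.source ∩ D)) :
    ContinuousOn (fun u => g (φ.symm u)) (chartSet φ D) :=
  hg.comp (φ.continuousOn_symm.mono inter_subset_left) fun _ hu => ⟨φ.map_target hu.1, hu.2⟩

theorem isCompact_image_chart {X : Type*} [TopologicalSpace X]
    {φ : OpenPartialHomeomorph X (Eu n)} {K : Set X} (hK : IsCompact K)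
    (hs : K ⊆ φ.source) : IsCompact (φ '' K) :=
  hK.image_of_continuousOn (φ.continuousOn.mono hs)

theorem image_chart_subset {X : Type*} [TopologicalSpace X]
    {φ : OpenPartialHomeomorph X (Eu n)} {K D : Set X}
    (hs : K ⊆ φ.source) (hKD : K ⊆ D) : φ '' K ⊆ chartSet φ D := by
  rintro _ ⟨x, hx, rfl⟩
  exact ⟨φ.map_source (hs hx), by simpa only [mem_preimage, φ.left_inv (hs hx)] using hKD hx⟩

theorem integrableOn_chartSet {X : Type*} [TopologicalSpace X]
    {φ : OpenPartialHomeomorph X (Eu n)} {K D : Set X}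
    (hD : IsClosed D) (hK : IsCompact K) (hs : K ⊆ φ.source) (hKD : K ⊆ D) {g : X → ℝ}
    (hg : ContinuousOn g (φ.source ∩ D)) (h0 : ∀ x ∈ D, x ∉ K → g x = 0) :
    IntegrableOn (fun u => g (φ.symm u)) (chartSet φ D) := by
  have h1 : IntegrableOn (fun u => g (φ.symm u)) (φ '' K) :=
    ((continuousOn_comp_symm hg).mono (image_chart_subset hs hKD)).integrableOn_compact
      (isCompact_image_chart hK hs)
  refine h1.of_forall_sdiff_eq_zero (measurableSet_chartSet φ hD) fun u hu => h0 _ hu.1.2 ?_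
  intro hK'
  exact hu.2 ⟨_, hK', φ.right_inv hu.1.1⟩

section Integral

variable [IsManifold 𝓘(ℝ, Eu n) ∞ X] [T2Space X] [SigmaCompactSpace X]

theorem tsupport_chartPartition_subset (c : X) :
    tsupport (chartPartition n X c) ⊆ (chartAt (Eu n) c).source :=
  Classical.choose_spec (SmoothPartitionOfUnity.exists_isSubordinate_chartAt_source 𝓘(ℝ, Eu n) X) c

theorem finite_chartPartition {D : Set X} (hD : IsCompact D) :
    {c : X | (Function.support (chartPartition n X c) ∩ D).Nonempty}.Finite :=
  (chartPartition n X).locallyFinite.finite_nonempty_inter_compact hD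

theorem integralForm_eq_sum (o : ∀ x : X, TopForm n x) {D : Set X} (hD : IsCompact D)
    (α : ∀ x : X, TopForm n x) :
    integralForm o D α = ∑ c ∈ (finite_chartPartition (n := n) hD).toFinset,
      ∫ u in chartSet (chartAt (Eu n) c) D, chartPartition n X c ((chartAt (Eu n) c).symm u) *
        sgnCoeff (chartAt (Eu n) c) o α ((chartAt (Eu n) c).symm u) := by
  change (∑ᶠ c : X, ∫ u in chartSet (chartAt (Eu n) c) D,
    chartPartition n X c ((chartAt (Eu n) c).symm u) *
      sgnCoeff (chartAt (Eu n) c) o α ((chartAt (Eu n) c).symm u)) = _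
  refine finsum_eq_sum_of_support_subset _ fun c hc => ?_
  rw [Finite.coe_toFinset, mem_ofPred_eq]
  by_contra hne
  rw [not_nonempty_iff_eq_empty] at hne
  refine hc (setIntegral_eq_zero_of_forall_eq_zero fun u hu => ?_)
  have : (chartAt (Eu n) c).symm u ∉ Function.support (chartPartition n X c) := fun h => by
    have : (chartAt (Eu n) c).symm u ∈ Function.support (chartPartition n X c) ∩ D := ⟨h, hu.2⟩
    rw [hne] at this
    exact this
  rw [Function.notMem_support.1 this, zero_mul]

theorem integrableOn_chartPartition_mul {o α : ∀ x : X, TopForm n x} {D : Set X}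
    (hD : IsCompact D) (ho : IsOrientation D o) (hα : ContinuousForm D α) (c : X) :
    IntegrableOn (fun u => chartPartition n X c ((chartAt (Eu n) c).symm u) *
      sgnCoeff (chartAt (Eu n) c) o α ((chartAt (Eu n) c).symm u))
      (chartSet (chartAt (Eu n) c) D) := by
  refine integrableOn_chartSet (K := tsupport (chartPartition n X c) ∩ D)
    (g := fun x => chartPartition n X c x * sgnCoeff (chartAt (Eu n) c) o α x) hD.isClosed
    (hD.inter_left (isClosed_tsupport _))
    (inter_subset_left.trans (tsupport_chartPartition_subset c)) inter_subset_right ?_ ?_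
  · exact (chartPartition n X c).contMDiff.continuous.continuousOn.mul
      (continuousOn_sgnCoeff ho hα (IsManifold.chart_mem_maximalAtlas c))
  · intro x hx hxK
    have : x ∉ tsupport (chartPartition n X c) := fun h => hxK ⟨h, hx⟩
    simp only [image_eq_zero_of_notMem_tsupport this, zero_mul]

theorem integralForm_sum {ι : Type*} (s : Finset ι) {o : ∀ x : X, TopForm n x}
    {α : ι → ∀ x : X, TopForm n x} {D : Set X} (hD : IsCompact D) (ho : IsOrientation D o)
    (hα : ∀ j ∈ s, ContinuousForm D (α j)) :
    integralForm o D (fun x => ∑ j ∈ s, α j x) = ∑ j ∈ s, integralForm o D (α j) := by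
  simp only [integralForm_eq_sum o hD]
  rw [Finset.sum_comm]
  refine Finset.sum_congr rfl fun c _ => ?_
  rw [← integral_finsetSum _ fun j hj => integrableOn_chartPartition_mul hD ho (hα j hj) c]
  refine integral_congr_ae (Eventually.of_forall fun u => ?_)
  simp only [sgnCoeff, ← Finset.mul_sum]
  congr 2
  simp [coeff]

theorem integralForm_sub {o α β : ∀ x : X, TopForm n x} {D : Set X} (hD : IsCompact D)
    (ho : IsOrientation D o) (hα : ContinuousForm D α) (hβ : ContinuousForm D β) :
    integralForm o D (fun x => α x - β x) = integralForm o D α - integralForm o D β := by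
  simp only [integralForm_eq_sum o hD, ← Finset.sum_sub_distrib]
  refine Finset.sum_congr rfl fun c _ => ?_
  rw [← integral_sub (integrableOn_chartPartition_mul hD ho hα c)
    (integrableOn_chartPartition_mul hD ho hβ c)]
  refine integral_congr_ae (Eventually.of_forall fun u => ?_)
  simp only [← mul_sub, sgnCoeff]
  rfl

theorem integralForm_congr {o α β : ∀ x : X, TopForm n x} {D : Set X} (hD : IsClosed D)
    (h : ∀ x ∈ D, α x = β x) : integralForm o D α = integralForm o D β := by
  unfold integralForm
  refine finsum_congr fun c => setIntegral_congr_fun (measurableSet_chartSet _ hD) fun u hu => ?_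
  rw [h _ hu.2]

/-- The integral of a form supported in the domain of a single chart. -/
theorem integralForm_eq_integral_chart {o α : ∀ x : X, TopForm n x} {D : Set X}
    (hD : IsCompact D) (ho : IsOrientation D o) (hα : ContinuousForm D α)
    {φ : OpenPartialHomeomorph X (Eu n)} (hφ : φ ∈ IsManifold.maximalAtlas 𝓘(ℝ, Eu n) ∞ X)
    {K : Set X} (hK : IsCompact K) (hs : K ⊆ φ.source) (hKD : K ⊆ D)
    (h0 : ∀ x ∈ D, x ∉ K → α x = 0) :
    integralForm o D α = ∫ u in φ '' K, sgnCoeff φ o α (φ.symm u) := by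
  have hcl := hD.isClosed
  rw [integralForm_eq_sum o hD]
  have h1 : ∀ c : X, ∫ u in chartSet (chartAt (Eu n) c) D,
      chartPartition n X c ((chartAt (Eu n) c).symm u) *
        sgnCoeff (chartAt (Eu n) c) o α ((chartAt (Eu n) c).symm u) =
      ∫ u in chartSet φ D, chartPartition n X c (φ.symm u) * sgnCoeff φ o α (φ.symm u) := by
    intro c
    refine integral_chartSet_change (IsManifold.chart_mem_maximalAtlas c) hφ hcl o α
      (chartPartition n X c) fun x hx hc hαx => ⟨?_, ?_⟩
    · exact tsupport_chartPartition_subset c (subset_tsupport _ hc)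
    · by_contra hxs
      exact hαx (h0 x hx fun hxK => hxs (hs hxK))
  simp only [h1]
  rw [← integral_finsetSum]
  · have h2 : ∀ u ∈ chartSet φ D, (∑ c ∈ (finite_chartPartition (n := n) hD).toFinset,
        chartPartition n X c (φ.symm u) * sgnCoeff φ o α (φ.symm u)) =
        sgnCoeff φ o α (φ.symm u) := by
      intro u hu
      rw [← Finset.sum_mul]
      have hsub : (chartPartition n X).finsupport (φ.symm u) ⊆
          (finite_chartPartition (n := n) hD).toFinset := by
        intro c hc
        rw [Finite.mem_toFinset]
        exact ⟨φ.symm u, (chartPartition n X).mem_finsupport _ |>.1 hc, hu.2⟩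
      rw [(chartPartition n X).sum_finsupport' (φ.symm u) (mem_univ _) hsub, one_mul]
    rw [setIntegral_congr_fun (measurableSet_chartSet φ hcl) h2]
    refine setIntegral_eq_of_subset_of_forall_sdiff_eq_zero (measurableSet_chartSet φ hcl)
      (image_chart_subset hs hKD) fun u hu => sgnCoeff_of_eq_zero φ o (h0 _ hu.1.2 ?_)
    exact fun hK' => hu.2 ⟨_, hK', φ.right_inv hu.1.1⟩
  · intro c _
    refine integrableOn_chartSet (K := K)
      (g := fun x => chartPartition n X c x * sgnCoeff φ o α x) hcl hK hs hKD ?_ ?_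
    · exact (chartPartition n X c).contMDiff.continuous.continuousOn.mul
        (continuousOn_sgnCoeff ho hα hφ)
    · intro x hx hxK
      simp only [sgnCoeff_of_eq_zero φ o (h0 x hx hxK), mul_zero]

end Integral

end Forms


/-! ### Regions and adapted families of charts -/

section Families

variable {n m : ℕ} {X Y : Type*}
  [TopologicalSpace X] [ChartedSpace (Eu n) X]
  [TopologicalSpace Y] [ChartedSpace (Eu n × Eu m) Y]

theorem IsRegion.subset_closure_interior {D : Set X} (hD : IsRegion n D) :
    D ⊆ closure (interior D) := by
  intro x hx
  by_cases hxi : x ∈ interior D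
  · exact subset_closure hxi
  have hfr : x ∈ frontier D := ⟨subset_closure hx, hxi⟩
  obtain ⟨φ, -, i, hxs, hx0, hφ⟩ := hD.2 x hfr
  -- Moving from `x` in the direction of the half space leads into the interior.
  set c : ℝ → X := fun t => φ.symm (φ x + t • EuclideanSpace.single i (1 : ℝ)) with hc
  have hcont : ContinuousAt
      (fun t : ℝ => φ x + t • (EuclideanSpace.single i (1 : ℝ) : Eu n)) 0 := by
    fun_prop
  have h0 : φ x + (0 : ℝ) • (EuclideanSpace.single i (1 : ℝ) : Eu n) = φ x := by simp
  have htar : ∀ᶠ t : ℝ in 𝓝[>] 0,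
      φ x + t • (EuclideanSpace.single i (1 : ℝ) : Eu n) ∈ φ.target :=
    nhdsWithin_le_nhds (hcont.eventually_mem (by
      rw [h0]; exact φ.open_target.mem_nhds (φ.map_source hxs)))
  have hlim : Tendsto c (𝓝[>] 0) (𝓝 x) := by
    have h1 : ContinuousAt φ.symm (φ x + (0 : ℝ) • (EuclideanSpace.single i (1 : ℝ) : Eu n)) := by
      rw [h0]; exact φ.continuousAt_symm (φ.map_source hxs)
    have h2 : ContinuousAt c 0 := ContinuousAt.comp h1 hcont
    have h3 : c 0 = x := by simp [hc, φ.left_inv hxs]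
    have h4 : Tendsto c (𝓝 0) (𝓝 x) := by simpa only [h3] using h2.tendsto
    exact h4.mono_left nhdsWithin_le_nhds
  refine mem_closure_of_tendsto hlim ?_
  have hopen : IsOpen (φ.source ∩ φ ⁻¹' {u | 0 < u i}) :=
    φ.isOpen_inter_preimage (isOpen_lt continuous_const (by fun_prop))
  have hsub : φ.source ∩ φ ⁻¹' {u | 0 < u i} ⊆ interior D :=
    interior_maximal (fun z hz => (hφ z hz.1).2 (le_of_lt hz.2)) hopen
  filter_upwards [htar, self_mem_nhdsWithin] with t ht ht0
  refine hsub ⟨φ.map_target ht, ?_⟩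
  simp only [hc, mem_preimage, φ.right_inv ht, mem_ofPred_eq]
  simpa [hx0] using ht0

/-- Finitely many fibered charts, with a smooth partition of unity on `D`. -/
structure ChartFamily (n m : ℕ) {X Y : Type*}
    [TopologicalSpace X] [ChartedSpace (Eu n) X]
    [TopologicalSpace Y] [ChartedSpace (Eu n × Eu m) Y]
    (π : Y → X) (D : Set X) where
  s : Finset X
  χ : X → X → ℝ
  ψ : X → FiberedChart n m π
  smooth : ∀ c, ContMDiff 𝓘(ℝ, Eu n) 𝓘(ℝ, ℝ) ∞ (χ c)
  abs_le : ∀ c x, |χ c x| ≤ 1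
  sum_eq : ∀ x ∈ D, ∑ c ∈ s, χ c x = 1

/-- The section `γ` maps the support of each function of the partition, within `D`, to the
corresponding fibered chart. -/
def ChartFamily.Adapted {π : Y → X} {D : Set X} (F : ChartFamily n m π D) (γ : X → Y) : Prop :=
  ∀ c ∈ F.s, ∀ x ∈ tsupport (F.χ c) ∩ D, γ x ∈ (F.ψ c).tot.source

theorem isOpen_section_preimage {γ : X → Y} {U : Set X} {π : Y → X} (hγ : IsSectionOn n m π γ U)
    {V : Set Y} (hV : IsOpen V) : IsOpen (U ∩ γ ⁻¹' V) :=
  hγ.2.1.continuousOn.isOpen_inter_preimage hγ.1 hV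

variable [IsManifold 𝓘(ℝ, Eu n) ∞ X] [T2Space X] [SigmaCompactSpace X]

theorem exists_chartFamily_of_cover {π : Y → X} {D : Set X} (hD : IsCompact D) {γ : X → Y}
    (C : X → FiberedChart n m π) (U : X → Set X) (hU : ∀ c, IsOpen (U c))
    (hDU : ∀ x ∈ D, x ∈ U x) (hγ : ∀ c, ∀ x ∈ D, x ∈ U c → γ x ∈ (C c).tot.source) :
    ∃ F : ChartFamily n m π D, F.Adapted γ ∧ F.ψ = C ∧ ∀ c, tsupport (F.χ c) ⊆ U c := by
  obtain ⟨f, hf⟩ := SmoothPartitionOfUnity.exists_isSubordinate 𝓘(ℝ, Eu n) hD.isClosed U hU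
    (fun x hx => mem_iUnion.2 ⟨x, hDU x hx⟩)
  have hfin : {c : X | (Function.support (f c) ∩ D).Nonempty}.Finite :=
    f.locallyFinite.finite_nonempty_inter_compact hD
  refine ⟨⟨hfin.toFinset, fun c x => f c x, C, fun c => (f c).contMDiff, fun c x => ?_,
    fun x hx => ?_⟩, fun c _ x hx => hγ c x hx.2 (hf c hx.1), rfl, hf⟩
  · rw [abs_of_nonneg (f.nonneg c x)]
    exact f.le_one c x
  · have hsub : f.finsupport x ⊆ hfin.toFinset := by
      intro c hc
      rw [Finite.mem_toFinset]
      exact ⟨x, (f.mem_finsupport _).1 hc, hx⟩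
    exact f.sum_finsupport' x hx hsub

variable [IsManifold 𝓘(ℝ, Eu n × Eu m) ∞ Y]

theorem exists_chartFamily {π : Y → X} (hπ : IsFibered n m π) {D : Set X} (hD : IsCompact D)
    {γ : X → Y} {U : Set X} (hγ : IsSectionOn n m π γ U) (hDU : D ⊆ U) :
    ∃ F : ChartFamily n m π D, F.Adapted γ := by
  choose C hC using fun y : Y => exists_fiberedChart hπ y
  obtain ⟨F, hF, -⟩ := exists_chartFamily_of_cover hD (γ := γ) (fun x => C (γ x))
    (fun x => U ∩ γ ⁻¹' (C (γ x)).tot.source)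
    (fun c => isOpen_section_preimage hγ (C (γ c)).tot.open_source)
    (fun x hx => ⟨hDU hx, hC _⟩) (fun c x _ hx => hx.2)
  exact ⟨F, hF⟩

/-- An adapted family in which a prescribed chart is the only one that counts near a given point. -/
theorem exists_chartFamily_at {π : Y → X} (hπ : IsFibered n m π) {D : Set X} (hD : IsCompact D)
    {γ : X → Y} {U : Set X} (hγ : IsSectionOn n m π γ U) (hDU : D ⊆ U)
    (ψ : FiberedChart n m π) {x₀ : X} (hx₀ : x₀ ∈ D) (hψ : γ x₀ ∈ ψ.tot.source) :
    ∃ F : ChartFamily n m π D, F.Adapted γ ∧ F.ψ x₀ = ψ ∧ x₀ ∈ F.s ∧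
      ∃ N : Set X, IsOpen N ∧ x₀ ∈ N ∧ (∀ x ∈ N, x ∈ D → F.χ x₀ x = 1) ∧
        ∀ c ∈ F.s, c ≠ x₀ → ∀ x ∈ N, F.χ c x = 0 := by
  classical
  choose C hC using fun y : Y => exists_fiberedChart hπ y
  -- All the other domains of the cover avoid `x₀`.
  have hV : ∃ V : X → Set X, ∃ C' : X → FiberedChart n m π, C' x₀ = ψ ∧ (∀ c, IsOpen (V c)) ∧
      (∀ x ∈ D, x ∈ V x) ∧ (∀ c, ∀ x ∈ D, x ∈ V c → γ x ∈ (C' c).tot.source) ∧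
      ∀ c, c ≠ x₀ → x₀ ∉ V c := by
    refine ⟨fun c => (U ∩ γ ⁻¹' (if c = x₀ then ψ else C (γ c)).tot.source) ∩
      {x | c ≠ x₀ → x ≠ x₀}, fun c => if c = x₀ then ψ else C (γ c), if_pos rfl, fun c => ?_,
      fun x hx => ⟨⟨hDU hx, ?_⟩, fun h => h⟩, fun c x _ hx => hx.1.2, fun c hc hx => hx.2 hc rfl⟩
    · refine (isOpen_section_preimage hγ (OpenPartialHomeomorph.open_source _)).inter ?_
      by_cases hc : c = x₀
      · simp [hc]
      · have : {x : X | c ≠ x₀ → x ≠ x₀} = {x₀}ᶜ := by ext; simp [hc]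
        rw [this]
        exact isOpen_compl_singleton
    · by_cases hx' : x = x₀
      · subst hx'; simpa using hψ
      · simpa [hx'] using hC (γ x)
  obtain ⟨V, C', hC'x, hVo, hVD, hVγ, hVx⟩ := hV
  obtain ⟨F, hFA, hF, hFs⟩ := exists_chartFamily_of_cover hD (γ := γ) C' V hVo hVD hVγ
  set N : Set X := ⋂ c ∈ F.s.erase x₀, (tsupport (F.χ c))ᶜ with hN
  have hNo : IsOpen N :=
    isOpen_biInter_finset fun c _ => (isClosed_tsupport (F.χ c)).isOpen_compl
  have hNz : ∀ c ∈ F.s, c ≠ x₀ → ∀ x ∈ N, F.χ c x = 0 := by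
    intro c hc hcx x hx
    rw [hN, mem_iInter₂] at hx
    exact image_eq_zero_of_notMem_tsupport (hx c (Finset.mem_erase.2 ⟨hcx, hc⟩))
  have hx₀N : x₀ ∈ N := by
    rw [hN, mem_iInter₂]
    intro c hc h
    exact hVx c (Finset.mem_erase.1 hc).1 (hFs c h)
  have hmem : x₀ ∈ F.s := by
    by_contra hx
    have h1 := F.sum_eq x₀ hx₀
    rw [Finset.sum_eq_zero fun c hc => hNz c hc (fun h => hx (h ▸ hc)) x₀ hx₀N] at h1
    exact zero_ne_one h1
  refine ⟨F, hFA, by rw [hF, hC'x], hmem, N, hNo, hx₀N, fun x hxN hxD => ?_, hNz⟩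
  rw [← F.sum_eq x hxD, Finset.sum_eq_single_of_mem x₀ hmem fun c hc hcx => hNz c hc hcx x hxN]

end Families

/-! ### Cut-off functions -/

section Cutoff

variable {n : ℕ} {X : Type*} [TopologicalSpace X] [ChartedSpace (Eu n) X]
  {G : Type*} [NormedAddCommGroup G] [NormedSpace ℝ G]

/-- The product of `a`, `χ` and `w` on the part of `D` in the support of `χ`, in a chart, extended
by zero. -/
def cutoff (φ : OpenPartialHomeomorph X (Eu n)) (χ : X → ℝ) (D : Set X) (a : X → ℝ)
    (w : Eu n → G) : Eu n → G :=
  indicator (φ '' (tsupport χ ∩ D)) fun u => (a (φ.symm u) * χ (φ.symm u)) • w u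

theorem cutoff_apply {X : Type*} [TopologicalSpace X] {φ : OpenPartialHomeomorph X (Eu n)}
    {χ : X → ℝ} {D : Set X} {a : X → ℝ} {w : Eu n → G} {u : Eu n}
    (hu : u ∈ φ '' (tsupport χ ∩ D)) :
    cutoff φ χ D a w u = (a (φ.symm u) * χ (φ.symm u)) • w u := indicator_of_mem hu _

theorem tsupport_cutoff_subset {X : Type*} [TopologicalSpace X]
    {φ : OpenPartialHomeomorph X (Eu n)} {χ : X → ℝ} {D : Set X} (hD : IsCompact D)
    (hs : tsupport χ ∩ D ⊆ φ.source) (a : X → ℝ) (w : Eu n → G) :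
    tsupport (cutoff φ χ D a w) ⊆ φ '' (tsupport χ ∩ D) :=
  closure_minimal support_indicator_subset
    (isCompact_image_chart (hD.inter_left (isClosed_tsupport χ)) hs).isClosed

theorem hasCompactSupport_cutoff {X : Type*} [TopologicalSpace X]
    {φ : OpenPartialHomeomorph X (Eu n)} {χ : X → ℝ} {D : Set X} (hD : IsCompact D)
    (hs : tsupport χ ∩ D ⊆ φ.source) (a : X → ℝ) (w : Eu n → G) :
    HasCompactSupport (cutoff φ χ D a w) :=
  (isCompact_image_chart (hD.inter_left (isClosed_tsupport χ)) hs).of_isClosed_subset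
    (isClosed_tsupport _) (tsupport_cutoff_subset hD hs a w)

/-- Near a point of `D` the cut-off function is a smooth function, up to a constant factor. -/
theorem cutoff_eventuallyEq {X : Type*} [TopologicalSpace X]
    {φ : OpenPartialHomeomorph X (Eu n)} {χ : X → ℝ} {D : Set X}
    (hs : tsupport χ ∩ D ⊆ φ.source) {a : X → ℝ} {x : X} (hx : x ∈ tsupport χ ∩ D)
    (ha : ∀ᶠ z in 𝓝[D] x, a z = a x) {w : Eu n → G}
    (hw : ∀ᶠ u in 𝓝 (φ x), φ.symm u ∉ D → w u = 0) :
    cutoff φ χ D a w =ᶠ[𝓝 (φ x)] fun u => (a x * χ (φ.symm u)) • w u := by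
  have hxs := hs hx
  have hc : Tendsto φ.symm (𝓝 (φ x)) (𝓝 x) := by
    have := (φ.continuousAt_symm (φ.map_source hxs)).tendsto
    rwa [φ.left_inv hxs] at this
  rw [eventually_nhdsWithin_iff] at ha
  filter_upwards [hw, hc.eventually ha, φ.open_target.mem_nhds (φ.map_source hxs)] with u h1 h2 h3
  by_cases hu : u ∈ φ '' (tsupport χ ∩ D)
  · rw [cutoff_apply hu]
    obtain ⟨z, hz, rfl⟩ := hu
    rw [φ.left_inv (hs hz)] at h2 ⊢
    rw [h2 hz.2]
  · rw [cutoff, indicator_of_notMem hu]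
    by_cases hD : φ.symm u ∈ D
    · have : φ.symm u ∉ tsupport χ := fun h => hu ⟨φ.symm u, ⟨h, hD⟩, φ.right_inv h3⟩
      simp [image_eq_zero_of_notMem_tsupport this]
    · rw [h1 hD, smul_zero]

theorem contDiff_cutoff [IsManifold 𝓘(ℝ, Eu n) ∞ X] {φ : OpenPartialHomeomorph X (Eu n)}
    (hφ : φ ∈ IsManifold.maximalAtlas 𝓘(ℝ, Eu n) ∞ X) {χ : X → ℝ}
    (hχ : ContMDiff 𝓘(ℝ, Eu n) 𝓘(ℝ, ℝ) ∞ χ) {D : Set X} (hD : IsCompact D)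
    (hs : tsupport χ ∩ D ⊆ φ.source) {a : X → ℝ}
    (ha : ∀ x ∈ tsupport χ ∩ D, ∀ᶠ z in 𝓝[D] x, a z = a x) {V : Set (Eu n)} (hV : IsOpen V)
    (hKV : φ '' (tsupport χ ∩ D) ⊆ V) {w : Eu n → G} (hw : ContDiffOn ℝ ∞ w V)
    (hw0 : ∀ u ∈ V, φ.symm u ∉ D → w u = 0) : ContDiff ℝ ∞ (cutoff φ χ D a w) := by
  refine contDiff_of_contDiffAt_tsupport fun u hu => ?_
  obtain ⟨x, hx, rfl⟩ := tsupport_cutoff_subset hD hs a w hu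
  have hVn : V ∈ 𝓝 (φ x) := hV.mem_nhds (hKV ⟨x, hx, rfl⟩)
  refine ContDiffAt.congr_of_eventuallyEq ?_
    (cutoff_eventuallyEq hs hx (ha x hx) (by filter_upwards [hVn] with u hu using hw0 u hu))
  have h1 : ContDiffAt ℝ ∞ (fun u => χ (φ.symm u)) (φ x) :=
    ((hχ _).comp _ (contMDiffAt_symm_of_mem_maximalAtlas hφ (φ.map_source (hs hx)))).contDiffAt
  exact (contDiffAt_const.mul h1).smul (hw.contDiffAt hVn)

theorem eventually_sign_eq [IsManifold 𝓘(ℝ, Eu n) ∞ X] {D : Set X}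
    {o : ∀ x : X, TopForm n x} (ho : IsOrientation D o) {φ : OpenPartialHomeomorph X (Eu n)}
    (hφ : φ ∈ IsManifold.maximalAtlas 𝓘(ℝ, Eu n) ∞ X) {x : X} (hx : x ∈ φ.source)
    (hxD : x ∈ D) :
    ∀ᶠ z in 𝓝[D] x, Real.sign (coeff φ (o z)) = Real.sign (coeff φ (o x)) := by
  have hc : ContinuousWithinAt (fun z => coeff φ (o z)) D x := by
    have := ho.2 φ hφ x ⟨hx, hxD⟩
    exact this.mono_of_mem_nhdsWithin
      (inter_mem (mem_nhdsWithin_of_mem_nhds (φ.open_source.mem_nhds hx)) self_mem_nhdsWithin)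
  rcases (coeff_ne_zero hφ hx (ho.1 x hxD)).lt_or_gt with h | h
  · filter_upwards [hc.eventually (gt_mem_nhds h)] with z hz
    rw [Real.sign_of_neg hz, Real.sign_of_neg h]
  · filter_upwards [hc.eventually (lt_mem_nhds h)] with z hz
    rw [Real.sign_of_pos hz, Real.sign_of_pos h]

end Cutoff


/-! ### The action in coordinates -/

section Action

variable {n m r : ℕ} {X Y : Type*}
  [TopologicalSpace X] [ChartedSpace (Eu n) X]
  [TopologicalSpace Y] [ChartedSpace (Eu n × Eu m) Y] {π : Y → X}

theorem FiberedChart.jetCoord_rep_mem (ψ : FiberedChart n m π) (r : ℕ) {γ : X → Y} {U : Set X}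
    (hγ : ∀ x ∈ U, π (γ x) = x) {u : Eu n} (hu : u ∈ ψ.repSet γ U) :
    jetCoord r (ψ.rep γ) u ∈ ψ.jetDomain r :=
  ψ.jetCoord_mem r (ψ.rep_mem_target hu.1 (hγ _ hu.2.1) hu.2.2)

theorem FiberedChart.contDiffOn_density (ψ : FiberedChart n m π) (l : Lagrangian n m π r)
    {γ : X → Y} {U : Set X} (hγ : IsSectionOn n m π γ U) :
    ContDiffOn ℝ ∞ (fun u => localDensity l.toFun ψ (jetCoord r (ψ.rep γ) u)) (ψ.repSet γ U) :=
  (l.smooth ψ).comp (contDiffOn_jetCoord (ψ.isOpen_repSet hγ) (ψ.contDiffOn_rep hγ))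
    fun _ hu => ψ.jetCoord_rep_mem r hγ.2.2 hu

theorem continuousForm_pullback [IsManifold 𝓘(ℝ, Eu n) ∞ X] [IsManifold 𝓘(ℝ, Eu n × Eu m) ∞ Y]
    (hπ : IsFibered n m π) (l : Lagrangian n m π r) {γ : X → Y} {U : Set X}
    (hγ : IsSectionOn n m π γ U) {D : Set X} (hDU : D ⊆ U) :
    ContinuousForm D (l.pullback γ) := by
  refine continuousForm_of_exists_chart fun x hx => ?_
  obtain ⟨ψ, hψ⟩ := exists_fiberedChart hπ (γ x)
  have hxU := hDU hx
  have hb := ψ.mem_base (hγ.2.2 x hxU) hψ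
  refine ⟨ψ.base, ψ.base_mem, hb, ContinuousAt.continuousWithinAt ?_⟩
  have h1 : ContinuousAt (fun z => localDensity l.toFun ψ (jetCoord r (ψ.rep γ) (ψ.base z))) x :=
    ((ψ.contDiffOn_density l hγ).continuousOn.continuousAt
      ((ψ.isOpen_repSet hγ).mem_nhds (ψ.mem_repSet hγ hxU hψ))).comp (ψ.base.continuousAt hb)
  refine h1.congr ?_
  filter_upwards [(isOpen_section_preimage hγ ψ.tot.open_source).mem_nhds ⟨hxU, hψ⟩] with z hz
  exact (coeff_pullback l ψ ⟨U, hz.1, hγ⟩ hz.2).symm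

namespace ChartFamily

variable {D : Set X}

/-- The part of the domain of integration in the chart with index `c`. -/
def K (F : ChartFamily n m π D) (c : X) : Set (Eu n) := (F.ψ c).base '' (tsupport (F.χ c) ∩ D)

/-- The sign that compares the orientation of a chart with `o`. -/
def sgn (F : ChartFamily n m π D) (o : ∀ x : X, TopForm n x) (c : X) (x : X) : ℝ :=
  Real.sign (coeff (F.ψ c).base (o x))

/-- The weight of the chart with index `c` in integrals over `D`. -/
def weight (F : ChartFamily n m π D) (o : ∀ x : X, TopForm n x) (c : X) (u : Eu n) : ℝ :=
  F.sgn o c ((F.ψ c).base.symm u) * F.χ c ((F.ψ c).base.symm u)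

/-- The integral over `D` of a form with given coefficients in the charts of the family. -/
def integral (F : ChartFamily n m π D) (o : ∀ x : X, TopForm n x) (g : X → Eu n → ℝ) : ℝ :=
  ∑ c ∈ F.s, ∫ u in F.K c, F.weight o c u * g c u

variable {F : ChartFamily n m π D} {γ : X → Y}

theorem Adapted.subset_source (hF : F.Adapted γ) (hγ : ∀ x ∈ D, π (γ x) = x) {c : X}
    (hc : c ∈ F.s) : tsupport (F.χ c) ∩ D ⊆ (F.ψ c).base.source :=
  fun x hx => (F.ψ c).mem_base (hγ x hx.2) (hF c hc x hx)

theorem Adapted.K_subset (hF : F.Adapted γ) {U : Set X} (hγ : IsSectionOn n m π γ U)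
    (hDU : D ⊆ U) {c : X} (hc : c ∈ F.s) : F.K c ⊆ (F.ψ c).repSet γ U := by
  rintro _ ⟨x, hx, rfl⟩
  exact (F.ψ c).mem_repSet hγ (hDU hx.2) (hF c hc x hx)

theorem Adapted.isCompact_K (hF : F.Adapted γ) (hγ : ∀ x ∈ D, π (γ x) = x) (hD : IsCompact D)
    {c : X} (hc : c ∈ F.s) : IsCompact (F.K c) :=
  isCompact_image_chart (hD.inter_left (isClosed_tsupport _)) (hF.subset_source hγ hc)

theorem Adapted.symm_mem (hF : F.Adapted γ) (hγ : ∀ x ∈ D, π (γ x) = x) {c : X}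
    (hc : c ∈ F.s) {u : Eu n} (hu : u ∈ F.K c) :
    (F.ψ c).base.symm u ∈ tsupport (F.χ c) ∩ D := by
  obtain ⟨x, hx, rfl⟩ := hu
  rwa [(F.ψ c).base.left_inv (hF.subset_source hγ hc hx)]

variable [IsManifold 𝓘(ℝ, Eu n) ∞ X]

theorem Adapted.continuousOn_sgn (hF : F.Adapted γ) (hγ : ∀ x ∈ D, π (γ x) = x)
    {o : ∀ x : X, TopForm n x} (ho : IsOrientation D o) {c : X} (hc : c ∈ F.s) :
    ContinuousOn (fun u => F.sgn o c ((F.ψ c).base.symm u)) (F.K c) :=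
  (continuousOn_comp_symm (continuousOn_sign_coeff ho (F.ψ c).base_mem)).mono
    (image_chart_subset (hF.subset_source hγ hc) inter_subset_right)

theorem Adapted.continuousOn_weight (hF : F.Adapted γ) (hγ : ∀ x ∈ D, π (γ x) = x)
    {o : ∀ x : X, TopForm n x} (ho : IsOrientation D o) {c : X} (hc : c ∈ F.s) :
    ContinuousOn (F.weight o c) (F.K c) := by
  refine (hF.continuousOn_sgn hγ ho hc).mul ((F.smooth c).continuous.comp_continuousOn
    ((F.ψ c).base.continuousOn_symm.mono ?_))
  exact (image_chart_subset (hF.subset_source hγ hc) inter_subset_right).trans inter_subset_left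

theorem Adapted.eventually_sgn (hF : F.Adapted γ) (hγ : ∀ x ∈ D, π (γ x) = x)
    {o : ∀ x : X, TopForm n x} (ho : IsOrientation D o) {c : X} (hc : c ∈ F.s) :
    ∀ x ∈ tsupport (F.χ c) ∩ D, ∀ᶠ z in 𝓝[D] x, F.sgn o c z = F.sgn o c x := fun _ hx =>
  eventually_sign_eq ho (F.ψ c).base_mem (hF.subset_source hγ hc hx) hx.2

variable [T2Space X] [SigmaCompactSpace X] [IsManifold 𝓘(ℝ, Eu n × Eu m) ∞ Y]

/-- The action as a sum of integrals in charts. -/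
theorem Adapted.action_eq (hF : F.Adapted γ) (hπ : IsFibered n m π) (l : Lagrangian n m π r)
    {U : Set X} (hγ : IsSectionOn n m π γ U) (hDU : D ⊆ U) (hD : IsCompact D)
    {o : ∀ x : X, TopForm n x} (ho : IsOrientation D o) :
    action l o D γ = F.integral o fun c u =>
      localDensity l.toFun (F.ψ c) (jetCoord r ((F.ψ c).rep γ) u) := by
  have hpb := continuousForm_pullback hπ l hγ hDU
  have hsec : ∀ x ∈ D, π (γ x) = x := fun x hx => hγ.2.2 x (hDU hx)
  have h1 : action l o D γ =
      integralForm o D fun x => ∑ c ∈ F.s, F.χ c x • l.pullback γ x := by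
    refine integralForm_congr hD.isClosed fun x hx => ?_
    rw [← Finset.sum_smul, F.sum_eq x hx, one_smul]
  rw [h1, integralForm_sum F.s (α := fun c x => F.χ c x • l.pullback γ x) hD ho
    fun c _ => hpb.smul (F.smooth c).continuous]
  refine Finset.sum_congr rfl fun c hc => ?_
  rw [integralForm_eq_integral_chart hD ho (hpb.smul (F.smooth c).continuous) (F.ψ c).base_mem
    (hD.inter_left (isClosed_tsupport (F.χ c))) (hF.subset_source hsec hc) inter_subset_right]
  · refine setIntegral_congr_fun (hF.isCompact_K hsec hD hc).measurableSet fun u hu => ?_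
    have hu' := hF.symm_mem hsec hc hu
    have h2 := coeff_pullback l (F.ψ c) ⟨U, hDU hu'.2, hγ⟩ (hF c hc _ hu')
    rw [(F.ψ c).base.right_inv (hF.K_subset hγ hDU hc hu).1] at h2
    simp only [sgnCoeff, weight, sgn, ← h2]
    rw [mul_assoc]
    rfl
  · intro x hx hxK
    have : x ∉ tsupport (F.χ c) := fun h => hxK ⟨h, hx⟩
    simp only [image_eq_zero_of_notMem_tsupport this, zero_smul]

end ChartFamily

end Action


/-! ### The first variation -/

section FirstVariation

variable {n m r : ℕ} {X Y : Type*}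
  [TopologicalSpace X] [ChartedSpace (Eu n) X]
  [TopologicalSpace Y] [ChartedSpace (Eu n × Eu m) Y]

/-- A smooth one-parameter family of sections over `U ⊇ D` whose velocity at the parameter `0`
vanishes outside `D`. -/
structure IsDeformation (n m : ℕ) {X Y : Type*}
    [TopologicalSpace X] [ChartedSpace (Eu n) X]
    [TopologicalSpace Y] [ChartedSpace (Eu n × Eu m) Y]
    (π : Y → X) (D : Set X) (ε : ℝ) (U : Set X) (Γ : ℝ → X → Y) : Prop where
  pos : 0 < ε
  isOpen : IsOpen U
  subset : D ⊆ U
  smooth : ContMDiffOn (𝓘(ℝ, ℝ).prod 𝓘(ℝ, Eu n)) 𝓘(ℝ, Eu n × Eu m) ∞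
    (fun q : ℝ × X => Γ q.1 q.2) (Ioo (-ε) ε ×ˢ U)
  isSection : ∀ t ∈ Ioo (-ε) ε, ∀ x ∈ U, π (Γ t x) = x
  zero : ∀ ψ : FiberedChart n m π, ∀ x ∈ U, x ∉ D → Γ 0 x ∈ ψ.tot.source →
    deriv (fun t => (ψ.tot (Γ t x)).2) 0 = 0

variable {π : Y → X} {D : Set X}

/-- The components of the velocity of a one-parameter family of sections. -/
def FiberedChart.repVel (ψ : FiberedChart n m π) (Γ : ℝ → X → Y) (u : Eu n) : Eu m :=
  deriv (fun t => ψ.rep (Γ t) u) 0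

theorem jetVec_const_smul {w : Eu n → Eu m} {u : Eu n} (hw : ContDiffAt ℝ ∞ w u) (a : ℝ) :
    jetVec r (fun u => a • w u) u = a • jetVec r w u := by
  refine Prod.ext (by simp [jetVec]) (funext fun I => ?_)
  change iteratedFDeriv ℝ I.1 (a • w) u _ = _
  rw [iteratedFDeriv_const_smul_apply (hw.of_le (by exact_mod_cast le_top))]
  rfl

namespace IsDeformation

variable {ε : ℝ} {U : Set X} {Γ : ℝ → X → Y}

theorem zero_mem (h : IsDeformation n m π D ε U Γ) : (0 : ℝ) ∈ Ioo (-ε) ε :=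
  ⟨neg_lt_zero.2 h.pos, h.pos⟩

theorem isSectionOn (h : IsDeformation n m π D ε U Γ) {t : ℝ}
    (ht : t ∈ Ioo (-ε) ε) : IsSectionOn n m π (Γ t) U :=
  ⟨h.isOpen, h.smooth.comp (contMDiff_const.prodMk contMDiff_id).contMDiffOn
    (fun _ hx => ⟨ht, hx⟩), h.isSection t ht⟩

theorem section_eq (h : IsDeformation n m π D ε U Γ) :
    ∀ x ∈ D, π (Γ 0 x) = x := fun x hx => h.isSection 0 h.zero_mem x (h.subset hx)

theorem isOpen_repDomain (h : IsDeformation n m π D ε U Γ)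
    (ψ : FiberedChart n m π) : IsOpen (ψ.repDomain Γ (Ioo (-ε) ε) U) :=
  ψ.isOpen_repDomain isOpen_Ioo h.isOpen h.smooth

theorem jetCoord_mem (h : IsDeformation n m π D ε U Γ) (ψ : FiberedChart n m π)
    (r : ℕ) : ∀ q ∈ ψ.repDomain Γ (Ioo (-ε) ε) U,
      jetCoord r (ψ.rep (Γ q.1)) q.2 ∈ ψ.jetDomain r := fun q hq =>
  ψ.jetCoord_rep_mem r (h.isSection q.1 hq.1) hq.2

theorem mem_repDomain (h : IsDeformation n m π D ε U Γ) (ψ : FiberedChart n m π)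
    {u : Eu n} (hu : u ∈ ψ.repSet (Γ 0) U) : ((0 : ℝ), u) ∈ ψ.repDomain Γ (Ioo (-ε) ε) U :=
  ⟨h.zero_mem, hu⟩

theorem contDiffOn_repVel (h : IsDeformation n m π D ε U Γ)
    (ψ : FiberedChart n m π) : ContDiffOn ℝ ∞ (ψ.repVel Γ) (ψ.repSet (Γ 0) U) :=
  (contDiffOn_deriv_param (h.isOpen_repDomain ψ) (ψ.contDiffOn_rep_param h.smooth)).comp
    (contDiff_prodMk_right (0 : ℝ)).contDiffOn fun _ hu => h.mem_repDomain ψ hu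

theorem repVel_eq_zero (h : IsDeformation n m π D ε U Γ) (ψ : FiberedChart n m π) :
    ∀ u ∈ ψ.repSet (Γ 0) U, ψ.base.symm u ∉ D → ψ.repVel Γ u = 0 := fun _ hu hD =>
  h.zero ψ _ hu.2.1 hD hu.2.2

theorem eventually_adapted (h : IsDeformation n m π D ε U Γ) (hD : IsCompact D)
    {F : ChartFamily n m π D} (hF : F.Adapted (Γ 0)) :
    ∀ᶠ t in 𝓝 (0 : ℝ), t ∈ Ioo (-ε) ε ∧ F.Adapted (Γ t) := by
  refine Eventually.and (isOpen_Ioo.mem_nhds h.zero_mem) ?_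
  refine (Finset.eventually_all F.s).2 fun c hc => ?_
  refine (hD.inter_left (isClosed_tsupport (F.χ c))).eventually_forall_of_forall_eventually
    fun x hx => ?_
  have ho := h.smooth.continuousOn.isOpen_inter_preimage (isOpen_Ioo.prod h.isOpen)
    (F.ψ c).tot.open_source
  filter_upwards [ho.mem_nhds ⟨⟨h.zero_mem, h.subset hx.2⟩, hF c hc x hx⟩] with z hz using hz.2

end IsDeformation

theorem ChartFamily.mul_mem_Ioo (F : ChartFamily n m π D) (k x : X) {ε t : ℝ}
    (ht : t ∈ Ioo (-ε) ε) : F.χ k x * t ∈ Ioo (-ε) ε := by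
  refine abs_lt.1 (lt_of_le_of_lt ?_ (abs_lt.2 ht))
  rw [abs_mul]
  exact mul_le_of_le_one_left (abs_nonneg t) (F.abs_le k x)

/-- The deformation that moves only the support of one function of the partition: time is rescaled
by that function, so that the velocity is multiplied by it. -/
def cutDeformation (F : ChartFamily n m π D) (Γ : ℝ → X → Y) (k : X) : ℝ → X → Y :=
  fun t x => Γ (F.χ k x * t) x

theorem cutDeformation_zero (F : ChartFamily n m π D) (Γ : ℝ → X → Y) (k : X) :
    cutDeformation F Γ k 0 = Γ 0 := by
  funext x
  simp [cutDeformation]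

theorem repVel_cutDeformation (F : ChartFamily n m π D) (Γ : ℝ → X → Y) (k : X)
    (ψ : FiberedChart n m π) (u : Eu n) :
    ψ.repVel (cutDeformation F Γ k) u = F.χ k (ψ.base.symm u) • ψ.repVel Γ u := by
  have := deriv_comp_mul_left (F.χ k (ψ.base.symm u))
    (fun t => (ψ.tot (Γ t (ψ.base.symm u))).2) 0
  simp only [FiberedChart.repVel, FiberedChart.rep, cutDeformation]
  rw [this, mul_zero]

theorem IsDeformation.cut {ε : ℝ} {U : Set X} {Γ : ℝ → X → Y}
    (h : IsDeformation n m π D ε U Γ)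
    (F : ChartFamily n m π D) (k : X) : IsDeformation n m π D ε U (cutDeformation F Γ k) where
  pos := h.pos
  isOpen := h.isOpen
  subset := h.subset
  smooth := by
    have h1 : ContMDiff (𝓘(ℝ, ℝ).prod 𝓘(ℝ, Eu n)) (𝓘(ℝ, ℝ).prod 𝓘(ℝ, Eu n)) ∞
        (fun q : ℝ × X => (F.χ k q.2 * q.1, q.2)) :=
      (((F.smooth k).comp contMDiff_snd).smul contMDiff_fst).prodMk contMDiff_snd
    exact h.smooth.comp h1.contMDiffOn fun q hq => ⟨F.mul_mem_Ioo k q.2 hq.1, hq.2⟩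
  isSection := fun t ht x hx => h.isSection _ (F.mul_mem_Ioo k x ht) x hx
  zero := by
    intro ψ x hx hD hψ
    have e : cutDeformation F Γ k 0 x = Γ 0 x := by simp [cutDeformation]
    rw [e] at hψ
    have := deriv_comp_mul_left (F.χ k x) (fun t => (ψ.tot (Γ t x)).2) 0
    simp only [cutDeformation]
    rw [this, mul_zero, h.zero ψ x hx hD hψ, smul_zero]

theorem ChartFamily.hasDerivAt_integral [IsManifold 𝓘(ℝ, Eu n) ∞ X] {F : ChartFamily n m π D}
    {γ : X → Y} (hF : F.Adapted γ) (hγ : ∀ x ∈ D, π (γ x) = x) (hD : IsCompact D)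
    {o : ∀ x : X, TopForm n x} (ho : IsOrientation D o) {g : X → ℝ → Eu n → ℝ}
    {W : X → Set (ℝ × Eu n)} (hW : ∀ c, IsOpen (W c))
    (hg : ∀ c, ContDiffOn ℝ ∞ (fun q : ℝ × Eu n => g c q.1 q.2) (W c))
    (hKW : ∀ c ∈ F.s, ∀ u ∈ F.K c, ((0 : ℝ), u) ∈ W c) :
    HasDerivAt (fun t => F.integral o fun c => g c t)
      (F.integral o fun c u => deriv (fun t => g c t u) 0) 0 :=
  HasDerivAt.fun_sum fun c hc => hasDerivAt_integral_mul (hF.isCompact_K hγ hD hc) (hW c)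
    (hKW c hc) (hg c) (hF.continuousOn_weight hγ ho hc)

theorem ChartFamily.integral_congr [IsManifold 𝓘(ℝ, Eu n) ∞ X] {F : ChartFamily n m π D}
    {γ : X → Y} (hF : F.Adapted γ) (hγ : ∀ x ∈ D, π (γ x) = x) (hD : IsCompact D)
    (o : ∀ x : X, TopForm n x) {g g' : X → Eu n → ℝ}
    (h : ∀ c ∈ F.s, ∀ u ∈ F.K c, g c u = g' c u) : F.integral o g = F.integral o g' :=
  Finset.sum_congr rfl fun c hc => setIntegral_congr_fun (hF.isCompact_K hγ hD hc).measurableSet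
    fun u hu => by simp only [h c hc u hu]

variable [IsManifold 𝓘(ℝ, Eu n) ∞ X] [T2Space X] [SigmaCompactSpace X]
  [IsManifold 𝓘(ℝ, Eu n × Eu m) ∞ Y] {ε : ℝ} {U : Set X} {Γ : ℝ → X → Y}

/-- The derivative of the action before any integration by parts: a linear form in the jet of the
velocity. -/
theorem IsDeformation.hasDerivAt_action (h : IsDeformation n m π D ε U Γ)
    (hπ : IsFibered n m π) (l : Lagrangian n m π r) (hD : IsCompact D)
    {o : ∀ x : X, TopForm n x} (ho : IsOrientation D o) {F : ChartFamily n m π D}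
    (hF : F.Adapted (Γ 0)) :
    HasDerivAt (fun t => action l o D (Γ t)) (F.integral o fun c u =>
      fderiv ℝ (localDensity l.toFun (F.ψ c)) (jetCoord r ((F.ψ c).rep (Γ 0)) u)
        (jetVec r ((F.ψ c).repVel Γ) u)) 0 := by
  have h1 : (fun t => action l o D (Γ t)) =ᶠ[𝓝 0] fun t => F.integral o fun c u =>
      localDensity l.toFun (F.ψ c) (jetCoord r ((F.ψ c).rep (Γ t)) u) := by
    filter_upwards [h.eventually_adapted hD hF] with t ht
    exact ht.2.action_eq hπ l (h.isSectionOn ht.1) h.subset hD ho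
  refine HasDerivAt.congr_of_eventuallyEq ?_ h1
  have hs0 := h.isSectionOn h.zero_mem
  have h2 := ChartFamily.hasDerivAt_integral hF h.section_eq hD ho
    (g := fun c t u => localDensity l.toFun (F.ψ c) (jetCoord r ((F.ψ c).rep (Γ t)) u))
    (fun c => h.isOpen_repDomain (F.ψ c))
    (fun c => (l.smooth (F.ψ c)).comp (contDiffOn_jetCoord_param
      (g := fun t => (F.ψ c).rep (Γ t)) (h.isOpen_repDomain (F.ψ c))
      ((F.ψ c).contDiffOn_rep_param h.smooth)) (h.jetCoord_mem (F.ψ c) r))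
    (fun c hc u hu => h.mem_repDomain _ (hF.K_subset hs0 h.subset hc hu))
  rwa [ChartFamily.integral_congr hF h.section_eq hD o fun c hc u hu => ?_] at h2
  exact (hasDerivAt_lagrangian ((F.ψ c).isOpen_jetDomain r) (l.smooth (F.ψ c))
    (h.isOpen_repDomain (F.ψ c)) ((F.ψ c).contDiffOn_rep_param h.smooth)
    (h.jetCoord_mem (F.ψ c) r) (h.mem_repDomain _ (hF.K_subset hs0 h.subset hc hu))).deriv

/-- The action changes only in the chart that contains the moving part of the section. -/
theorem IsDeformation.action_cut_eq (h : IsDeformation n m π D ε U Γ)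
    (hπ : IsFibered n m π) (l : Lagrangian n m π r) (hD : IsCompact D)
    {o : ∀ x : X, TopForm n x} (ho : IsOrientation D o) {F : ChartFamily n m π D}
    (hF : F.Adapted (Γ 0)) {k : X} (hk : k ∈ F.s) {t : ℝ} (ht : t ∈ Ioo (-ε) ε)
    (hFt : F.Adapted (cutDeformation F Γ k t)) :
    action l o D (cutDeformation F Γ k t) = action l o D (Γ 0) +
      ∫ u in F.K k, F.sgn o k ((F.ψ k).base.symm u) *
        (localDensity l.toFun (F.ψ k) (jetCoord r ((F.ψ k).rep (cutDeformation F Γ k t)) u) -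
          localDensity l.toFun (F.ψ k) (jetCoord r ((F.ψ k).rep (Γ 0)) u)) := by
  have hs0 := h.isSectionOn h.zero_mem
  have hst := (h.cut F k).isSectionOn ht
  have hc0 := continuousForm_pullback hπ l hs0 h.subset
  have hct := continuousForm_pullback hπ l hst h.subset
  rw [← sub_eq_iff_eq_add', action, action, ← integralForm_sub hD ho hct hc0,
    integralForm_eq_integral_chart hD ho (hct.sub hc0) (F.ψ k).base_mem
      (hD.inter_left (isClosed_tsupport (F.χ k))) (hF.subset_source h.section_eq hk)
      inter_subset_right]
  · refine setIntegral_congr_fun (hF.isCompact_K h.section_eq hD hk).measurableSet fun u hu => ?_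
    have hu' := hF.symm_mem h.section_eq hk hu
    have hr := (F.ψ k).base.right_inv (hF.K_subset hs0 h.subset hk hu).1
    have h1 := coeff_pullback l (F.ψ k) ⟨U, h.subset hu'.2, hst⟩ (hFt k hk _ hu')
    have h2 := coeff_pullback l (F.ψ k) ⟨U, h.subset hu'.2, hs0⟩ (hF k hk _ hu')
    rw [hr] at h1 h2
    rw [← h1, ← h2]
    rfl
  · intro x hx hxK
    have hxt : x ∉ tsupport (F.χ k) := fun h => hxK ⟨h, hx⟩
    refine sub_eq_zero.2 (l.pullback_congr ?_)
    filter_upwards [(isClosed_tsupport (F.χ k)).isOpen_compl.mem_nhds hxt] with z hz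
    simp [cutDeformation, image_eq_zero_of_notMem_tsupport hz]

/-- The first variation for a deformation cut off to one chart, where integration by parts takes
place in `ℝⁿ`. -/
theorem IsDeformation.hasDerivAt_action_cut (h : IsDeformation n m π D ε U Γ)
    (hπ : IsFibered n m π) (l : Lagrangian n m π r) (hD : IsCompact D)
    {o : ∀ x : X, TopForm n x} (ho : IsOrientation D o) {F : ChartFamily n m π D}
    (hF : F.Adapted (Γ 0)) {k : X} (hk : k ∈ F.s) :
    HasDerivAt (fun t => action l o D (cutDeformation F Γ k t))
      (∫ u in F.K k, F.weight o k u * ∑ σ, (F.ψ k).repVel Γ u σ *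
        eulerExpr (localDensity l.toFun (F.ψ k)) ((F.ψ k).rep (Γ 0)) u σ) 0 := by
  have h' := h.cut F k
  have e0 := cutDeformation_zero F Γ k
  have hF' : F.Adapted (cutDeformation F Γ k 0) := by rwa [e0]
  set ψ := F.ψ k with hψ
  set L := localDensity l.toFun ψ with hL
  have hs0 := h.isSectionOn h.zero_mem
  have hKs := hF.subset_source h.section_eq hk
  have hKV := hF.K_subset hs0 h.subset hk
  have hVo := ψ.isOpen_repSet hs0
  have hKc := hF.isCompact_K h.section_eq hD hk
  have h1 : (fun t => action l o D (cutDeformation F Γ k t)) =ᶠ[𝓝 0] fun t =>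
      action l o D (Γ 0) + ∫ u in F.K k, F.sgn o k (ψ.base.symm u) *
        (L (jetCoord r (ψ.rep (cutDeformation F Γ k t)) u) - L (jetCoord r (ψ.rep (Γ 0)) u)) := by
    filter_upwards [h'.eventually_adapted hD hF'] with t ht
    exact h.action_cut_eq hπ l hD ho hF hk ht.1 ht.2
  refine HasDerivAt.congr_of_eventuallyEq (HasDerivAt.const_add _ ?_) h1
  set W := ψ.repDomain (cutDeformation F Γ k) (Ioo (-ε) ε) U with hW
  have hWo : IsOpen W := h'.isOpen_repDomain ψ
  have hg1 : ContDiffOn ℝ ∞ (fun q : ℝ × Eu n =>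
      L (jetCoord r (ψ.rep (cutDeformation F Γ k q.1)) q.2)) W :=
    (l.smooth ψ).comp (contDiffOn_jetCoord_param
      (g := fun t => ψ.rep (cutDeformation F Γ k t)) hWo (ψ.contDiffOn_rep_param h'.smooth))
      (h'.jetCoord_mem ψ r)
  have hg2 : ContDiffOn ℝ ∞ (fun q : ℝ × Eu n => L (jetCoord r (ψ.rep (Γ 0)) q.2))
      (univ ×ˢ ψ.repSet (Γ 0) U) :=
    (ψ.contDiffOn_density l hs0).comp contDiff_snd.contDiffOn fun q hq => hq.2
  have hKW : ∀ u ∈ F.K k, ((0 : ℝ), u) ∈ W := fun u hu =>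
    h'.mem_repDomain ψ (by rw [e0]; exact hKV hu)
  have h2 := hasDerivAt_integral_mul hKc (hWo.inter (isOpen_univ.prod hVo))
    (fun u hu => ⟨hKW u hu, mem_univ _, hKV hu⟩)
    (g := fun t u => L (jetCoord r (ψ.rep (cutDeformation F Γ k t)) u) -
      L (jetCoord r (ψ.rep (Γ 0)) u))
    ((hg1.mono inter_subset_left).sub (hg2.mono inter_subset_right))
    (hF.continuousOn_sgn h.section_eq ho hk)
  refine h2.congr_deriv (Eq.symm ?_)
  -- The variation to integrate by parts. It contains the sign of the orientation and is smooth on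
  -- all of `ℝⁿ`, because the velocity vanishes outside `D` and the sign is locally constant on `D`.
  set w := cutoff ψ.base (F.χ k) D (F.sgn o k) (ψ.repVel Γ) with hw
  have hwK : tsupport w ⊆ F.K k := tsupport_cutoff_subset hD hKs _ _
  have hw0 := h.repVel_eq_zero ψ
  have hwsm : ContDiff ℝ ∞ w := contDiff_cutoff ψ.base_mem (F.smooth k) hD hKs
    (hF.eventually_sgn h.section_eq ho hk) hVo hKV (h.contDiffOn_repVel ψ) hw0
  have key := integral_fderiv_jetVec (ψ.isOpen_jetDomain r) (l.smooth ψ) hVo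
    (ψ.contDiffOn_rep hs0) (fun u hu => ψ.jetCoord_rep_mem r hs0.2.2 hu) hwsm
    (hasCompactSupport_cutoff hD hKs _ _) (hwK.trans hKV)
  have k1 : ∫ u in F.K k, fderiv ℝ L (jetCoord r (ψ.rep (Γ 0)) u) (jetVec r w u) =
      ∫ u, fderiv ℝ L (jetCoord r (ψ.rep (Γ 0)) u) (jetVec r w u) :=
    setIntegral_eq_integral_of_forall_compl_eq_zero fun u hu => by
      rw [jetVec_eq_zero (notMem_tsupport_iff_eventuallyEq.1 fun h => hu (hwK h)), map_zero]
  have k2 : ∫ u in F.K k, ∑ σ, w u σ * eulerExpr L (ψ.rep (Γ 0)) u σ =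
      ∫ u, ∑ σ, w u σ * eulerExpr L (ψ.rep (Γ 0)) u σ :=
    setIntegral_eq_integral_of_forall_compl_eq_zero fun u hu => Finset.sum_eq_zero fun σ _ => by
      rw [image_eq_zero_of_notMem_tsupport fun h => hu (hwK h)]
      simp
  refine Eq.trans ?_ ((k2.trans (key.symm.trans k1.symm)).trans ?_)
  · refine setIntegral_congr_fun hKc.measurableSet fun u hu => ?_
    have hwu : w u = F.weight o k u • ψ.repVel Γ u := cutoff_apply hu
    simp only [hwu, Finset.mul_sum]
    refine Finset.sum_congr rfl fun σ _ => ?_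
    rw [PiLp.smul_apply, smul_eq_mul, mul_assoc]
  · refine setIntegral_congr_fun hKc.measurableSet fun u hu => ?_
    obtain ⟨x, hx, rfl⟩ := id hu
    have hVn : ψ.repSet (Γ 0) U ∈ 𝓝 (ψ.base x) := hVo.mem_nhds (hKV hu)
    have e1 : w =ᶠ[𝓝 (ψ.base x)] fun u => F.sgn o k x • ψ.repVel (cutDeformation F Γ k) u := by
      refine (cutoff_eventuallyEq hKs hx (hF.eventually_sgn h.section_eq ho hk x hx)
        (by filter_upwards [hVn] with u hu using hw0 u hu)).trans
        (Eventually.of_forall fun u => ?_)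
      simp only [repVel_cutDeformation, smul_smul]
      rfl
    have hd := hasDerivAt_lagrangian (ψ.isOpen_jetDomain r) (l.smooth ψ)
      (g := fun t => ψ.rep (cutDeformation F Γ k t)) hWo
      (ψ.contDiffOn_rep_param h'.smooth) (h'.jetCoord_mem ψ r) (hKW _ hu)
    have hsm : ContDiffAt ℝ ∞ (ψ.repVel (cutDeformation F Γ k)) (ψ.base x) :=
      (h'.contDiffOn_repVel ψ).contDiffAt (by rwa [e0])
    simp only [deriv_sub_const]
    rw [hd.deriv, jetVec_congr r e1, jetVec_const_smul hsm, map_smul, smul_eq_mul,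
      ψ.base.left_inv (hKs hx), e0]
    rfl

/-- The first variation formula. By uniqueness of derivatives the linear form of
`IsDeformation.hasDerivAt_action` may be computed for the velocities of the deformations
`cutDeformation F Γ k`, which add up to the velocity of `Γ`. -/
theorem IsDeformation.hasDerivAt_action_euler (h : IsDeformation n m π D ε U Γ)
    (hπ : IsFibered n m π) (l : Lagrangian n m π r) (hD : IsCompact D)
    {o : ∀ x : X, TopForm n x} (ho : IsOrientation D o) {F : ChartFamily n m π D}
    (hF : F.Adapted (Γ 0)) :
    HasDerivAt (fun t => action l o D (Γ t)) (F.integral o fun c u => ∑ σ,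
      (F.ψ c).repVel Γ u σ *
        eulerExpr (localDensity l.toFun (F.ψ c)) ((F.ψ c).rep (Γ 0)) u σ) 0 := by
  refine (h.hasDerivAt_action hπ l hD ho hF).congr_deriv ?_
  have hs0 := h.isSectionOn h.zero_mem
  have hcut : ∀ k ∈ F.s, _ := fun k hk =>
    ((h.cut F k).hasDerivAt_action hπ l hD ho (F := F)
      (by rwa [cutDeformation_zero])).unique (h.hasDerivAt_action_cut hπ l hD ho hF hk)
  simp only [cutDeformation_zero] at hcut
  have hVo := fun c => (F.ψ c).isOpen_repSet hs0
  have hcont : ∀ k, ∀ c ∈ F.s, ContinuousOn (fun u => F.weight o c u *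
      fderiv ℝ (localDensity l.toFun (F.ψ c)) (jetCoord r ((F.ψ c).rep (Γ 0)) u)
        (jetVec r ((F.ψ c).repVel (cutDeformation F Γ k)) u)) (F.K c) := by
    intro k c hc
    have a1 := (h.cut F k).contDiffOn_repVel (F.ψ c)
    rw [cutDeformation_zero] at a1
    have a2 := (contDiffOn_jetVec (r := r) (hVo c) a1).continuousOn
    have a3 : ContinuousOn (fun u => fderiv ℝ (localDensity l.toFun (F.ψ c))
        (jetCoord r ((F.ψ c).rep (Γ 0)) u)) ((F.ψ c).repSet (Γ 0) U) :=
      ((l.smooth (F.ψ c)).continuousOn_fderiv_of_isOpen ((F.ψ c).isOpen_jetDomain r)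
        (by simp)).comp (contDiffOn_jetCoord (hVo c) ((F.ψ c).contDiffOn_rep hs0)).continuousOn
        fun u hu => (F.ψ c).jetCoord_rep_mem r hs0.2.2 hu
    exact (hF.continuousOn_weight h.section_eq ho hc).mul
      ((a3.clm_apply a2).mono (hF.K_subset hs0 h.subset hc))
  have hsplit : ∀ c ∈ F.s, ∀ u ∈ F.K c, jetVec r ((F.ψ c).repVel Γ) u =
      ∑ k ∈ F.s, jetVec r ((F.ψ c).repVel (cutDeformation F Γ k)) u := by
    intro c hc u hu
    have hVn := (hVo c).mem_nhds (hF.K_subset hs0 h.subset hc hu)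
    rw [← jetVec_sum F.s fun k _ => by
      have := (h.cut F k).contDiffOn_repVel (F.ψ c)
      rw [cutDeformation_zero] at this
      exact this.contDiffAt hVn]
    refine jetVec_congr r ?_
    filter_upwards [hVn] with v hv
    simp only [repVel_cutDeformation, ← Finset.sum_smul]
    by_cases hvD : (F.ψ c).base.symm v ∈ D
    · rw [F.sum_eq _ hvD, one_smul]
    · rw [h.repVel_eq_zero (F.ψ c) v hv hvD, smul_zero]
  calc _ = ∑ c ∈ F.s, ∑ k ∈ F.s, ∫ u in F.K c, F.weight o c u *
        fderiv ℝ (localDensity l.toFun (F.ψ c)) (jetCoord r ((F.ψ c).rep (Γ 0)) u)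
          (jetVec r ((F.ψ c).repVel (cutDeformation F Γ k)) u) := by
        refine Finset.sum_congr rfl fun c hc => ?_
        have hKc := hF.isCompact_K h.section_eq hD hc
        rw [← integral_finsetSum _ fun k _ => (hcont k c hc).integrableOn_compact hKc]
        refine setIntegral_congr_fun hKc.measurableSet fun u hu => ?_
        simp only [hsplit c hc u hu, map_sum, Finset.mul_sum]
    _ = ∑ k ∈ F.s, ∑ c ∈ F.s, ∫ u in F.K c, F.weight o c u *
        fderiv ℝ (localDensity l.toFun (F.ψ c)) (jetCoord r ((F.ψ c).rep (Γ 0)) u)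
          (jetVec r ((F.ψ c).repVel (cutDeformation F Γ k)) u) := Finset.sum_comm
    _ = _ := Finset.sum_congr rfl hcut

end FirstVariation


/-! ### Vertical vectors in fibered charts -/

section Vertical

variable {n m : ℕ} {X Y : Type*}
  [TopologicalSpace X] [ChartedSpace (Eu n) X]
  [TopologicalSpace Y] [ChartedSpace (Eu n × Eu m) Y] {π : Y → X}

/-- The components of a tangent vector of `Y` in the direction of the fibres, in a fibered chart. -/
def FiberedChart.vert (ψ : FiberedChart n m π) (q : TangentBundle 𝓘(ℝ, Eu n × Eu m) Y) : Eu m :=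
  (show Eu n × Eu m from mfderiv 𝓘(ℝ, Eu n × Eu m) 𝓘(ℝ, Eu n × Eu m) ψ.tot q.1 q.2).2

theorem FiberedChart.vert_zero (ψ : FiberedChart n m π) (y : Y) :
    ψ.vert ⟨y, (0 : TangentSpace 𝓘(ℝ, Eu n × Eu m) y)⟩ = 0 := by
  unfold FiberedChart.vert
  rw [map_zero]
  rfl

theorem FiberedChart.vert_smul (ψ : FiberedChart n m π) (y : Y) (a : ℝ)
    (v : TangentSpace 𝓘(ℝ, Eu n × Eu m) y) :
    ψ.vert ⟨y, a • v⟩ = a • ψ.vert ⟨y, v⟩ := by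
  unfold FiberedChart.vert
  rw [map_smul]
  rfl

theorem FiberedChart.mdifferentiableAt_tot (ψ : FiberedChart n m π) {y : Y}
    (hy : y ∈ ψ.tot.source) :
    MDifferentiableAt 𝓘(ℝ, Eu n × Eu m) 𝓘(ℝ, Eu n × Eu m) ψ.tot y :=
  (contMDiffAt_of_mem_maximalAtlas ψ.tot_mem hy).mdifferentiableAt (by simp)

theorem FiberedChart.vert_velocity (ψ : FiberedChart n m π) {c : ℝ → Y}
    (hc : MDifferentiableAt 𝓘(ℝ, ℝ) 𝓘(ℝ, Eu n × Eu m) c 0) (h0 : c 0 ∈ ψ.tot.source) :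
    ψ.vert (velocity c) = deriv (fun t => (ψ.tot (c t)).2) 0 := by
  have h1 := mfderiv_comp (0 : ℝ) (ψ.mdifferentiableAt_tot h0) hc
  have h2 : DifferentiableAt ℝ (ψ.tot ∘ c) 0 :=
    ((ψ.mdifferentiableAt_tot h0).comp (0 : ℝ) hc).differentiableAt
  have h3 : HasDerivAt (fun t => (ψ.tot (c t)).2) (deriv (ψ.tot ∘ c) 0).2 0 :=
    (ContinuousLinearMap.snd ℝ (Eu n) (Eu m)).hasFDerivAt.comp_hasDerivAt 0 h2.hasDerivAt
  rw [h3.deriv, ← fderiv_apply_one_eq_deriv, ← mfderiv_eq_fderiv, h1]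
  rfl

theorem FiberedChart.contMDiffAt_proj (ψ : FiberedChart n m π) {y : Y} (hy : y ∈ ψ.tot.source) :
    ContMDiffAt 𝓘(ℝ, Eu n × Eu m) 𝓘(ℝ, Eu n) ∞ π y := by
  have h1 : ContMDiffAt 𝓘(ℝ, Eu n × Eu m) 𝓘(ℝ, Eu n) ∞ (fun y => ψ.base.symm (ψ.tot y).1) y := by
    refine ContMDiffAt.comp y (g := ψ.base.symm) (f := fun y => (ψ.tot y).1) ?_
      (contDiff_fst.contMDiff.contMDiffAt.comp y (contMDiffAt_of_mem_maximalAtlas ψ.tot_mem hy))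
    rw [ψ.fst_eq y hy]
    exact contMDiffAt_symm_of_mem_maximalAtlas ψ.base_mem (ψ.base.map_source (ψ.mapsTo y hy))
  refine h1.congr_of_eventuallyEq ?_
  filter_upwards [ψ.tot.open_source.mem_nhds hy] with z hz
  rw [ψ.fst_eq z hz, ψ.base.left_inv (ψ.mapsTo z hz)]

/-- The components of a smooth vector field along a map are smooth. -/
theorem FiberedChart.contMDiffOn_vert [IsManifold 𝓘(ℝ, Eu n × Eu m) ∞ Y]
    (ψ : FiberedChart n m π) {E M : Type*}
    [NormedAddCommGroup E] [NormedSpace ℝ E] [TopologicalSpace M] [ChartedSpace E M]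
    {f : M → TangentBundle 𝓘(ℝ, Eu n × Eu m) Y} {A : Set M}
    (hf : ContMDiffOn 𝓘(ℝ, E) (𝓘(ℝ, Eu n × Eu m).tangent) ∞ f A)
    (hA : ∀ x ∈ A, (f x).1 ∈ ψ.tot.source) :
    ContMDiffOn 𝓘(ℝ, E) 𝓘(ℝ, Eu m) ∞ (fun x => ψ.vert (f x)) A := by
  have h1 := (contMDiffOn_of_mem_maximalAtlas ψ.tot_mem).contMDiffOn_tangentMapWithin (m := ∞)
    le_rfl ψ.tot.open_source.uniqueMDiffOn
  have h2 := h1.comp hf hA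
  have h3 := (contMDiff_snd_tangentBundle_modelSpace (Eu n × Eu m) 𝓘(ℝ, Eu n × Eu m)
    (n := ∞)).comp_contMDiffOn h2
  have h4 : ContMDiffOn 𝓘(ℝ, E) 𝓘(ℝ, Eu m) ∞ (fun x => (show Eu n × Eu m from
      (tangentMapWithin 𝓘(ℝ, Eu n × Eu m) 𝓘(ℝ, Eu n × Eu m) ψ.tot ψ.tot.source (f x)).2).2) A :=
    (contDiff_snd (𝕜 := ℝ) (E := Eu n) (F := Eu m)).contMDiff.comp_contMDiffOn h3
  refine h4.congr fun x hx => ?_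
  rw [tangentMapWithin_eq_tangentMap (ψ.tot.open_source.uniqueMDiffOn _ (hA x hx))
    (ψ.mdifferentiableAt_tot (hA x hx))]
  rfl

/-- A vertical vector is determined by its components. -/
theorem FiberedChart.eq_of_vert_eq (ψ : FiberedChart n m π) {y : Y} (hy : y ∈ ψ.tot.source)
    {v w : TangentSpace 𝓘(ℝ, Eu n × Eu m) y}
    (hv : mfderiv 𝓘(ℝ, Eu n × Eu m) 𝓘(ℝ, Eu n) π y v = 0)
    (hw : mfderiv 𝓘(ℝ, Eu n × Eu m) 𝓘(ℝ, Eu n) π y w = 0)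
    (h : ψ.vert ⟨y, v⟩ = ψ.vert ⟨y, w⟩) : v = w := by
  have hπ := (ψ.contMDiffAt_proj hy).mdifferentiableAt (by simp)
  have hb : MDifferentiableAt 𝓘(ℝ, Eu n) 𝓘(ℝ, Eu n) ψ.base (π y) :=
    (contMDiffAt_of_mem_maximalAtlas ψ.base_mem (ψ.mapsTo y hy)).mdifferentiableAt (by simp)
  have e : (Prod.fst ∘ ψ.tot) =ᶠ[𝓝 y] ψ.base ∘ π := by
    filter_upwards [ψ.tot.open_source.mem_nhds hy] with z hz using ψ.fst_eq z hz
  have hf : MDifferentiableAt 𝓘(ℝ, Eu n × Eu m) 𝓘(ℝ, Eu n)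
      (Prod.fst : Eu n × Eu m → Eu n) (ψ.tot y) :=
    (contDiff_fst (𝕜 := ℝ) (n := 1)).contMDiff.mdifferentiableAt (by simp)
  have h1 := e.mfderiv_eq (I := 𝓘(ℝ, Eu n × Eu m)) (I' := 𝓘(ℝ, Eu n))
  rw [mfderiv_comp _ hf (ψ.mdifferentiableAt_tot hy), mfderiv_comp _ hb hπ,
    mfderiv_eq_fderiv, fderiv_fst] at h1
  have key : ∀ v : TangentSpace 𝓘(ℝ, Eu n × Eu m) y,
      mfderiv 𝓘(ℝ, Eu n × Eu m) 𝓘(ℝ, Eu n) π y v = 0 →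
      (show Eu n × Eu m from
        mfderiv 𝓘(ℝ, Eu n × Eu m) 𝓘(ℝ, Eu n × Eu m) ψ.tot y v).1 = 0 := by
    intro v hv
    have h2 := DFunLike.congr_fun h1 v
    have h3 : mfderiv 𝓘(ℝ, Eu n) 𝓘(ℝ, Eu n) ψ.base (π y)
        (mfderiv 𝓘(ℝ, Eu n × Eu m) 𝓘(ℝ, Eu n) π y v) = 0 := by rw [hv, map_zero]
    exact h2.trans h3
  have hmd : ψ.tot.MDifferentiable 𝓘(ℝ, Eu n × Eu m) 𝓘(ℝ, Eu n × Eu m) :=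
    ⟨(contMDiffOn_of_mem_maximalAtlas ψ.tot_mem).mdifferentiableOn (by simp),
      (contMDiffOn_symm_of_mem_maximalAtlas ψ.tot_mem).mdifferentiableOn (by simp)⟩
  refine (hmd.mfderiv_injective hy) ?_
  exact Prod.ext ((key v hv).trans (key w hw).symm) h

end Vertical

/-! ### Flows -/

section Flows

variable {n m : ℕ} {X Y : Type*} [TopologicalSpace X]
  [TopologicalSpace Y] [ChartedSpace (Eu n × Eu m) Y]

/-- A smooth one-parameter family `e` of fibre-preserving maps of `Y` with `e 0 = id` that fixes the
fibres over points outside the interior of `D`, and whose velocity at the parameter `0` is the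
vector field `Ξ`. It is not required to be a one-parameter group: only the velocity at `0`
matters. -/
structure IsFlow (π : Y → X) (D : Set X) (ε : ℝ) (e : ℝ → Y → Y)
    (Ξ : ∀ y : Y, TangentSpace 𝓘(ℝ, Eu n × Eu m) y) : Prop where
  pos : 0 < ε
  smooth : ContMDiffOn (𝓘(ℝ, ℝ).prod 𝓘(ℝ, Eu n × Eu m)) 𝓘(ℝ, Eu n × Eu m) ∞
    (fun q : ℝ × Y => e q.1 q.2) (Ioo (-ε) ε ×ˢ univ)
  proj : ∀ t ∈ Ioo (-ε) ε, ∀ y, π (e t y) = π y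
  zero_time : ∀ y, e 0 y = y
  fixed : ∀ t ∈ Ioo (-ε) ε, ∀ y, π y ∉ interior D → e t y = y
  velocity_eq : ∀ y, velocity (fun t => e t y) =
    (⟨y, Ξ y⟩ : TangentBundle 𝓘(ℝ, Eu n × Eu m) Y)

theorem mk_eq_of_eq {y y' : Y} (h : y' = y) {v v' : Eu n × Eu m} (hv : v' = v) :
    (⟨y', v'⟩ : TangentBundle 𝓘(ℝ, Eu n × Eu m) Y) = ⟨y, v⟩ := by
  subst h hv
  rfl

namespace IsFlow

variable {π : Y → X} {D : Set X} {ε : ℝ} {e : ℝ → Y → Y}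
  {Ξ : ∀ y : Y, TangentSpace 𝓘(ℝ, Eu n × Eu m) y}

theorem zero_mem (h : IsFlow π D ε e Ξ) : (0 : ℝ) ∈ Ioo (-ε) ε := ⟨neg_lt_zero.2 h.pos, h.pos⟩

theorem mono (h : IsFlow π D ε e Ξ) {ε' : ℝ} (h0 : 0 < ε') (hε : ε' ≤ ε) :
    IsFlow π D ε' e Ξ where
  pos := h0
  smooth := h.smooth.mono (prod_mono (Ioo_subset_Ioo (neg_le_neg hε) hε) subset_rfl)
  proj := fun t ht => h.proj t (Ioo_subset_Ioo (neg_le_neg hε) hε ht)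
  zero_time := h.zero_time
  fixed := fun t ht => h.fixed t (Ioo_subset_Ioo (neg_le_neg hε) hε ht)
  velocity_eq := h.velocity_eq

theorem contMDiffAt (h : IsFlow π D ε e Ξ) {t : ℝ} (ht : t ∈ Ioo (-ε) ε) (y : Y) :
    ContMDiffAt (𝓘(ℝ, ℝ).prod 𝓘(ℝ, Eu n × Eu m)) 𝓘(ℝ, Eu n × Eu m) ∞
      (fun q : ℝ × Y => e q.1 q.2) (t, y) :=
  h.smooth.contMDiffAt ((isOpen_Ioo.prod isOpen_univ).mem_nhds ⟨ht, mem_univ _⟩)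

theorem mdifferentiableAt_curve (h : IsFlow π D ε e Ξ) (y : Y) :
    MDifferentiableAt 𝓘(ℝ, ℝ) 𝓘(ℝ, Eu n × Eu m) (fun t => e t y) 0 :=
  (((h.contMDiffAt h.zero_mem y).comp (0 : ℝ)
    (contMDiffAt_id.prodMk contMDiffAt_const)).mdifferentiableAt (by simp))

theorem field_eq (h : IsFlow π D ε e Ξ) (y : Y) :
    mfderiv 𝓘(ℝ, ℝ) 𝓘(ℝ, Eu n × Eu m) (fun t => e t y) 0 (1 : ℝ) = Ξ y := by
  have := h.velocity_eq y
  have h2 := (Bundle.TotalSpace.mk.injEq _ _ _ _).mp this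
  exact eq_of_heq h2.2

theorem id (π : Y → X) (D : Set X) :
    IsFlow (n := n) (m := m) π D 1 (fun _ y => y) (fun _ => 0) where
  pos := one_pos
  smooth := contMDiff_snd.contMDiffOn
  proj := fun _ _ _ => rfl
  zero_time := fun _ => rfl
  fixed := fun _ _ _ _ => rfl
  velocity_eq := fun y => by
    unfold velocity
    rw [mfderiv_const]
    rfl

/-- The velocity of a composition of flows is the sum of the velocities. -/
theorem comp (h : IsFlow π D ε e Ξ) {e' : ℝ → Y → Y}
    {Ξ' : ∀ y : Y, TangentSpace 𝓘(ℝ, Eu n × Eu m) y} (h' : IsFlow π D ε e' Ξ') :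
    IsFlow π D ε (fun t y => e t (e' t y)) (fun y => Ξ y + Ξ' y) where
  pos := h.pos
  smooth := h.smooth.comp (contMDiffOn_fst.prodMk h'.smooth) fun q hq => ⟨hq.1, mem_univ _⟩
  proj := fun t ht y => (h.proj t ht _).trans (h'.proj t ht y)
  zero_time := fun y => by rw [h'.zero_time, h.zero_time]
  fixed := fun t ht y hy => by rw [h'.fixed t ht y hy, h.fixed t ht y hy]
  velocity_eq := fun y => by
    have h1 : MDifferentiableAt (𝓘(ℝ, ℝ).prod 𝓘(ℝ, Eu n × Eu m)) 𝓘(ℝ, Eu n × Eu m)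
        (fun q : ℝ × Y => e q.1 q.2) (0, e' 0 y) :=
      (h.contMDiffAt h.zero_mem _).mdifferentiableAt (by simp)
    have h2 : MDifferentiableAt 𝓘(ℝ, ℝ) (𝓘(ℝ, ℝ).prod 𝓘(ℝ, Eu n × Eu m))
        (fun t : ℝ => (t, e' t y)) 0 := mdifferentiableAt_id.prodMk (h'.mdifferentiableAt_curve y)
    have h3 := mfderiv_comp (0 : ℝ) h1 h2
    have h4 : mfderiv 𝓘(ℝ, ℝ) (𝓘(ℝ, ℝ).prod 𝓘(ℝ, Eu n × Eu m)) (fun t : ℝ => (t, e' t y)) 0 =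
        (mfderiv 𝓘(ℝ, ℝ) 𝓘(ℝ, ℝ) (fun t : ℝ => t) 0).prod
          (mfderiv 𝓘(ℝ, ℝ) 𝓘(ℝ, Eu n × Eu m) (fun t => e' t y) 0) :=
      mfderiv_prodMk mdifferentiableAt_id (h'.mdifferentiableAt_curve y)
    have h5 : mfderiv 𝓘(ℝ, ℝ) 𝓘(ℝ, ℝ) (fun t : ℝ => t) 0 = ContinuousLinearMap.id ℝ ℝ := mfderiv_id
    have h6 : mfderiv 𝓘(ℝ, Eu n × Eu m) 𝓘(ℝ, Eu n × Eu m) (e 0) (e' 0 y) =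
        ContinuousLinearMap.id ℝ (Eu n × Eu m) := by
      have : e 0 = _root_.id := funext h.zero_time
      rw [this]
      exact mfderiv_id
    have h7 : ∀ z, z = y → (mfderiv 𝓘(ℝ, ℝ) 𝓘(ℝ, Eu n × Eu m) (fun t => e t z) 0 (1 : ℝ) :
        Eu n × Eu m) = Ξ y := by
      rintro z rfl
      exact h.field_eq z
    have h8 : (mfderiv 𝓘(ℝ, ℝ) 𝓘(ℝ, Eu n × Eu m) (fun t => e t (e' t y)) 0 (1 : ℝ) :
        Eu n × Eu m) = Ξ y + Ξ' y := by
      refine (DFunLike.congr_fun h3 (1 : ℝ)).trans ?_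
      refine (congrArg (fun A : ℝ →L[ℝ] ℝ × (Eu n × Eu m) => (mfderiv (𝓘(ℝ, ℝ).prod
        𝓘(ℝ, Eu n × Eu m)) 𝓘(ℝ, Eu n × Eu m) (fun q : ℝ × Y => e q.1 q.2) (0, e' 0 y) (A 1) :
          Eu n × Eu m)) h4).trans ?_
      refine (mfderiv_prod_eq_add_apply h1).trans ?_
      refine congrArg₂ (fun a b : Eu n × Eu m => a + b) ?_ ?_
      · refine Eq.trans ?_ (h7 _ (h'.zero_time y))
        exact congrArg (fun A : ℝ →L[ℝ] ℝ => (mfderiv 𝓘(ℝ, ℝ) 𝓘(ℝ, Eu n × Eu m)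
          (fun t => e t (e' 0 y)) 0 (A 1) : Eu n × Eu m)) h5
      · refine (DFunLike.congr_fun h6 _).trans ?_
        exact h'.field_eq y
    exact mk_eq_of_eq ((h.zero_time _).trans (h'.zero_time y)) h8

theorem field_eq_zero (h : IsFlow π D ε e Ξ) {y : Y} (hy : ∀ᶠ t in 𝓝 (0 : ℝ), e t y = y) :
    Ξ y = 0 := by
  have h1 : (fun t => e t y) =ᶠ[𝓝 0] fun _ => y := hy
  have h2 : mfderiv 𝓘(ℝ, ℝ) 𝓘(ℝ, Eu n × Eu m) (fun _ : ℝ => y) 0 = 0 := mfderiv_const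
  exact (h.field_eq y).symm.trans ((DFunLike.congr_fun h1.mfderiv_eq (1 : ℝ)).trans
    (DFunLike.congr_fun h2 (1 : ℝ)))

theorem field_eq_zero_of_notMem (h : IsFlow π D ε e Ξ) {y : Y} (hy : π y ∉ interior D) :
    Ξ y = 0 :=
  h.field_eq_zero (by
    filter_upwards [isOpen_Ioo.mem_nhds h.zero_mem] with t ht using h.fixed t ht y hy)

theorem vertical [ChartedSpace (Eu n) X] (h : IsFlow π D ε e Ξ) {y : Y}
    (hπ : MDifferentiableAt 𝓘(ℝ, Eu n × Eu m) 𝓘(ℝ, Eu n) π y) :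
    mfderiv 𝓘(ℝ, Eu n × Eu m) 𝓘(ℝ, Eu n) π y (Ξ y) = 0 := by
  have key : ∀ z, z = y → e 0 y = z →
      (mfderiv 𝓘(ℝ, Eu n × Eu m) 𝓘(ℝ, Eu n) π z : (Eu n × Eu m) → Eu n)
        (mfderiv 𝓘(ℝ, ℝ) 𝓘(ℝ, Eu n × Eu m) (fun t => e t y) 0 (1 : ℝ)) = 0 := by
    rintro _ hz rfl
    have hπ' : MDifferentiableAt 𝓘(ℝ, Eu n × Eu m) 𝓘(ℝ, Eu n) π (e 0 y) := by rwa [hz]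
    have h1 := mfderiv_comp (0 : ℝ) hπ' (h.mdifferentiableAt_curve y)
    have h2 : π ∘ (fun t => e t y) =ᶠ[𝓝 0] fun _ => π y := by
      filter_upwards [isOpen_Ioo.mem_nhds h.zero_mem] with t ht using h.proj t ht y
    have h3 : mfderiv 𝓘(ℝ, ℝ) 𝓘(ℝ, Eu n) (fun _ : ℝ => π y) 0 = 0 := mfderiv_const
    exact (DFunLike.congr_fun h1 (1 : ℝ)).symm.trans
      ((DFunLike.congr_fun h2.mfderiv_eq (1 : ℝ)).trans (DFunLike.congr_fun h3 (1 : ℝ)))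
  refine Eq.trans ?_ (key y rfl (h.zero_time y))
  exact congrArg (fun v : Eu n × Eu m =>
    (mfderiv 𝓘(ℝ, Eu n × Eu m) 𝓘(ℝ, Eu n) π y : (Eu n × Eu m) → Eu n) v) (h.field_eq y).symm

/-- The velocity of a smooth flow is a smooth vector field: it is the value of the tangent map of
the flow on `∂/∂t`. -/
theorem contMDiff_field [IsManifold 𝓘(ℝ, Eu n × Eu m) ∞ Y] (h : IsFlow π D ε e Ξ) :
    ContMDiff 𝓘(ℝ, Eu n × Eu m) (𝓘(ℝ, Eu n × Eu m).tangent) ∞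
      (fun y => (⟨y, Ξ y⟩ : TangentBundle 𝓘(ℝ, Eu n × Eu m) Y)) := by
  have ho : IsOpen (Ioo (-ε) ε ×ˢ (univ : Set Y)) := isOpen_Ioo.prod isOpen_univ
  have h1 := h.smooth.contMDiffOn_tangentMapWithin (m := ∞) le_rfl ho.uniqueMDiffOn
  have h2 : ContMDiff 𝓘(ℝ, Eu n × Eu m) (𝓘(ℝ, Eu n × Eu m).tangent) ∞
      (fun y : Y => (⟨y, 0⟩ : TangentBundle 𝓘(ℝ, Eu n × Eu m) Y)) :=
    Bundle.contMDiff_zeroSection ℝ (TangentSpace 𝓘(ℝ, Eu n × Eu m) (M := Y))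
  have h3 : ContMDiff 𝓘(ℝ, Eu n × Eu m) ((𝓘(ℝ, ℝ).prod 𝓘(ℝ, Eu n × Eu m)).tangent) ∞
      (fun y : Y => (equivTangentBundleProd 𝓘(ℝ, ℝ) ℝ 𝓘(ℝ, Eu n × Eu m) Y).symm
        ((⟨0, (1 : ℝ)⟩ : TangentBundle 𝓘(ℝ, ℝ) ℝ), ⟨y, 0⟩)) :=
    contMDiff_equivTangentBundleProd_symm.comp (contMDiff_const.prodMk h2)
  have h4 := h1.comp_contMDiff h3 fun y => ⟨h.zero_mem, mem_univ y⟩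
  refine h4.congr fun y => ?_
  have hd : MDifferentiableAt (𝓘(ℝ, ℝ).prod 𝓘(ℝ, Eu n × Eu m)) 𝓘(ℝ, Eu n × Eu m)
      (fun q : ℝ × Y => e q.1 q.2) (0, y) :=
    (h.contMDiffAt h.zero_mem y).mdifferentiableAt (by simp)
  rw [Function.comp_apply, tangentMapWithin_eq_tangentMap (ho.uniqueMDiffOn _
    ⟨h.zero_mem, mem_univ y⟩) hd]
  refine (mk_eq_of_eq (h.zero_time y) ?_).symm
  refine (mfderiv_prod_eq_add_apply hd).trans ?_
  refine Eq.trans (congrArg₂ (fun a b : Eu n × Eu m => a + b) (h.field_eq y)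
    (map_zero (mfderiv 𝓘(ℝ, Eu n × Eu m) 𝓘(ℝ, Eu n × Eu m) (e 0) y))) (add_zero _)

end IsFlow

theorem exists_isFlow_sum {ι : Type*} (s : Finset ι) {π : Y → X} {D : Set X}
    {Ξ : ι → ∀ y : Y, TangentSpace 𝓘(ℝ, Eu n × Eu m) y}
    (h : ∀ c ∈ s, ∃ ε e, IsFlow π D ε e (Ξ c)) :
    ∃ ε e, IsFlow π D ε e (fun y => ∑ c ∈ s, Ξ c y) := by
  classical
  induction s using Finset.induction_on with
  | empty => exact ⟨1, _, by simpa using IsFlow.id (n := n) (m := m) π D⟩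
  | insert c s hc ih =>
    obtain ⟨ε, e, he⟩ := h c (Finset.mem_insert_self c s)
    obtain ⟨ε', e', he'⟩ := ih fun c' hc' => h c' (Finset.mem_insert_of_mem hc')
    refine ⟨min ε ε', fun t y => e t (e' t y), ?_⟩
    simp only [Finset.sum_insert hc]
    exact (he.mono (lt_min he.pos he'.pos) (min_le_left _ _)).comp
      (he'.mono (lt_min he.pos he'.pos) (min_le_right _ _))

variable [ChartedSpace (Eu n) X]

open Classical in
/-- The displacement by `t • W` along the fibres, in a fibered chart. -/
def FiberedChart.shift {π : Y → X} (ψ : FiberedChart n m π) (W : Y → Eu m) (t : ℝ) (y : Y) : Y :=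
  if y ∈ ψ.tot.source then ψ.tot.symm (ψ.tot y + (0, t • W y)) else y

theorem FiberedChart.shift_eq_self {π : Y → X} (ψ : FiberedChart n m π) {W : Y → Eu m} {t : ℝ}
    {y : Y} (h : t • W y = 0) : ψ.shift W t y = y := by
  unfold FiberedChart.shift
  split_ifs with hy
  · rw [h, Prod.mk_zero_zero, add_zero, ψ.tot.left_inv hy]
  · rfl

/-- A vertical field with compact support in a fibered chart is the velocity of a flow. -/
theorem FiberedChart.exists_isFlow {π : Y → X} (ψ : FiberedChart n m π) {D : Set X}
    {W : Y → Eu m} (hW : ContMDiff 𝓘(ℝ, Eu n × Eu m) 𝓘(ℝ, Eu m) ∞ W)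
    (hc : HasCompactSupport W) (hs : tsupport W ⊆ ψ.tot.source)
    (hD : ∀ y, π y ∉ interior D → W y = 0) :
    ∃ ε e Ξ, IsFlow π D ε e Ξ ∧ (∀ y ∈ ψ.tot.source, ψ.vert ⟨y, Ξ y⟩ = W y) ∧
      ∀ y, W y = 0 → Ξ y = 0 := by
  have hev : ∀ᶠ t in 𝓝 (0 : ℝ), ∀ y ∈ tsupport W, ψ.tot y + (0, t • W y) ∈ ψ.tot.target := by
    refine hc.eventually_forall_of_forall_eventually fun y hy => ?_
    have h1 : ContinuousAt (fun q : ℝ × Y => ψ.tot q.2 + (0, q.1 • W q.2)) (0, y) :=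
      ((ψ.tot.continuousAt (hs hy)).comp (x := ((0 : ℝ), y)) continuousAt_snd).add
        (continuousAt_const.prodMk
          (continuousAt_fst.smul (hW.continuous.continuousAt.comp continuousAt_snd)))
    refine h1.eventually_mem (ψ.tot.open_target.mem_nhds ?_)
    simpa only [zero_smul, Prod.mk_zero_zero, add_zero] using ψ.tot.map_source (hs hy)
  obtain ⟨ε, hε, hball⟩ := Metric.eventually_nhds_iff.1 hev
  have hmem : ∀ t ∈ Ioo (-ε) ε, ∀ y ∈ ψ.tot.source,
      ψ.tot y + (0, t • W y) ∈ ψ.tot.target := by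
    intro t ht y hy
    by_cases hyW : y ∈ tsupport W
    · exact hball (by simpa [abs_lt] using ht) y hyW
    · rw [image_eq_zero_of_notMem_tsupport hyW, smul_zero, Prod.mk_zero_zero, add_zero]
      exact ψ.tot.map_source hy
  have hsm : ContMDiffOn (𝓘(ℝ, ℝ).prod 𝓘(ℝ, Eu n × Eu m)) 𝓘(ℝ, Eu n × Eu m) ∞
      (fun q : ℝ × Y => ψ.shift W q.1 q.2) (Ioo (-ε) ε ×ˢ univ) := by
    rintro ⟨t, y⟩ ⟨ht, -⟩
    refine ContMDiffAt.contMDiffWithinAt ?_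
    by_cases hy : y ∈ tsupport W
    · have h1 : ContMDiffAt (𝓘(ℝ, ℝ).prod 𝓘(ℝ, Eu n × Eu m)) 𝓘(ℝ, Eu n × Eu m) ∞
          (fun q : ℝ × Y => ψ.tot q.2 + (0, q.1 • W q.2)) (t, y) := by
        refine ContMDiffAt.add ((contMDiffAt_of_mem_maximalAtlas ψ.tot_mem (hs hy)).comp (t, y)
          contMDiffAt_snd) ?_
        exact ((ContinuousLinearMap.inr ℝ (Eu n) (Eu m)).contDiff.contMDiff.contMDiffAt).comp
          (t, y) (contMDiffAt_fst.smul (hW.contMDiffAt.comp (t, y) contMDiffAt_snd))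
      refine ((contMDiffAt_symm_of_mem_maximalAtlas ψ.tot_mem (hmem t ht y (hs hy))).comp (t, y)
        h1).congr_of_eventuallyEq ?_
      filter_upwards [(isOpen_univ.prod ψ.tot.open_source).mem_nhds
        (⟨mem_univ t, hs hy⟩ : ((t, y) : ℝ × Y) ∈ univ ×ˢ ψ.tot.source)] with q hq
      exact if_pos hq.2
    · refine contMDiffAt_snd.congr_of_eventuallyEq ?_
      filter_upwards [(isOpen_univ.prod (isClosed_tsupport W).isOpen_compl).mem_nhds
        (⟨mem_univ t, hy⟩ : ((t, y) : ℝ × Y) ∈ univ ×ˢ (tsupport W)ᶜ)] with q hq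
      exact ψ.shift_eq_self (by rw [image_eq_zero_of_notMem_tsupport hq.2, smul_zero])
  have h0 : ∀ y, ψ.shift W 0 y = y := fun y => ψ.shift_eq_self (zero_smul ℝ _)
  have hflow : IsFlow π D ε (ψ.shift W)
      (fun y => (mfderiv 𝓘(ℝ, ℝ) 𝓘(ℝ, Eu n × Eu m) (fun t => ψ.shift W t y) 0 (1 : ℝ) :
        Eu n × Eu m)) :=
    { pos := hε
      smooth := hsm
      proj := fun t ht y => by
        by_cases hy : y ∈ ψ.tot.source
        · have h1 := hmem t ht y hy
          have h2 := (ψ.base_mem_target h1).1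
          have h3 : ψ.shift W t y = ψ.tot.symm (ψ.tot y + (0, t • W y)) := if_pos hy
          rw [h3]
          refine ψ.base.injOn (ψ.mapsTo _ (ψ.tot.map_target h1)) (ψ.mapsTo y hy) ?_
          rw [← h2, ← ψ.fst_eq y hy, Prod.fst_add, add_zero]
        · exact congrArg π (if_neg hy)
      zero_time := h0
      fixed := fun t _ y hy => ψ.shift_eq_self (by rw [hD y hy, smul_zero])
      velocity_eq := fun y => mk_eq_of_eq (h0 y) rfl }
  refine ⟨ε, ψ.shift W, _, hflow, fun y hy => ?_, fun y hy => hflow.field_eq_zero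
    (Eventually.of_forall fun t => ψ.shift_eq_self (by rw [hy, smul_zero]))⟩
  rw [← hflow.velocity_eq y, ψ.vert_velocity (hflow.mdifferentiableAt_curve y) (by rwa [h0])]
  have h1 : (fun t => (ψ.tot (ψ.shift W t y)).2) =ᶠ[𝓝 0] fun t => (ψ.tot y).2 + t • W y := by
    filter_upwards [isOpen_Ioo.mem_nhds hflow.zero_mem] with t ht
    have h3 : ψ.shift W t y = ψ.tot.symm (ψ.tot y + (0, t • W y)) := if_pos hy
    rw [h3, ψ.tot.right_inv (hmem t ht y hy)]
    rfl
  have h2 := ((hasDerivAt_id (0 : ℝ)).smul_const (W y)).const_add (ψ.tot y).2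
  rw [h1.deriv_eq]
  exact h2.deriv.trans (one_smul ℝ _)

end Flows


/-! ### Extensions and variations -/

section Extensions

variable {n m : ℕ} {X Y : Type*}
  [TopologicalSpace X] [ChartedSpace (Eu n) X]
  [TopologicalSpace Y] [ChartedSpace (Eu n × Eu m) Y] {π : Y → X} {D : Set X} {γ : X → Y}

theorem IsFlow.contMDiffOn_comp {ε : ℝ} {e : ℝ → Y → Y}
    {Ξ : ∀ y : Y, TangentSpace 𝓘(ℝ, Eu n × Eu m) y} (h : IsFlow π D ε e Ξ) {U : Set X}
    (hγ : IsSectionOn n m π γ U) :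
    ContMDiffOn (𝓘(ℝ, ℝ).prod 𝓘(ℝ, Eu n)) 𝓘(ℝ, Eu n × Eu m) ∞
      (fun q : ℝ × X => e q.1 (γ q.2)) (Ioo (-ε) ε ×ˢ U) :=
  h.smooth.comp (contMDiffOn_fst.prodMk (hγ.2.1.comp contMDiffOn_snd fun _ hq => hq.2))
    fun _ hq => ⟨hq.1, mem_univ _⟩

theorem IsFlow.isVariation₂ {ε : ℝ} {e₁ e₂ : ℝ → Y → Y}
    {Ξ₁ Ξ₂ : ∀ y : Y, TangentSpace 𝓘(ℝ, Eu n × Eu m) y} (h₁ : IsFlow π D ε e₁ Ξ₁)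
    (h₂ : IsFlow π D ε e₂ Ξ₂) {U : Set X} (hγ : IsSectionOn n m π γ U) (hDU : D ⊆ U) :
    IsVariation₂ n m π D γ Ξ₁ Ξ₂ fun t₁ t₂ x => e₂ t₂ (e₁ t₁ (γ x)) := by
  refine ⟨ε, h₁.pos, U, hγ.1, hDU, ?_, fun t₁ ht₁ t₂ ht₂ x hx => ?_, fun x _ => ?_,
    fun x _ => ?_, fun t₁ _ x _ => ?_⟩
  · have a1 : ContMDiffOn ((𝓘(ℝ, ℝ).prod 𝓘(ℝ, ℝ)).prod 𝓘(ℝ, Eu n)) 𝓘(ℝ, Eu n × Eu m) ∞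
        (fun q : (ℝ × ℝ) × X => e₁ q.1.1 (γ q.2)) ((Ioo (-ε) ε ×ˢ Ioo (-ε) ε) ×ˢ U) :=
      (h₁.contMDiffOn_comp hγ).comp ((contMDiff_fst.comp contMDiff_fst).prodMk
        contMDiff_snd).contMDiffOn fun q hq => ⟨hq.1.1, hq.2⟩
    exact h₂.smooth.comp ((contMDiff_snd.comp contMDiff_fst).contMDiffOn.prodMk a1)
      fun q hq => ⟨hq.1.2, mem_univ _⟩
  · rw [h₂.proj t₂ ht₂, h₁.proj t₁ ht₁, hγ.2.2 x hx]
  · simp only [h₁.zero_time, h₂.zero_time]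
  · simp only [h₂.zero_time]
    exact h₁.velocity_eq (γ x)
  · exact (h₂.velocity_eq _).trans (congrArg
      (fun z => (⟨z, Ξ₂ z⟩ : TangentBundle 𝓘(ℝ, Eu n × Eu m) Y)) (h₂.zero_time _).symm)

variable [IsManifold 𝓘(ℝ, Eu n × Eu m) ∞ Y]

/-- A field along a section with compact support in a fibered chart extends to the velocity of a
flow. -/
theorem FiberedChart.exists_isFlow_along [T2Space Y] [SigmaCompactSpace Y]
    (ψ : FiberedChart n m π) {U : Set X} (hγ : IsSectionOn n m π γ U) {η : Eu n → Eu m}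
    (hη : ContDiff ℝ ∞ η) (hc : HasCompactSupport η) (hs : tsupport η ⊆ ψ.repSet γ U)
    (hD : ∀ u ∈ ψ.repSet γ U, ψ.base.symm u ∉ interior D → η u = 0) :
    ∃ ε e Ξ, IsFlow (n := n) (m := m) π D ε e Ξ ∧
      (∀ x ∈ U, γ x ∈ ψ.tot.source → ψ.vert ⟨γ x, Ξ (γ x)⟩ = η (ψ.base x)) ∧
      ∀ x ∈ U, (γ x ∈ ψ.tot.source → η (ψ.base x) = 0) → Ξ (γ x) = 0 := by
  classical
  have := ChartedSpace.locallyCompactSpace (Eu n × Eu m) Y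
  set C : Set Y := (fun u => γ (ψ.base.symm u)) '' tsupport η with hC
  have hCc : IsCompact C := by
    refine hc.isCompact.image_of_continuousOn ?_
    exact hγ.2.1.continuousOn.comp (ψ.base.continuousOn_symm.mono fun u hu => (hs hu).1)
      fun u hu => (hs hu).2.1
  have hCs : C ⊆ ψ.tot.source := by
    rintro _ ⟨u, hu, rfl⟩
    exact (hs hu).2.2
  obtain ⟨L, hL, hCL, hLs⟩ := exists_compact_between hCc ψ.tot.open_source hCs
  obtain ⟨θ, hθ0, hθ1, -⟩ := exists_contMDiffMap_zero_one_of_isClosed (n := (⊤ : ℕ∞))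
    𝓘(ℝ, Eu n × Eu m) isOpen_interior.isClosed_compl hCc.isClosed
    (disjoint_left.2 fun y hy hyC => hy (hCL hyC))
  -- The components `η` are taken constant along the fibres, and cut off by `θ`, which is `1` on the
  -- image of the support of `η` under `γ`.
  set W : Y → Eu m := fun y => if y ∈ ψ.tot.source then θ y • η (ψ.tot y).1 else 0 with hW
  have hWL : ∀ y, y ∉ L → W y = 0 := by
    intro y hy
    have : θ y = 0 := hθ0 fun h => hy (interior_subset h)
    simp only [hW, this, zero_smul, ite_self]
  have hWsupp : tsupport W ⊆ L := closure_minimal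
    (fun y hy => by_contra fun h => hy (hWL y h)) hL.isClosed
  have hWsm : ContMDiff 𝓘(ℝ, Eu n × Eu m) 𝓘(ℝ, Eu m) ∞ W := by
    intro y
    by_cases hy : y ∈ L
    · have h1 : ContMDiffAt 𝓘(ℝ, Eu n × Eu m) 𝓘(ℝ, Eu m) ∞ (fun y => θ y • η (ψ.tot y).1) y :=
        θ.contMDiff.contMDiffAt.smul ((hη.comp contDiff_fst).contMDiff.contMDiffAt.comp y
          (contMDiffAt_of_mem_maximalAtlas ψ.tot_mem (hLs hy)))
      refine h1.congr_of_eventuallyEq ?_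
      filter_upwards [ψ.tot.open_source.mem_nhds (hLs hy)] with z hz
      exact if_pos hz
    · refine (contMDiffAt_const (c := (0 : Eu m))).congr_of_eventuallyEq ?_
      filter_upwards [hL.isClosed.isOpen_compl.mem_nhds hy] with z hz using hWL z hz
  have hWγ : ∀ x ∈ U, γ x ∈ ψ.tot.source → W (γ x) = η (ψ.base x) := by
    intro x hx hxs
    have hb := ψ.mem_base (hγ.2.2 x hx) hxs
    simp only [hW, if_pos hxs, ψ.tot_eq (hγ.2.2 x hx) hxs]
    by_cases hu : ψ.base x ∈ tsupport η
    · have : θ (γ x) = 1 := hθ1 ⟨ψ.base x, hu, by simp only [ψ.base.left_inv hb]⟩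
      rw [this, one_smul]
    · rw [image_eq_zero_of_notMem_tsupport hu, smul_zero]
  have hWD : ∀ y, π y ∉ interior D → W y = 0 := by
    intro y hy
    by_contra hne
    by_cases hys : y ∈ ψ.tot.source
    · simp only [hW, if_pos hys, ψ.fst_eq y hys] at hne
      have h1 : η (ψ.base (π y)) ≠ 0 := fun h => hne (by rw [h, smul_zero])
      have h2 := hs (subset_tsupport η h1)
      exact h1 (hD _ h2 (by rwa [ψ.base.left_inv (ψ.mapsTo y hys)]))
    · exact hne (if_neg hys)
  obtain ⟨ε, e, Ξ, he, hv, h0⟩ := ψ.exists_isFlow hWsm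
    (hL.of_isClosed_subset (isClosed_tsupport W) hWsupp) (hWsupp.trans hLs) hWD
  refine ⟨ε, e, Ξ, he, fun x hx hxs => (hv _ hxs).trans (hWγ x hx hxs), fun x hx h => h0 _ ?_⟩
  by_cases hxs : γ x ∈ ψ.tot.source
  · rw [hWγ x hx hxs, h hxs]
  · exact if_neg hxs

/-- The components in a fibered chart of a field along a section. -/
def TangentField.comp (ν : TangentField n m π D γ) (ψ : FiberedChart n m π) (u : Eu n) : Eu m :=
  ψ.vert ⟨γ (ψ.base.symm u), ν.toFun (ψ.base.symm u)⟩

theorem TangentField.comp_eq_zero (ν : TangentField n m π D γ) (ψ : FiberedChart n m π) {u : Eu n}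
    (hu : ψ.base.symm u ∉ interior D) : ν.comp ψ u = 0 := by
  rw [TangentField.comp, ν.zero _ hu, ψ.vert_zero]

/-- A section over a neighbourhood of `D` on which a given field along it is smooth. -/
theorem TangentField.exists_contDiffOn_comp (ν : TangentField n m π D γ) {U : Set X}
    (hγ : IsSectionOn n m π γ U) (hDU : D ⊆ U) :
    ∃ U', IsSectionOn n m π γ U' ∧ D ⊆ U' ∧
      ∀ ψ : FiberedChart n m π, ContDiffOn ℝ ∞ (ν.comp ψ) (ψ.repSet γ U') := by
  obtain ⟨V, hV, hDV, hν⟩ := ν.smooth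
  refine ⟨U ∩ V, ⟨hγ.1.inter hV, hγ.2.1.mono inter_subset_left, fun x hx => hγ.2.2 x hx.1⟩,
    subset_inter hDU hDV, fun ψ => ?_⟩
  have h1 := hν.comp ((contMDiffOn_symm_of_mem_maximalAtlas ψ.base_mem).mono
    (s := ψ.base.target) (t := ψ.repSet γ (U ∩ V)) fun u hu => hu.1) fun u hu => hu.2.1.2
  exact (ψ.contMDiffOn_vert h1 fun u hu => hu.2.2).contDiffOn

theorem IsFibered.contMDiff (hπ : IsFibered n m π) :
    ContMDiff 𝓘(ℝ, Eu n × Eu m) 𝓘(ℝ, Eu n) ∞ π := fun y => by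
  obtain ⟨ψ, hψ⟩ := exists_fiberedChart hπ y
  exact ψ.contMDiffAt_proj hψ

theorem IsFibered.mdifferentiableAt (hπ : IsFibered n m π) (y : Y) :
    MDifferentiableAt 𝓘(ℝ, Eu n × Eu m) 𝓘(ℝ, Eu n) π y :=
  (hπ.contMDiff y).mdifferentiableAt (by simp)

/-- A field along a section is decomposed by a partition of unity into fields with support in
fibered charts, each of which extends to the velocity of a flow. -/
theorem TangentField.exists_isFlow [IsManifold 𝓘(ℝ, Eu n) ∞ X] [T2Space X]
    [SigmaCompactSpace X] [T2Space Y] [SigmaCompactSpace Y] (hπ : IsFibered n m π)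
    (hD : IsCompact D) {U : Set X} (hγ : IsSectionOn n m π γ U) (hDU : D ⊆ U)
    (ν : TangentField n m π D γ) :
    ∃ ε e Ξ, IsFlow (n := n) (m := m) π D ε e Ξ ∧ ∀ x ∈ D, Ξ (γ x) = ν.toFun x := by
  obtain ⟨U', hγ', hDU', hν⟩ := ν.exists_contDiffOn_comp hγ hDU
  obtain ⟨F, hF⟩ := exists_chartFamily hπ hD hγ' hDU'
  have hsec : ∀ x ∈ D, π (γ x) = x := fun x hx => hγ'.2.2 x (hDU' hx)
  have key : ∀ c ∈ F.s, ∃ Ξ, (∃ ε e, IsFlow (n := n) (m := m) π D ε e Ξ) ∧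
      ∀ x ∈ D, Ξ (γ x) = F.χ c x • ν.toFun x := by
    intro c hc
    have hsub := hF.subset_source hsec hc
    have hKV := hF.K_subset hγ' hDU' hc
    set ψ := F.ψ c
    obtain ⟨ε, e, Ξ, he, hv, h0⟩ := ψ.exists_isFlow_along (D := D) hγ'
      (η := cutoff ψ.base (F.χ c) D (fun _ => 1) (ν.comp ψ))
      (contDiff_cutoff ψ.base_mem (F.smooth c) hD hsub
        (fun _ _ => Eventually.of_forall fun _ => rfl)
        (ψ.isOpen_repSet hγ') hKV (hν ψ)
        fun u _ hu => ν.comp_eq_zero ψ fun h => hu (interior_subset h))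
      (hasCompactSupport_cutoff hD hsub _ _) ((tsupport_cutoff_subset hD hsub _ _).trans hKV)
      (fun u _ hu => by
        by_cases huK : u ∈ ψ.base '' (tsupport (F.χ c) ∩ D)
        · rw [cutoff_apply huK, ν.comp_eq_zero ψ hu, smul_zero]
        · exact indicator_of_notMem huK _)
    refine ⟨Ξ, ⟨ε, e, he⟩, fun x hx => ?_⟩
    by_cases hxt : x ∈ tsupport (F.χ c)
    · have hxs := hF c hc x ⟨hxt, hx⟩
      have hb := hsub ⟨hxt, hx⟩
      refine ψ.eq_of_vert_eq hxs (he.vertical (hπ.mdifferentiableAt _)) ?_ ?_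
      · rw [map_smul, ν.vertical x hx, smul_zero]
      · rw [hv x (hDU' hx) hxs, cutoff_apply ⟨x, ⟨hxt, hx⟩, rfl⟩, ψ.vert_smul, one_mul,
          TangentField.comp, ψ.base.left_inv hb]
    · rw [image_eq_zero_of_notMem_tsupport hxt, zero_smul]
      refine h0 x (hDU' hx) fun hxs => indicator_of_notMem ?_ _
      rintro ⟨z, hz, hzx⟩
      have := ψ.base.injOn (hsub hz) (ψ.mem_base (hsec x hx) hxs) hzx
      exact hxt (this ▸ hz.1)
  choose! Ξ he hΞ using key
  obtain ⟨ε', e', he'⟩ := exists_isFlow_sum F.s he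
  refine ⟨ε', e', _, he', fun x hx => ?_⟩
  rw [Finset.sum_congr rfl fun c hc => hΞ c hc x hx, ← Finset.sum_smul, F.sum_eq x hx, one_smul]

theorem IsFlow.isExtension (hπ : IsFibered n m π) {ε : ℝ} {e : ℝ → Y → Y}
    {Ξ : ∀ y : Y, TangentSpace 𝓘(ℝ, Eu n × Eu m) y} (h : IsFlow π D ε e Ξ)
    {ν : TangentField n m π D γ} (hν : ∀ x ∈ D, Ξ (γ x) = ν.toFun x) : IsExtension Ξ ν where
  smooth := h.contMDiff_field
  vertical := fun y => h.vertical (hπ.mdifferentiableAt y)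
  zero := fun _ hy => h.field_eq_zero_of_notMem hy
  extends_field := hν

theorem IsFlow.isVariation {ε : ℝ} {e : ℝ → Y → Y}
    {Ξ : ∀ y : Y, TangentSpace 𝓘(ℝ, Eu n × Eu m) y} (h : IsFlow π D ε e Ξ) {U : Set X}
    (hγ : IsSectionOn n m π γ U) (hDU : D ⊆ U) {ν : TangentField n m π D γ}
    (hν : ∀ x ∈ D, Ξ (γ x) = ν.toFun x) : IsVariation ν fun t x => e t (γ x) := by
  refine ⟨ε, h.pos, U, hγ.1, hDU, h.contMDiffOn_comp hγ, fun t ht x hx => ?_,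
    fun x _ => h.zero_time _, fun x hx => ?_⟩
  · rw [h.proj t ht, hγ.2.2 x hx]
  · refine (h.velocity_eq (γ x)).trans ?_
    by_cases hxD : x ∈ D
    · rw [hν x hxD]
    · have hxi : x ∉ interior D := fun h => hxD (interior_subset h)
      rw [ν.zero x hxi, h.field_eq_zero_of_notMem (by rwa [hγ.2.2 x hx])]

open Classical in
/-- Fields along `γ` with prescribed components in a fibered chart. -/
theorem FiberedChart.exists_tangentField [T2Space Y] [SigmaCompactSpace Y]
    (hπ : IsFibered n m π) (ψ : FiberedChart n m π)
    {U : Set X} (hγ : IsSectionOn n m π γ U) (hDU : D ⊆ U) {η : Eu n → Eu m}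
    (hη : ContDiff ℝ ∞ η) (hc : HasCompactSupport η) (hs : tsupport η ⊆ ψ.repSet γ U)
    (hD : ∀ u ∈ ψ.repSet γ U, ψ.base.symm u ∉ interior D → η u = 0) :
    ∃ κ : TangentField n m π D γ,
      (∀ x ∈ D, γ x ∈ ψ.tot.source → ψ.vert ⟨γ x, κ.toFun x⟩ = η (ψ.base x)) ∧
      ∀ x ∈ D, (γ x ∈ ψ.tot.source → η (ψ.base x) = 0) → κ.toFun x = 0 := by
  obtain ⟨ε, e, Ξ, he, hv, h0⟩ := ψ.exists_isFlow_along (D := D) hγ hη hc hs hD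
  have heq : ∀ x ∈ U, (if x ∈ interior D then Ξ (γ x) else 0) = Ξ (γ x) := by
    intro x hx
    split_ifs with hxi
    · rfl
    · exact (he.field_eq_zero_of_notMem (by rwa [hγ.2.2 x hx])).symm
  refine ⟨⟨fun x => if x ∈ interior D then Ξ (γ x) else 0, ⟨U, hγ.1, hDU, ?_⟩, ?_, ?_⟩, ?_, ?_⟩
  · refine (he.contMDiff_field.comp_contMDiffOn hγ.2.1).congr fun x hx => ?_
    simp only [heq x hx, Function.comp_apply]
  · intro x hx
    rw [heq x (hDU hx)]
    exact he.vertical (hπ.mdifferentiableAt _)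
  · exact fun x hx => if_neg hx
  · intro x hx hxs
    simp only [heq x (hDU hx)]
    exact hv x (hDU hx) hxs
  · intro x hx h
    simp only [heq x (hDU hx)]
    exact h0 x (hDU hx) h

end Extensions


/-! ### Extremals -/

section Extremals

variable {n m r : ℕ} {X Y : Type*}
  [TopologicalSpace X] [ChartedSpace (Eu n) X]
  [TopologicalSpace Y] [ChartedSpace (Eu n × Eu m) Y]
  {π : Y → X} {D : Set X} {γ : X → Y}

theorem FiberedChart.rep_eventuallyEq (ψ : FiberedChart n m π) {γ γ' : X → Y} {U : Set X}
    (hγ : IsSectionOn n m π γ U) (h : ∀ x ∈ U, γ' x = γ x) {u : Eu n} (hu : u ∈ ψ.repSet γ U) :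
    ψ.rep γ' =ᶠ[𝓝 u] ψ.rep γ := by
  filter_upwards [(ψ.isOpen_repSet hγ).mem_nhds hu] with v hv
  simp only [FiberedChart.rep, h _ hv.2.1]

theorem ChartFamily.Adapted.congr {F : ChartFamily n m π D} (hF : F.Adapted γ) {γ' : X → Y}
    (h : ∀ x ∈ D, γ' x = γ x) : F.Adapted γ' := fun c hc x hx => by
  rw [h x hx.2]
  exact hF c hc x hx

theorem mdifferentiableAt_curve {Γ : ℝ → X → Y} {ε : ℝ} {U : Set X} (hε : 0 < ε) (hU : IsOpen U)
    (hΓ : ContMDiffOn (𝓘(ℝ, ℝ).prod 𝓘(ℝ, Eu n)) 𝓘(ℝ, Eu n × Eu m) ∞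
      (fun q : ℝ × X => Γ q.1 q.2) (Ioo (-ε) ε ×ˢ U)) {x : X} (hx : x ∈ U) :
    MDifferentiableAt 𝓘(ℝ, ℝ) 𝓘(ℝ, Eu n × Eu m) (fun t => Γ t x) 0 := by
  have h1 := hΓ.contMDiffAt (x := ((0 : ℝ), x))
    ((isOpen_Ioo.prod hU).mem_nhds ⟨⟨neg_lt_zero.2 hε, hε⟩, hx⟩)
  exact (h1.comp (0 : ℝ) (contMDiffAt_id.prodMk contMDiffAt_const)).mdifferentiableAt (by simp)

theorem IsDeformation.of_velocity {Γ : ℝ → X → Y} {ε : ℝ} {U : Set X} (hε : 0 < ε)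
    (hU : IsOpen U) (hDU : D ⊆ U)
    (hΓ : ContMDiffOn (𝓘(ℝ, ℝ).prod 𝓘(ℝ, Eu n)) 𝓘(ℝ, Eu n × Eu m) ∞
      (fun q : ℝ × X => Γ q.1 q.2) (Ioo (-ε) ε ×ˢ U))
    (hs : ∀ t ∈ Ioo (-ε) ε, ∀ x ∈ U, π (Γ t x) = x)
    (h0 : ∀ x ∈ U, x ∉ D → ∃ y, velocity (fun t => Γ t x) =
      (⟨y, 0⟩ : TangentBundle 𝓘(ℝ, Eu n × Eu m) Y)) : IsDeformation n m π D ε U Γ where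
  pos := hε
  isOpen := hU
  subset := hDU
  smooth := hΓ
  isSection := hs
  zero := fun ψ x hx hxD hψ => by
    obtain ⟨y, hy⟩ := h0 x hx hxD
    rw [← ψ.vert_velocity (mdifferentiableAt_curve hε hU hΓ hx) hψ, hy, ψ.vert_zero]

theorem IsDeformation.repVel_eq {Γ : ℝ → X → Y} {ε : ℝ} {U : Set X}
    (h : IsDeformation n m π D ε U Γ) (ψ : FiberedChart n m π) {u : Eu n}
    (hu : u ∈ ψ.repSet (Γ 0) U) :
    ψ.repVel Γ u = ψ.vert (velocity fun t => Γ t (ψ.base.symm u)) :=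
  (ψ.vert_velocity (mdifferentiableAt_curve h.pos h.isOpen h.smooth hu.2.1) hu.2.2).symm

/-- A continuous function that vanishes on the interior of a region vanishes on its boundary. -/
theorem IsRegion.eq_zero_of_interior (hD : IsRegion n D) {U : Set X}
    (hγ : IsSectionOn n m π γ U) (hDU : D ⊆ U) (ψ : FiberedChart n m π) {h : Eu n → ℝ}
    (hh : ContinuousOn h (ψ.repSet γ U))
    (h0 : ∀ x ∈ interior D, γ x ∈ ψ.tot.source → h (ψ.base x) = 0) :
    ∀ x ∈ D, γ x ∈ ψ.tot.source → h (ψ.base x) = 0 := by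
  intro x hx hxs
  by_contra hne
  have hxU := hDU hx
  have hc : ContinuousAt (fun z => h (ψ.base z)) x :=
    (hh.continuousAt ((ψ.isOpen_repSet hγ).mem_nhds (ψ.mem_repSet hγ hxU hxs))).comp
      (ψ.base.continuousAt (ψ.mem_base (hγ.2.2 x hxU) hxs))
  have h1 : ∀ᶠ z in 𝓝 x, h (ψ.base z) ≠ 0 := hc.eventually_ne hne
  have h2 : ∀ᶠ z in 𝓝 x, γ z ∈ ψ.tot.source := by
    filter_upwards [(isOpen_section_preimage hγ ψ.tot.open_source).mem_nhds ⟨hxU, hxs⟩] with z hz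
      using hz.2
  obtain ⟨z, hz, hz1, hz2⟩ := ((mem_closure_iff_frequently.1
    (hD.subset_closure_interior hx)).and_eventually (h1.and h2)).exists
  exact hz1 (h0 z hz hz2)

variable [IsManifold 𝓘(ℝ, Eu n × Eu m) ∞ Y]

theorem IsVariation.exists_isDeformation {ν : TangentField n m π D γ} {Γ : ℝ → X → Y}
    (h : IsVariation ν Γ) :
    ∃ ε U, IsDeformation n m π D ε U Γ ∧ (∀ x ∈ U, Γ 0 x = γ x) ∧
      ∀ ψ : FiberedChart n m π, ∀ u ∈ ψ.repSet (Γ 0) U, ψ.repVel Γ u = ν.comp ψ u := by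
  obtain ⟨ε, hε, U, hU, hDU, hΓ, hs, h0, hv⟩ := h
  have hdef : IsDeformation n m π D ε U Γ := IsDeformation.of_velocity hε hU hDU hΓ hs
    fun x hx hxD => ⟨γ x, by rw [hv x hx, ν.zero x fun h => hxD (interior_subset h)]⟩
  refine ⟨ε, U, hdef, h0, fun ψ u hu => ?_⟩
  rw [hdef.repVel_eq ψ hu, hv _ hu.2.1]
  rfl

variable [IsManifold 𝓘(ℝ, Eu n) ∞ X] [T2Space Y] [SigmaCompactSpace Y]

/-- The fundamental lemma of the calculus of variations, for fields along `γ`. In the family `F` the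
chart with index `x₀` is the only one that counts near `x₀`. -/
theorem eq_zero_of_integral_comp_mul_eq_zero (hπ : IsFibered n m π) (hD : IsCompact D) {U : Set X}
    (hγ : IsSectionOn n m π γ U) (hDU : D ⊆ U) {o : ∀ x : X, TopForm n x}
    (ho : IsOrientation D o) {F : ChartFamily n m π D} (hF : F.Adapted γ) {x₀ : X}
    (hx₀ : x₀ ∈ interior D) (hψ : γ x₀ ∈ (F.ψ x₀).tot.source) (hx₀F : x₀ ∈ F.s) {N : Set X}
    (hN : IsOpen N) (hxN : x₀ ∈ N) (hN1 : ∀ x ∈ N, x ∈ D → F.χ x₀ x = 1)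
    (hN0 : ∀ c ∈ F.s, c ≠ x₀ → ∀ x ∈ N, F.χ c x = 0) {g : X → Eu n → Fin m → ℝ}
    (hg : ∀ σ, ContinuousOn (fun u => g x₀ u σ) ((F.ψ x₀).repSet γ U))
    (H : ∀ κ : TangentField n m π D γ,
      F.integral o (fun c u => ∑ σ, κ.comp (F.ψ c) u σ * g c u σ) = 0) (σ : Fin m) :
    g x₀ ((F.ψ x₀).base x₀) σ = 0 := by
  classical
  have hsec : ∀ x ∈ D, π (γ x) = x := fun x hx => hγ.2.2 x (hDU hx)
  have hint : interior D ⊆ D := interior_subset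
  set ψ := F.ψ x₀ with hψd
  have hVo := ψ.isOpen_repSet hγ
  set N' : Set (Eu n) := ψ.repSet γ U ∩ (ψ.base.target ∩ ψ.base.symm ⁻¹' (N ∩ interior D)) with hN'
  have hN'o : IsOpen N' :=
    hVo.inter (ψ.base.symm.isOpen_inter_preimage (hN.inter isOpen_interior))
  have hb : x₀ ∈ ψ.base.source := ψ.mem_base (hsec _ (hint hx₀)) hψ
  have hu₀ : ψ.base x₀ ∈ N' := by
    refine ⟨ψ.mem_repSet hγ (hDU (hint hx₀)) hψ, ψ.base.map_source hb, ?_⟩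
    simpa only [mem_preimage, ψ.base.left_inv hb] using ⟨hxN, hx₀⟩
  have hsc : ContinuousOn (fun u => F.sgn o x₀ (ψ.base.symm u)) N' :=
    (continuousOn_comp_symm (continuousOn_sign_coeff ho ψ.base_mem)).mono
      fun u hu => ⟨hu.1.1, hint hu.2.2.2⟩
  have key := eq_zero_of_integral_mul_eq_zero hN'o (h := fun u =>
    F.sgn o x₀ (ψ.base.symm u) * g x₀ u σ)
    (hsc.mul ((hg σ).mono inter_subset_left)) (fun η hη hc hs => ?_) _ hu₀
  · refine (mul_eq_zero.1 key).resolve_left fun h => ?_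
    simp only [ψ.base.left_inv hb] at h
    exact coeff_ne_zero ψ.base_mem hb (ho.1 x₀ (hint hx₀)) (Real.sign_eq_zero_iff.1 h)
  -- the field with components `η e_σ`
  set ηv : Eu n → Eu m := fun u => η u • EuclideanSpace.single σ (1 : ℝ) with hηv
  have hηs : tsupport ηv ⊆ tsupport η := closure_mono fun u hu h => hu (by simp [hηv, h])
  have hη0 : ∀ u, u ∉ N' → η u = 0 := fun u hu =>
    image_eq_zero_of_notMem_tsupport fun h => hu (hs h)
  obtain ⟨κ, hκ, hκ0⟩ := ψ.exists_tangentField hπ hγ hDU (η := ηv) (hη.smul contDiff_const)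
    (hc.of_isClosed_subset (isClosed_tsupport _) hηs)
    (hηs.trans (hs.trans inter_subset_left)) (fun u _ hu => by
      simp only [hηv, hη0 u fun h => hu h.2.2.2, zero_smul])
  have h1 := H κ
  rw [ChartFamily.integral, Finset.sum_eq_single_of_mem x₀ hx₀F] at h1
  · rw [← h1, ← setIntegral_eq_integral_of_forall_compl_eq_zero (s := F.K x₀)]
    · refine setIntegral_congr_fun (hF.isCompact_K hsec hD hx₀F).measurableSet fun u hu => ?_
      have hu' := hF.symm_mem hsec hx₀F hu
      have hur : ψ.base (ψ.base.symm u) = u :=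
        ψ.base.right_inv (hF.K_subset hγ hDU hx₀F hu).1
      have h2 : κ.comp ψ u = ηv u := by
        rw [TangentField.comp, hκ _ hu'.2 (hF x₀ hx₀F _ hu'), hur]
      have h3 : ∑ τ, κ.comp ψ u τ * g x₀ u τ = η u * g x₀ u σ := by
        rw [h2, Finset.sum_eq_single σ]
        · simp [hηv]
        · intro τ _ hτ
          simp [hηv, hτ]
        · simp
      simp only [← hψd, h3]
      by_cases huN : u ∈ N'
      · have h4 : F.χ x₀ (ψ.base.symm u) = 1 := hN1 _ huN.2.2.1 hu'.2
        simp only [ChartFamily.weight, ← hψd, h4]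
        ring
      · simp only [hη0 u huN, zero_mul, mul_zero]
    · intro u hu
      have huN : u ∉ N' := fun h => hu ⟨ψ.base.symm u, ⟨subset_tsupport _ (by
        rw [Function.mem_support, hN1 _ h.2.2.1 (hint h.2.2.2)]
        exact one_ne_zero), hint h.2.2.2⟩, ψ.base.right_inv h.2.1⟩
      rw [hη0 u huN, zero_mul]
  · intro c hc hcx
    refine setIntegral_eq_zero_of_forall_eq_zero fun u hu => ?_
    have hu' := hF.symm_mem hsec hc hu
    set x := (F.ψ c).base.symm u with hx
    by_cases hxN : x ∈ N
    · rw [ChartFamily.weight, ← hx, hN0 c hc hcx x hxN, mul_zero, zero_mul]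
    · have h2 : κ.toFun x = 0 := hκ0 x hu'.2 fun hxs => by
        have hb' := ψ.mem_base (hsec x hu'.2) hxs
        simp only [hηv]
        rw [hη0 _ fun h => hxN (by simpa only [ψ.base.left_inv hb'] using h.2.2.1), zero_smul]
      have h3 : κ.comp (F.ψ c) u = 0 := by
        rw [TangentField.comp, ← hx, h2, (F.ψ c).vert_zero]
      simp [h3]

variable [T2Space X] [SigmaCompactSpace X]

/-- An extremal satisfies the Euler–Lagrange equations. -/
theorem IsExtremal.eulerExpr_eq_zero (hπ : IsFibered n m π) {l : Lagrangian n m π r}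
    (hD : IsRegion n D) {o : ∀ x : X, TopForm n x} (ho : IsOrientation D o) {U : Set X}
    (hγ : IsSectionOn n m π γ U) (hDU : D ⊆ U) (hext : IsExtremal l o D γ)
    (ψ : FiberedChart n m π) :
    ∀ x ∈ D, γ x ∈ ψ.tot.source → ∀ σ,
      eulerExpr (localDensity l.toFun ψ) (ψ.rep γ) (ψ.base x) σ = 0 := by
  have hcont : ∀ (ψ : FiberedChart n m π) (σ), ContinuousOn
      (fun u => eulerExpr (localDensity l.toFun ψ) (ψ.rep γ) u σ) (ψ.repSet γ U) := fun ψ σ =>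
    (contDiffOn_eulerExpr (ψ.isOpen_jetDomain r) (l.smooth ψ) (ψ.isOpen_repSet hγ)
      (ψ.contDiffOn_rep hγ) (fun u hu => ψ.jetCoord_rep_mem r hγ.2.2 hu) σ).continuousOn
  intro x hx hxs σ
  refine hD.eq_zero_of_interior hγ hDU ψ (hcont ψ σ) (fun x₀ hx₀ hψ => ?_) x hx hxs
  obtain ⟨F, hF, rfl, hx₀F, N, hN, hxN, hN1, hN0⟩ :=
    exists_chartFamily_at hπ hD.1 hγ hDU ψ (interior_subset hx₀) hψ
  refine eq_zero_of_integral_comp_mul_eq_zero hπ hD.1 hγ hDU ho hF hx₀ hψ hx₀F hN hxN hN1 hN0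
    (g := fun c u σ => eulerExpr (localDensity l.toFun (F.ψ c)) ((F.ψ c).rep γ) u σ)
    (hcont _) (fun κ => ?_) σ
  obtain ⟨ε, e, Ξ, he, hΞ⟩ := κ.exists_isFlow hπ hD.1 hγ hDU
  have hvar := he.isVariation hγ hDU hΞ
  obtain ⟨ε', U', hdef, h0, hrep⟩ := hvar.exists_isDeformation
  have hγ0 : (fun x => e 0 (γ x)) = γ := funext fun x => he.zero_time _
  have h1 := hdef.hasDerivAt_action_euler hπ l hD.1 ho (F := F) (by simpa only [hγ0] using hF)
  refine Eq.trans ?_ (h1.unique (hext κ _ hvar))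
  refine ChartFamily.integral_congr hF (fun x hx => hγ.2.2 x (hDU hx)) hD.1 o fun c hc u hu => ?_
  have hs0 := hdef.isSectionOn hdef.zero_mem
  rw [hrep (F.ψ c) u (ChartFamily.Adapted.K_subset (by simpa only [hγ0] using hF) hs0
    hdef.subset hc hu)]
  simp only [hγ0]

end Extremals


/-! ### The second variation and the Hessian -/

section Hessian

variable {n m r : ℕ} {X Y : Type*}
  [TopologicalSpace X] [ChartedSpace (Eu n) X]
  [TopologicalSpace Y] [ChartedSpace (Eu n × Eu m) Y]
  {π : Y → X} {D : Set X} {γ : X → Y}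

theorem FiberedChart.components_rep (ψ : FiberedChart n m π)
    (Ξ : ∀ y : Y, TangentSpace 𝓘(ℝ, Eu n × Eu m) y) {γ : X → Y} {U : Set X}
    (hγ : ∀ x ∈ U, π (γ x) = x) {u : Eu n} (hu : u ∈ ψ.repSet γ U) :
    ψ.components Ξ (u, ψ.rep γ u) = ψ.vert ⟨γ (ψ.base.symm u), Ξ (γ (ψ.base.symm u))⟩ := by
  change ψ.vert ⟨ψ.tot.symm (u, ψ.rep γ u), Ξ (ψ.tot.symm (u, ψ.rep γ u))⟩ = _
  rw [ψ.symm_rep hu.1 (hγ _ hu.2.1) hu.2.2]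

variable [IsManifold 𝓘(ℝ, Eu n × Eu m) ∞ Y]

theorem FiberedChart.contDiffOn_components (ψ : FiberedChart n m π)
    {Ξ : ∀ y : Y, TangentSpace 𝓘(ℝ, Eu n × Eu m) y}
    (hΞ : ContMDiff 𝓘(ℝ, Eu n × Eu m) (𝓘(ℝ, Eu n × Eu m).tangent) ∞
      (fun y => (⟨y, Ξ y⟩ : TangentBundle 𝓘(ℝ, Eu n × Eu m) Y))) :
    ContDiffOn ℝ ∞ (ψ.components Ξ) ψ.tot.target :=
  (ψ.contMDiffOn_vert (hΞ.comp_contMDiffOn (contMDiffOn_symm_of_mem_maximalAtlas ψ.tot_mem))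
    fun _ hq => ψ.tot.map_target hq).contDiffOn

theorem IsExtension.field_eq {Ξ : ∀ y : Y, TangentSpace 𝓘(ℝ, Eu n × Eu m) y}
    {ν : TangentField n m π D γ} (h : IsExtension Ξ ν) {x : X} (hx : π (γ x) = x) :
    Ξ (γ x) = ν.toFun x := by
  by_cases hxi : x ∈ interior D
  · exact h.extends_field x (interior_subset hxi)
  · rw [ν.zero x hxi, h.zero _ (by rwa [hx])]

theorem IsExtension.components_rep {Ξ : ∀ y : Y, TangentSpace 𝓘(ℝ, Eu n × Eu m) y}
    {ν : TangentField n m π D γ} (h : IsExtension Ξ ν) (ψ : FiberedChart n m π) {U : Set X}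
    (hγ : ∀ x ∈ U, π (γ x) = x) {u : Eu n} (hu : u ∈ ψ.repSet γ U) :
    ψ.components Ξ (u, ψ.rep γ u) = ν.comp ψ u := by
  rw [ψ.components_rep Ξ hγ hu, h.field_eq (hγ _ hu.2.1)]
  rfl

/-- The two families of deformations contained in a variation with two parameters. -/
theorem IsVariation₂.exists_isDeformation {Ξ₁ Ξ₂ : ∀ y : Y, TangentSpace 𝓘(ℝ, Eu n × Eu m) y}
    {ν κ : TangentField n m π D γ} {Γ : ℝ → ℝ → X → Y} (h : IsVariation₂ n m π D γ Ξ₁ Ξ₂ Γ)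
    (h₁ : IsExtension Ξ₁ ν) (h₂ : IsExtension Ξ₂ κ) :
    ∃ ε U, IsSectionOn n m π γ U ∧ (∀ x ∈ U, Γ 0 0 x = γ x) ∧
      IsDeformation n m π D ε U (fun t => Γ t 0) ∧
      (∀ t ∈ Ioo (-ε) ε, IsDeformation n m π D ε U (Γ t)) ∧
      (∀ ψ : FiberedChart n m π, ∀ u ∈ ψ.repSet (Γ 0 0) U,
        ψ.repVel (fun t => Γ t 0) u = ν.comp ψ u) ∧
      ∀ t ∈ Ioo (-ε) ε, ∀ ψ : FiberedChart n m π, ∀ u ∈ ψ.repSet (Γ t 0) U,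
        ψ.repVel (Γ t) u = ψ.components Ξ₂ (u, ψ.rep (Γ t 0) u) := by
  obtain ⟨ε, hε, U, hU, hDU, hΓ, hs, h00, hv₁, hv₂⟩ := h
  have hz : (0 : ℝ) ∈ Ioo (-ε) ε := ⟨neg_lt_zero.2 hε, hε⟩
  have hγs : ∀ x ∈ U, π (γ x) = x := fun x hx => by rw [← h00 x hx, hs 0 hz 0 hz x hx]
  have hΓ₁ : ContMDiffOn (𝓘(ℝ, ℝ).prod 𝓘(ℝ, Eu n)) 𝓘(ℝ, Eu n × Eu m) ∞
      (fun q : ℝ × X => Γ q.1 0 q.2) (Ioo (-ε) ε ×ˢ U) :=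
    hΓ.comp (((contMDiff_fst.prodMk contMDiff_const).prodMk contMDiff_snd).contMDiffOn)
      fun q hq => ⟨⟨hq.1, hz⟩, hq.2⟩
  have hΓ₂ : ∀ t ∈ Ioo (-ε) ε, ContMDiffOn (𝓘(ℝ, ℝ).prod 𝓘(ℝ, Eu n)) 𝓘(ℝ, Eu n × Eu m) ∞
      (fun q : ℝ × X => Γ t q.1 q.2) (Ioo (-ε) ε ×ˢ U) := fun t ht =>
    hΓ.comp (((contMDiff_const.prodMk contMDiff_fst).prodMk contMDiff_snd).contMDiffOn)
      fun q hq => ⟨⟨ht, hq.1⟩, hq.2⟩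
  have hd₁ : IsDeformation n m π D ε U (fun t => Γ t 0) :=
    IsDeformation.of_velocity hε hU hDU hΓ₁ (fun t ht => hs t ht 0 hz) fun x hx hxD =>
      ⟨γ x, by rw [hv₁ x hx, h₁.zero _ (by rw [hγs x hx]; exact fun h => hxD (interior_subset h))]⟩
  have hd₂ : ∀ t ∈ Ioo (-ε) ε, IsDeformation n m π D ε U (Γ t) := fun t ht =>
    IsDeformation.of_velocity hε hU hDU (hΓ₂ t ht) (hs t ht) fun x hx hxD =>
      ⟨Γ t 0 x, by
        rw [hv₂ t ht x hx,
          h₂.zero _ (by rw [hs t ht 0 hz x hx]; exact fun h => hxD (interior_subset h))]⟩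
  refine ⟨ε, U, ⟨hU, (hd₁.isSectionOn hz).2.1.congr fun x hx => (h00 x hx).symm, hγs⟩, h00, hd₁,
    hd₂, fun ψ u hu => ?_, fun t ht ψ u hu => ?_⟩
  · rw [hd₁.repVel_eq ψ hu, hv₁ _ hu.2.1, h₁.field_eq (hγs _ hu.2.1)]
    rfl
  · rw [(hd₂ t ht).repVel_eq ψ hu, hv₂ t ht _ hu.2.1, ψ.components_rep Ξ₂ (hs t ht 0 hz) hu]

/-- The second variation `∫_D κ^σ J_σ(ν) ds` along an extremal, where `J` is the linearization of
the Euler–Lagrange operator, computed in a family of charts. -/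
def ChartFamily.secondVariation (F : ChartFamily n m π D) (o : ∀ x : X, TopForm n x)
    (l : Lagrangian n m π r) (ν κ : TangentField n m π D γ) : ℝ :=
  F.integral o fun c u => ∑ σ, κ.comp (F.ψ c) u σ *
    linEuler (localDensity l.toFun (F.ψ c)) ((F.ψ c).rep γ) (ν.comp (F.ψ c)) u σ

theorem HasMixedDeriv.unique {F : ℝ → ℝ → ℝ} {h h' : ℝ} (H : HasMixedDeriv F h)
    (H' : HasMixedDeriv F h') : h = h' := by
  obtain ⟨g, hg, hd⟩ := H
  obtain ⟨g', hg', hd'⟩ := H'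
  refine hd.unique (hd'.congr_of_eventuallyEq ?_)
  filter_upwards [hg, hg'] with t ht ht' using ht.unique ht'

variable [IsManifold 𝓘(ℝ, Eu n) ∞ X] [T2Space X] [SigmaCompactSpace X]

theorem HasHessian.hessian_eq {l : Lagrangian n m π r} {o : ∀ x : X, TopForm n x}
    {ν κ : TangentField n m π D γ} {h : ℝ} (H : HasHessian l o ν κ h) : hessian l o ν κ = h := by
  have H' : HasHessian l o ν κ (hessian l o ν κ) := Classical.epsilon_spec ⟨h, H⟩
  obtain ⟨Ξ₁, Ξ₂, Γ, h₁, h₂, hΓ⟩ := H.1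
  exact (H'.2 Ξ₁ Ξ₂ Γ h₁ h₂ hΓ).unique (H.2 Ξ₁ Ξ₂ Γ h₁ h₂ hΓ)

variable [T2Space Y] [SigmaCompactSpace Y]

/-- The first variation formula for `t₂ ↦ Γ(t₁, t₂)` gives `∂A/∂t₂` at `t₂ = 0` as an integral of
`Ξ₂^σ E_σ(L)`; in its derivative with respect to `t₁` the factor `E_σ(L)` vanishes along the
extremal, which leaves the term with the derivative of `E_σ(L)`. -/
theorem IsVariation₂.hasMixedDeriv (hπ : IsFibered n m π) {l : Lagrangian n m π r}
    (hD : IsRegion n D) {o : ∀ x : X, TopForm n x} (ho : IsOrientation D o)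
    (hext : IsExtremal l o D γ) {F : ChartFamily n m π D} (hF : F.Adapted γ)
    {Ξ₁ Ξ₂ : ∀ y : Y, TangentSpace 𝓘(ℝ, Eu n × Eu m) y}
    {ν κ : TangentField n m π D γ} {Γ : ℝ → ℝ → X → Y} (h : IsVariation₂ n m π D γ Ξ₁ Ξ₂ Γ)
    (h₁ : IsExtension Ξ₁ ν) (h₂ : IsExtension Ξ₂ κ) :
    HasMixedDeriv (fun t₁ t₂ => action l o D (Γ t₁ t₂)) (F.secondVariation o l ν κ) := by
  obtain ⟨ε, U, hγ, h00, hd₁, hd₂, hv₁, hv₂⟩ := h.exists_isDeformation h₁ h₂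
  have hDU := hd₁.subset
  have hsec : ∀ x ∈ D, π (γ x) = x := fun x hx => hγ.2.2 x (hDU hx)
  have hF0 : F.Adapted (Γ 0 0) := hF.congr fun x hx => h00 x (hDU hx)
  have hs0 := hd₁.isSectionOn hd₁.zero_mem
  refine ⟨fun t => F.integral o fun c u => ∑ σ,
    (F.ψ c).components Ξ₂ (u, (F.ψ c).rep (Γ t 0) u) σ *
      eulerExpr (localDensity l.toFun (F.ψ c)) ((F.ψ c).rep (Γ t 0)) u σ, ?_, ?_⟩
  · filter_upwards [hd₁.eventually_adapted hD.1 hF0] with t ⟨ht, hFt⟩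
    refine ((hd₂ t ht).hasDerivAt_action_euler hπ l hD.1 ho hFt).congr_deriv ?_
    have hst := hd₁.isSectionOn ht
    refine ChartFamily.integral_congr hF hsec hD.1 o fun c hc u hu => ?_
    rw [hv₂ t ht (F.ψ c) u (hFt.K_subset hst hDU hc hu)]
  · have hsm : ∀ c σ, ContDiffOn ℝ ∞ (fun q : ℝ × Eu n =>
        (F.ψ c).components Ξ₂ (q.2, (F.ψ c).rep (Γ q.1 0) q.2) σ)
        ((F.ψ c).repDomain (fun t => Γ t 0) (Ioo (-ε) ε) U) := fun c σ =>
      (EuclideanSpace.proj σ : Eu m →L[ℝ] ℝ).contDiff.comp_contDiffOn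
        (((F.ψ c).contDiffOn_components h₂.smooth).comp
          (contDiffOn_snd.prodMk ((F.ψ c).contDiffOn_rep_param hd₁.smooth)) fun q hq =>
            (F.ψ c).rep_mem_target hq.2.1 (hd₁.isSection q.1 hq.1 _ hq.2.2.1) hq.2.2.2)
    have hmem : ∀ c ∈ F.s, ∀ u ∈ F.K c, ((0 : ℝ), u) ∈
        (F.ψ c).repDomain (fun t => Γ t 0) (Ioo (-ε) ε) U := fun c hc u hu =>
      hd₁.mem_repDomain _ (hF0.K_subset hs0 hDU hc hu)
    refine (ChartFamily.hasDerivAt_integral hF hsec hD.1 ho (g := fun c t u => ∑ σ,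
      (F.ψ c).components Ξ₂ (u, (F.ψ c).rep (Γ t 0) u) σ *
        eulerExpr (localDensity l.toFun (F.ψ c)) ((F.ψ c).rep (Γ t 0)) u σ)
      (fun c => hd₁.isOpen_repDomain (F.ψ c)) (fun c => ContDiffOn.sum fun σ _ => (hsm c σ).mul
        (contDiffOn_eulerExpr_param (g := fun t => (F.ψ c).rep (Γ t 0))
          ((F.ψ c).isOpen_jetDomain r) (l.smooth _) (hd₁.isOpen_repDomain _)
          ((F.ψ c).contDiffOn_rep_param hd₁.smooth) (hd₁.jetCoord_mem _ r) σ))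
      hmem).congr_deriv ?_
    refine ChartFamily.integral_congr hF hsec hD.1 o fun c hc u hu => ?_
    have huK := hF.K_subset hγ hDU hc hu
    have huD := (hF.symm_mem hsec hc hu).2
    have hrep : (F.ψ c).rep (Γ 0 0) =ᶠ[𝓝 u] (F.ψ c).rep γ :=
      (F.ψ c).rep_eventuallyEq hγ h00 huK
    have hvel : (F.ψ c).repVel (fun t => Γ t 0) =ᶠ[𝓝 u] ν.comp (F.ψ c) := by
      filter_upwards [((F.ψ c).isOpen_repSet hs0).mem_nhds
        (hF0.K_subset hs0 hDU hc hu)] with v hv using hv₁ _ v hv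
    have hE : ∀ σ, eulerExpr (localDensity l.toFun (F.ψ c)) ((F.ψ c).rep (Γ 0 0)) u σ = 0 := by
      intro σ
      have := hext.eulerExpr_eq_zero hπ hD ho hγ hDU (F.ψ c) _ huD huK.2.2 σ
      rwa [(F.ψ c).base.right_inv huK.1, ← eulerExpr_congr _ hrep] at this
    refine HasDerivAt.deriv (HasDerivAt.fun_sum fun σ _ => ?_)
    have ha := (((hsm c σ).contDiffAt ((hd₁.isOpen_repDomain _).mem_nhds
      (hmem c hc u hu))).differentiableAt (by simp)).comp (0 : ℝ) (f := fun t : ℝ => (t, u))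
        (by fun_prop)
    have hb := hasDerivAt_eulerExpr (g := fun t => (F.ψ c).rep (Γ t 0))
      ((F.ψ c).isOpen_jetDomain r) (l.smooth _) (hd₁.isOpen_repDomain _)
      ((F.ψ c).contDiffOn_rep_param hd₁.smooth) (hd₁.jetCoord_mem _ r) (hmem c hc u hu) σ
    refine (ha.hasDerivAt.mul hb).congr_deriv ?_
    rw [hE σ, mul_zero, zero_add]
    congr 1
    · simp only [Function.comp_apply, hrep.self_of_nhds]
      rw [h₂.components_rep (F.ψ c) hγ.2.2 huK]
    · exact linEuler_congr _ hrep hvel σ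

theorem TangentField.exists_isVariation₂ (hπ : IsFibered n m π) (hD : IsCompact D) {U : Set X}
    (hγ : IsSectionOn n m π γ U) (hDU : D ⊆ U) (ν κ : TangentField n m π D γ) :
    ∃ Ξ₁ Ξ₂ Γ, IsExtension Ξ₁ ν ∧ IsExtension Ξ₂ κ ∧ IsVariation₂ n m π D γ Ξ₁ Ξ₂ Γ := by
  obtain ⟨ε₁, e₁, Ξ₁, he₁, hΞ₁⟩ := ν.exists_isFlow hπ hD hγ hDU
  obtain ⟨ε₂, e₂, Ξ₂, he₂, hΞ₂⟩ := κ.exists_isFlow hπ hD hγ hDU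
  have hε := lt_min he₁.pos he₂.pos
  exact ⟨Ξ₁, Ξ₂, _, he₁.isExtension hπ hΞ₁, he₂.isExtension hπ hΞ₂,
    (he₁.mono hε (min_le_left _ _)).isVariation₂ (he₂.mono hε (min_le_right _ _)) hγ hDU⟩

theorem IsExtremal.hasHessian (hπ : IsFibered n m π) {l : Lagrangian n m π r}
    (hD : IsRegion n D) {o : ∀ x : X, TopForm n x} (ho : IsOrientation D o) {U : Set X}
    (hγ : IsSectionOn n m π γ U) (hDU : D ⊆ U) (hext : IsExtremal l o D γ)
    {F : ChartFamily n m π D} (hF : F.Adapted γ) (ν κ : TangentField n m π D γ) :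
    HasHessian l o ν κ (F.secondVariation o l ν κ) :=
  ⟨ν.exists_isVariation₂ hπ hD.1 hγ hDU κ, fun _ _ _ h₁ h₂ h =>
    h.hasMixedDeriv hπ hD ho hext hF h₁ h₂⟩

/-! ### Jacobi fields -/

/-- In the interior of the region, the Euler–Lagrange expression of `Ξ ⌟ E(λ)` along an extremal is
the linearized Euler–Lagrange expression in the direction of the field that `Ξ` extends. -/
theorem IsExtremal.eulerExpr_contractEuler_eq (hπ : IsFibered n m π) {l : Lagrangian n m π r}
    (hD : IsRegion n D) {o : ∀ x : X, TopForm n x} (ho : IsOrientation D o) {U : Set X}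
    (hγ : IsSectionOn n m π γ U) (hDU : D ⊆ U) (hext : IsExtremal l o D γ)
    {Ξ : ∀ y : Y, TangentSpace 𝓘(ℝ, Eu n × Eu m) y} {ν : TangentField n m π D γ}
    (hΞ : IsExtension Ξ ν) (ψ : FiberedChart n m π) {u : Eu n} (hu : u ∈ ψ.repSet γ U)
    (huD : ψ.base.symm u ∈ interior D) (σ : Fin m) :
    eulerExpr (contractEuler (ψ.components Ξ) (localDensity l.toFun ψ)) (ψ.rep γ) u σ =
      linEuler (localDensity l.toFun ψ) (ψ.rep γ) (ν.comp ψ) u σ := by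
  set N : Set (Eu n) := ψ.repSet γ U ∩ (ψ.base.target ∩ ψ.base.symm ⁻¹' interior D) with hNdef
  have hN : IsOpen N :=
    (ψ.isOpen_repSet hγ).inter (ψ.base.symm.isOpen_inter_preimage isOpen_interior)
  have huN : u ∈ N := ⟨hu, hu.1, huD⟩
  rw [eulerExpr_contractEuler ψ.tot.open_target (l.smooth ψ) (ψ.contDiffOn_components hΞ.smooth) hN
    ((ψ.contDiffOn_rep hγ).mono inter_subset_left)
    (fun v hv => ψ.rep_mem_target hv.1.1 (hγ.2.2 _ hv.1.2.1) hv.1.2.2) (fun v hv τ => ?_) u huN σ]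
  · refine linEuler_congr _ EventuallyEq.rfl ?_ σ
    filter_upwards [hN.mem_nhds huN] with v hv using hΞ.components_rep ψ hγ.2.2 hv.1
  · have := hext.eulerExpr_eq_zero hπ hD ho hγ hDU ψ _ (interior_subset hv.2.2) hv.1.2.2 τ
    rwa [ψ.base.right_inv hv.1.1] at this

theorem IsJacobiAlong.secondVariation_eq_zero (hπ : IsFibered n m π) {l : Lagrangian n m π r}
    (hD : IsRegion n D) {o : ∀ x : X, TopForm n x} (ho : IsOrientation D o) {U : Set X}
    (hγ : IsSectionOn n m π γ U) (hDU : D ⊆ U) (hext : IsExtremal l o D γ)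
    {F : ChartFamily n m π D} (hF : F.Adapted γ) {ν : TangentField n m π D γ}
    (hν : IsJacobiAlong l ν) (κ : TangentField n m π D γ) : F.secondVariation o l ν κ = 0 := by
  obtain ⟨Ξ, -, -, hΞ, -⟩ := ν.exists_isVariation₂ hπ hD.1 hγ hDU ν
  have hsec : ∀ x ∈ D, π (γ x) = x := fun x hx => hγ.2.2 x (hDU hx)
  have h0 : F.integral o (fun _ _ => 0) = 0 := by simp [ChartFamily.integral]
  rw [← h0]
  refine ChartFamily.integral_congr hF hsec hD.1 o fun c hc u hu => Finset.sum_eq_zero fun σ _ => ?_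
  have huK := hF.K_subset hγ hDU hc hu
  by_cases huD : (F.ψ c).base.symm u ∈ interior D
  · have := hν Ξ hΞ (F.ψ c) _ (interior_subset huD) huK.2.2 σ
    rw [(F.ψ c).base.right_inv huK.1,
      hext.eulerExpr_contractEuler_eq hπ hD ho hγ hDU hΞ (F.ψ c) huK huD] at this
    rw [this, mul_zero]
  · rw [κ.comp_eq_zero (F.ψ c) huD]
    exact zero_mul _

theorem IsExtremal.isJacobiAlong (hπ : IsFibered n m π) {l : Lagrangian n m π r}
    (hD : IsRegion n D) {o : ∀ x : X, TopForm n x} (ho : IsOrientation D o) {U : Set X}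
    (hγ : IsSectionOn n m π γ U) (hDU : D ⊆ U) (hext : IsExtremal l o D γ)
    {ν : TangentField n m π D γ} (hν : ∀ κ : TangentField n m π D γ, hessian l o ν κ = 0) :
    IsJacobiAlong l ν := by
  intro Ξ hΞ ψ x hx hxs σ
  obtain ⟨U', hγ', hDU', hνU⟩ := ν.exists_contDiffOn_comp hγ hDU
  have hΛ := contDiffOn_contractEuler ψ.tot.open_target (l.smooth ψ)
    (ψ.contDiffOn_components hΞ.smooth)
  refine hD.eq_zero_of_interior hγ' hDU' ψ (contDiffOn_eulerExpr
    (isOpen_jetDomain' ψ.tot.open_target (2 * r)) hΛ (ψ.isOpen_repSet hγ') (ψ.contDiffOn_rep hγ')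
    (fun u hu => ψ.jetCoord_rep_mem (2 * r) hγ'.2.2 hu) σ).continuousOn
    (fun x₀ hx₀ hψ => ?_) x hx hxs
  have hu₀ := ψ.mem_repSet hγ' (hDU' (interior_subset hx₀)) hψ
  have hb := ψ.mem_base (hγ'.2.2 _ (hDU' (interior_subset hx₀))) hψ
  rw [hext.eulerExpr_contractEuler_eq hπ hD ho hγ' hDU' hΞ ψ hu₀ (by rwa [ψ.base.left_inv hb])]
  obtain ⟨F, hF, rfl, hx₀F, N, hN, hxN, hN1, hN0⟩ :=
    exists_chartFamily_at hπ hD.1 hγ' hDU' ψ (interior_subset hx₀) hψ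
  refine eq_zero_of_integral_comp_mul_eq_zero hπ hD.1 hγ' hDU' ho hF hx₀ hψ hx₀F hN hxN hN1 hN0
    (g := fun c u σ => linEuler (localDensity l.toFun (F.ψ c)) ((F.ψ c).rep γ)
      (ν.comp (F.ψ c)) u σ) (fun σ => ?_) (fun κ => ?_) σ
  · exact (contDiffOn_linEuler ((F.ψ x₀).isOpen_jetDomain r) (l.smooth _)
      ((F.ψ x₀).isOpen_repSet hγ') ((F.ψ x₀).contDiffOn_rep hγ')
      (fun u hu => (F.ψ x₀).jetCoord_rep_mem r hγ'.2.2 hu) (hνU _) σ).continuousOn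
  · rw [← hν κ, (hext.hasHessian hπ hD ho hγ hDU hF ν κ).hessian_eq]
    rfl

end Hessian

end VarCalc

end

theorem mainTheorem6 {n m : ℕ} {X Y : Type*}
    [TopologicalSpace X] [ChartedSpace (VarCalc.Eu n) X]
    [IsManifold 𝓘(ℝ, VarCalc.Eu n) ∞ X] [T2Space X] [SigmaCompactSpace X]
    [TopologicalSpace Y] [ChartedSpace (VarCalc.Eu n × VarCalc.Eu m) Y]
    [IsManifold 𝓘(ℝ, VarCalc.Eu n × VarCalc.Eu m) ∞ Y] [T2Space Y] [SigmaCompactSpace Y]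
    (π : Y → X) (hπ : VarCalc.IsFibered n m π)
    {r : ℕ} (l : VarCalc.Lagrangian n m π r)
    (D : Set X) (hD : VarCalc.IsRegion n D)
    (o : ∀ x : X, VarCalc.TopForm n x) (ho : VarCalc.IsOrientation D o)
    (τ γ : X → Y) (hγ : γ ∈ VarCalc.sectionsRel n m π D τ)
    (hext : VarCalc.IsExtremal l o D γ)
    (ν : VarCalc.TangentField n m π D γ) :
    (∀ κ : VarCalc.TangentField n m π D γ, VarCalc.HasHessian l o ν κ (VarCalc.hessian l o ν κ)) ∧
      ((∀ κ : VarCalc.TangentField n m π D γ, VarCalc.hessian l o ν κ = 0) ↔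
        VarCalc.IsJacobiAlong l ν) := by
  obtain ⟨⟨U, hDU, hγU⟩, -⟩ := hγ
  obtain ⟨F, hF⟩ := VarCalc.exists_chartFamily hπ hD.1 hγU hDU
  have key := fun κ => hext.hasHessian hπ hD ho hγU hDU hF ν κ
  refine ⟨fun κ => ?_, fun h => hext.isJacobiAlong hπ hD ho hγU hDU h, fun h κ => ?_⟩
  · rw [(key κ).hessian_eq]
    exact key κ
  · rw [(key κ).hessian_eq, h.secondVariation_eq_zero hπ hD ho hγU hDU hext hF κ]
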